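/- All groups are abelian; $\mathbb{Z}_n$ denotes $\mathbb{Z}/n\mathbb{Z}$. A group $M$ is \emph{$N$-injective} (respectively \emph{$N$-pure-injective}) if every homomorphism $L\to M$ from a subgroup (respectively from a pure subgroup) $L\le N$ extends to a homomorphism $N\to M$; here $L$ is pure in $N$ if $nL=L\cap nN$ for every integer $n$. A group $N$ is \emph{pure-split} if each of its pure subgroups is a direct summand. A group $M$ is \emph{poor} if $M$ is $N$-injective only for semisimple $N$, and \emph{pi-poor} if $M$ is $N$-pure-injective only for pure-split $N$. A group is \emph{uniform} if it is nonzero and any two of its nonzero subgroups intersect nontrivially. Let $\{A_\gamma\mid\gamma\in\Gamma\}$ be a complete set of representatives of the isomorphism classes of uniform groups, and let $M=\bigoplus_{\gamma\in\Gamma}A_\gamma^{(\mathbb{N})}$. Fix a prime $p$ and let $V\le M$ be the sum of all those summands in this decomposition (the individual copies of the $A_\gamma$) that are isomorphic to $\mathbb{Z}_p$. Then $V$ is a direct summand of $M$, and whenever $M=V\oplus K$ for a subgroup $K\le M$, the group $K$ is pi-poor but not poor. On the other hand, the group $\bigoplus_{q\text{ prime}}\mathbb{Z}_q$ is poor but not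 pi-poor. Consequently neither of the two notions implies the other: there is a pi-poor group that is not poor, and there is a poor group that is not pi-poor. -/

import Mathlib

open scoped DirectSum

universe u v w

/-! Abelian groups are treated as `ℤ`-modules; a subgroup is a `Submodule ℤ`. -/

/-- `M` is `N`-injective: every homomorphism from a subgroup of `N` to `M` extends to `N`. -/
def IsRelInjective (M : Type u) [AddCommGroup M] [Module ℤ M]
    (N : Type v) [AddCommGroup N] [Module ℤ N] : Prop :=
  ∀ (L : Submodule ℤ N) (f : L →ₗ[ℤ] M), ∃ g : N →ₗ[ℤ] M, ∀ x : L, g x = f x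

/-- `L` is a pure subgroup of `N`: `nL = L ∩ nN` for every integer `n`. -/
def IsPureSubgroup {N : Type v} [AddCommGroup N] [Module ℤ N] (L : Submodule ℤ N) : Prop :=
  ∀ (n : ℤ) (y : N), n • y ∈ L → ∃ x ∈ L, n • x = n • y

/-- `M` is `N`-pure-injective: every homomorphism from a pure subgroup of `N` to `M`
extends to `N`. -/
def IsRelPureInjective (M : Type u) [AddCommGroup M] [Module ℤ M]
    (N : Type v) [AddCommGroup N] [Module ℤ N] : Prop :=
  ∀ L : Submodule ℤ N, IsPureSubgroup L →
    ∀ f : L →ₗ[ℤ] M, ∃ g : N →ₗ[ℤ] M, ∀ x : L, g x = f x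

/-- `N` is pure-split: every pure subgroup of `N` is a direct summand. -/
def IsPureSplit (N : Type v) [AddCommGroup N] [Module ℤ N] : Prop :=
  ∀ L : Submodule ℤ N, IsPureSubgroup L → ∃ C : Submodule ℤ N, IsCompl L C

/-- `M` is poor: `M` is `N`-injective only for semisimple `N`. The groups `N` range over an
arbitrary universe `v`. -/
def IsPoor (M : Type u) [AddCommGroup M] [Module ℤ M] : Prop :=
  ∀ (N : Type v) [AddCommGroup N] [Module ℤ N], IsRelInjective M N → IsSemisimpleModule ℤ N

/-- `M` is pi-poor: `M` is `N`-pure-injective only for pure-split `N`. The groups `N` range over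
an arbitrary universe `v`. -/
def IsPiPoor (M : Type u) [AddCommGroup M] [Module ℤ M] : Prop :=
  ∀ (N : Type v) [AddCommGroup N] [Module ℤ N], IsRelPureInjective M N → IsPureSplit N

/-- `U` is uniform: it is nonzero and any two nonzero subgroups meet nontrivially. -/
def IsUniformAbGroup (U : Type u) [AddCommGroup U] [Module ℤ U] : Prop :=
  Nontrivial U ∧ ∀ B C : Submodule ℤ U, B ≠ ⊥ → C ≠ ⊥ → B ⊓ C ≠ ⊥

/-- `(A γ)` is a complete set of representatives of the isomorphism classes of uniform
abelian groups: each `A γ` is uniform, each uniform group is isomorphic to some `A γ`, and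
distinct members are not isomorphic. (Uniform abelian groups are countable, so the universe
in which they are taken is immaterial.) -/
structure IsUniformRepresentatives {Γ : Type w} (A : Γ → Type u)
    [∀ γ, AddCommGroup (A γ)] : Prop where
  uniform : ∀ γ, IsUniformAbGroup (A γ)
  exists_equiv : ∀ (U : Type u) [AddCommGroup U], IsUniformAbGroup U → ∃ γ, Nonempty (U ≃+ A γ)
  eq_of_equiv : ∀ γ δ, Nonempty (A γ ≃+ A δ) → γ = δ

/-- The group `⨁_γ A_γ^(ℕ)`. -/
abbrev CountableCopiesSum {Γ : Type w} (A : Γ → Type u) [∀ γ, AddCommGroup (A γ)] :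
    Type (max w u) :=
  ⨁ γ : Γ, ⨁ _n : ℕ, A γ

open Classical in
/-- The `n`-th summand `A_γ` of `⨁_γ A_γ^(ℕ)`, as a subgroup. -/
noncomputable def copySummand {Γ : Type w} (A : Γ → Type u) [∀ γ, AddCommGroup (A γ)]
    (γ : Γ) (n : ℕ) : Submodule ℤ (CountableCopiesSum A) :=
  LinearMap.range
    ((DirectSum.lof ℤ Γ (fun γ => ⨁ _n : ℕ, A γ) γ).comp (DirectSum.lof ℤ ℕ (fun _ => A γ) n))

/-- The sum of all those summands of the decomposition `⨁_γ A_γ^(ℕ)` that are isomorphic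
to `ℤ/pℤ`. -/
noncomputable def primeSummands {Γ : Type w} (A : Γ → Type u) [∀ γ, AddCommGroup (A γ)]
    (p : ℕ) : Submodule ℤ (CountableCopiesSum A) :=
  ⨆ (γ : Γ) (n : ℕ) (_ : Nonempty (copySummand A γ n ≃+ ZMod p)), copySummand A γ n

/-! Suppose a complement `K` of `V` is `N`-pure-injective. Coordinates of `M` at summands other than
ℤ/pℤ vanish on `V`, so they survive in `K`. Hence a pointwise finite sequence of maps from a pure
subgroup of `N` into uniform groups other than ℤ/pℤ extends to such a sequence on `N`
(`HasFamilyExtension`). Losing ℤ/pℤ does no harm: ℤ/q^k with k ≥ 2, other primes, or subgroups of ℚ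
suffice.

This property forces `N` to be pure-split. Its engine is `HasFamilyExtension.false_of_sequence`: an
independent sequence that telescopes q-adically from one element x₀ would make infinitely many
extended coordinates nonzero at x₀. So primary components are bounded modulo divisible subgroups,
and a torsion-free `N` has no infinite sequence independent modulo q. In a torsion-free `N`,
rank-one pure subgroups are summands, and a reduced pure subgroup is exhausted by finitely many of
them. In general, when the primary components are bounded, torsion splits off from subgroups of
torsion-free rank one. Given a pure L, divide out its divisible part and then a maximal H with H ∩ L
= 0 and H + L pure. Boundedness makes the quotient by L torsion-free, the rank-one splitting leaves
no room outside L, and H is a complement.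

`K` is not poor: a uniform group with an element of order p not divisible by p is ℤ/pℤ, so elements
of order p in `K` are divisible by p. This makes `K` injective relative to the non-semisimple group
ℤ/p².

For ⨁ ℤ/q, maps into ℤ/q kill qN, so relative injectivity forces qx ∈ ℤq²x; all orders are then
squarefree and N is semisimple. Yet this group is pure-injective relative to ∏ ℤ/2^k, whose torsion
subgroup is pure but not a summand. -/

/-! ### Divisibility and purity -/

/-- A subgroup is divisible if it is divisible by every prime. -/
def IsDivisibleSubgroup {N : Type v} [AddCommGroup N] (D : Submodule ℤ N) : Prop :=
  ∀ r : ℕ, r.Prime → ∀ x ∈ D, ∃ y ∈ D, (r : ℤ) • y = x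

theorem forall_exists_zsmul_eq_of_prime {N : Type v} [AddCommGroup N] {D : Submodule ℤ N}
    (hD : IsDivisibleSubgroup D) (n : ℤ) (hn : n ≠ 0) : ∀ x ∈ D, ∃ y ∈ D, n • y = x := by
  have key : ∀ m : ℕ, m ≠ 0 → ∀ x ∈ D, ∃ y ∈ D, (m : ℤ) • y = x := by
    intro m
    induction m using Nat.recOnMul with
    | zero => intro h; exact absurd rfl h
    | one => intro _ x hx; exact ⟨x, hx, by simp⟩
    | prime r hr => intro _; exact hD r hr
    | mul a b iha ihb =>
      intro h x hx
      obtain ⟨y, hy, rfl⟩ := iha (left_ne_zero_of_mul h) x hx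
      obtain ⟨z, hz, rfl⟩ := ihb (right_ne_zero_of_mul h) y hy
      exact ⟨z, hz, by push_cast; rw [mul_smul]⟩
  intro x hx
  obtain ⟨y, hy, rfl⟩ := key n.natAbs (by simpa using hn) x hx
  rcases Int.natAbs_eq n with h | h
  · exact ⟨y, hy, by rw [← h]⟩
  · refine ⟨-y, D.neg_mem hy, ?_⟩
    rw [smul_neg, ← neg_smul]
    congr 1
    omega

/-- Homomorphisms into a divisible group extend. -/
theorem exists_extension_of_divisibleBy {N : Type v} [AddCommGroup N] {Q : Type u}
    [AddCommGroup Q] [DivisibleBy Q ℤ] (L : Submodule ℤ N) (f : L →ₗ[ℤ] Q) :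
    ∃ g : N →ₗ[ℤ] Q, ∀ x : L, g x = f x := by
  obtain ⟨g, hg⟩ := (Module.Baer.of_divisible Q).extension_property L.subtype
    L.injective_subtype f
  exact ⟨g, fun x => by rw [← hg]; rfl⟩

theorem IsDivisibleSubgroup.exists_isCompl {N : Type v} [AddCommGroup N] {D : Submodule ℤ N}
    (hD : IsDivisibleSubgroup D) : ∃ C, IsCompl D C := by
  classical
  have h : ∀ {n : ℤ} (_ : n ≠ 0), Function.Surjective (fun a : D => n • a) := by
    intro n hn x
    obtain ⟨y, hy, hxy⟩ := forall_exists_zsmul_eq_of_prime hD n hn x x.2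
    exact ⟨⟨y, hy⟩, Subtype.ext hxy⟩
  let _ : DivisibleBy D ℤ := divisibleByOfSMulRightSurj D ℤ h
  obtain ⟨g, hg⟩ := exists_extension_of_divisibleBy D LinearMap.id
  exact ⟨_, LinearMap.isCompl_of_proj (f := g) hg⟩

theorem isPureSubgroup_of_isDivisible {N : Type v} [AddCommGroup N] {D : Submodule ℤ N}
    (hD : IsDivisibleSubgroup D) : IsPureSubgroup D := by
  intro n y hy
  rcases eq_or_ne n 0 with rfl | hn
  · exact ⟨0, D.zero_mem, by simp⟩
  · exact forall_exists_zsmul_eq_of_prime hD n hn _ hy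

/-- Purity can be tested modulo a smaller pure subgroup. -/
theorem IsPureSubgroup.of_le {N : Type v} [AddCommGroup N] {L S : Submodule ℤ N}
    (hL : IsPureSubgroup L) (hLS : L ≤ S)
    (h : ∀ (n : ℤ) (y : N), n ≠ 0 → n • y ∈ S → ∃ x ∈ S, n • y - n • x ∈ L) :
    IsPureSubgroup S := by
  intro n y hy
  rcases eq_or_ne n 0 with rfl | hn
  · exact ⟨0, S.zero_mem, by simp⟩
  obtain ⟨x, hx, hxy⟩ := h n y hn hy
  rw [← smul_sub] at hxy
  obtain ⟨l, hl, hl'⟩ := hL n _ hxy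
  refine ⟨x + l, S.add_mem hx (hLS hl), ?_⟩
  rw [smul_add, hl', smul_sub]; abel

theorem isPureSubgroup_of_torsionFree_quotient {N : Type v} [AddCommGroup N] {L : Submodule ℤ N}
    (h : ∀ (n : ℤ) (y : N), n ≠ 0 → n • y ∈ L → y ∈ L) : IsPureSubgroup L := by
  intro n y hy
  rcases eq_or_ne n 0 with rfl | hn
  · exact ⟨0, L.zero_mem, by simp⟩
  · exact ⟨y, h n y hn hy, rfl⟩

theorem IsPureSubgroup.map_subtype {N : Type v} [AddCommGroup N] {S : Submodule ℤ N}
    (hS : IsPureSubgroup S) {L : Submodule ℤ S} (hL : IsPureSubgroup L) :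
    IsPureSubgroup (L.map S.subtype) := by
  rintro n y ⟨l, hl, hly⟩
  obtain ⟨x, hx, hxy⟩ := hS n y (by rw [← hly]; exact l.2)
  have : n • (⟨x, hx⟩ : S) = l := Subtype.ext (by rw [← hly] at hxy; exact hxy)
  obtain ⟨z, hz, hzx⟩ := hL n ⟨x, hx⟩ (by rw [this]; exact hl)
  exact ⟨z, ⟨z, hz, rfl⟩, by rw [← hxy]; exact congrArg Subtype.val hzx⟩

theorem IsPureSubgroup.comap_mkQ {N : Type v} [AddCommGroup N] {S : Submodule ℤ N}
    (hS : IsPureSubgroup S) {L : Submodule ℤ (N ⧸ S)} (hL : IsPureSubgroup L) :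
    IsPureSubgroup (L.comap S.mkQ) := by
  refine hS.of_le (fun x hx => ?_) fun n y _ hy => ?_
  · rw [Submodule.mem_comap, Submodule.mkQ_apply, (Submodule.Quotient.mk_eq_zero S).2 hx]
    exact L.zero_mem
  · obtain ⟨x, hx, hxy⟩ := hL n (S.mkQ y) (by rw [← map_smul]; exact hy)
    obtain ⟨x, rfl⟩ := S.mkQ_surjective x
    refine ⟨x, hx, ?_⟩
    rw [← Submodule.Quotient.mk_eq_zero S, ← Submodule.mkQ_apply, map_sub, map_smul, map_smul, hxy,
      sub_self]

theorem IsPureSubgroup.map_mkQ {N : Type v} [AddCommGroup N] {S L : Submodule ℤ N}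
    (hSL : S ≤ L) (hL : IsPureSubgroup L) : IsPureSubgroup (L.map S.mkQ) := by
  intro n y hy
  obtain ⟨y, rfl⟩ := S.mkQ_surjective y
  rw [← map_smul, ← Submodule.mem_comap, Submodule.comap_map_mkQ, sup_eq_right.2 hSL] at hy
  obtain ⟨x, hx, hxy⟩ := hL n y hy
  exact ⟨S.mkQ x, ⟨x, hx, rfl⟩, by rw [← map_smul, ← map_smul, hxy]⟩

/-! ### Extension of families of homomorphisms into uniform groups -/

/-- Uniform groups other than `ℤ/pℤ`. -/
def IsUniformNe (p : ℕ) (U : Type) [AddCommGroup U] : Prop :=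
  IsUniformAbGroup U ∧ ¬ Nonempty (U ≃+ ZMod p)

/-- Pointwise finitely supported sequences of homomorphisms from a pure subgroup of `N` into
uniform groups other than `ℤ/pℤ` extend to pointwise finitely supported sequences on `N`. -/
def HasFamilyExtension (p : ℕ) (N : Type v) [AddCommGroup N] : Prop :=
  ∀ W : Submodule ℤ N, IsPureSubgroup W → ∀ (U : ℕ → Type) [∀ n, AddCommGroup (U n)],
    (∀ n, IsUniformNe p (U n)) → ∀ f : ∀ n, W →ₗ[ℤ] U n, (∀ x, {n | f n x ≠ 0}.Finite) →
      ∃ g : ∀ n, N →ₗ[ℤ] U n, (∀ n (x : W), g n x = f n x) ∧ ∀ x, {n | g n x ≠ 0}.Finite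

namespace HasFamilyExtension

variable {p : ℕ} {N : Type v} [AddCommGroup N]

theorem subgroup (h : HasFamilyExtension p N) {S : Submodule ℤ N} (hS : IsPureSubgroup S) :
    HasFamilyExtension p S := by
  intro W hW U _ hU f hf
  let e := Submodule.equivMapOfInjective S.subtype S.injective_subtype W
  obtain ⟨g, hg, hgf⟩ := h _ (hS.map_subtype hW) U hU (fun n => (f n).comp e.symm.toLinearMap)
    (fun x => hf (e.symm x))
  refine ⟨fun n => (g n).comp S.subtype, fun n x => ?_, fun x => hgf x⟩
  have := hg n (e x)
  simpa [e] using this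

/-- Preimages of pure subgroups are pure, and the pulled-back maps vanish on `S`; hence so do their
extensions, which therefore descend. -/
theorem quotient (h : HasFamilyExtension p N) {S : Submodule ℤ N} (hS : IsPureSubgroup S) :
    HasFamilyExtension p (N ⧸ S) := by
  intro W hW U _ hU f hf
  obtain ⟨g, hg, hgf⟩ := h _ (hS.comap_mkQ hW) U hU
    (fun n => (f n).comp (S.mkQ.restrict (p := W.comap S.mkQ) (q := W) fun _ hx => hx))
    (fun x => hf _)
  have hker : ∀ n, S ≤ LinearMap.ker (g n) := by
    intro n x hx
    have hx0 : S.mkQ x = 0 := (Submodule.Quotient.mk_eq_zero S).2 hx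
    have := hg n ⟨x, by rw [Submodule.mem_comap, hx0]; exact W.zero_mem⟩
    rw [LinearMap.mem_ker, this, LinearMap.comp_apply]
    convert map_zero (f n)
    exact Subtype.ext hx0
  refine ⟨fun n => S.liftQ (g n) (hker n), ?_, ?_⟩
  · rintro n ⟨x, hx⟩
    obtain ⟨x, rfl⟩ := S.mkQ_surjective x
    exact hg n ⟨x, hx⟩
  · intro x
    obtain ⟨x, rfl⟩ := S.mkQ_surjective x
    exact hgf x

end HasFamilyExtension

/-! ### Homomorphisms into finite cyclic groups -/

theorem natCast_zsmul_coe_inv (n : ℕ) :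
    n • (((n : ℚ)⁻¹ : ℚ) : AddCircle (1 : ℚ)) = 0 := by
  rcases eq_or_ne n 0 with rfl | hn
  · simp
  · rw [← AddCircle.coe_nsmul, AddCircle.coe_eq_zero_iff]
    exact ⟨1, by simp [mul_inv_cancel₀ (Nat.cast_ne_zero (R := ℚ).mpr hn)]⟩

/-- The embedding of `ℤ/nℤ` into `ℚ/ℤ`. -/
noncomputable def zmodToAddCircle (n : ℕ) : ZMod n →ₗ[ℤ] AddCircle (1 : ℚ) :=
  (ZMod.lift n ⟨(zmultiplesHom (AddCircle (1 : ℚ))) ((n : ℚ)⁻¹ : ℚ), by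
    simpa using natCast_zsmul_coe_inv n⟩).toIntLinearMap

theorem zmodToAddCircle_intCast (n : ℕ) (m : ℤ) :
    zmodToAddCircle n (m : ZMod n) = ((m * (n : ℚ)⁻¹ : ℚ) : AddCircle (1 : ℚ)) := by
  have := ZMod.lift_coe n ⟨(zmultiplesHom (AddCircle (1 : ℚ))) ((n : ℚ)⁻¹ : ℚ), by
    simpa using natCast_zsmul_coe_inv n⟩ m
  refine this.trans ?_
  simp only [zmultiplesHom_apply]
  rw [← AddCircle.coe_zsmul, zsmul_eq_mul]

theorem zmodToAddCircle_injective {n : ℕ} (hn : n ≠ 0) :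
    Function.Injective (zmodToAddCircle n) := by
  rw [injective_iff_map_eq_zero]
  intro a ha
  obtain ⟨m, rfl⟩ := ZMod.intCast_surjective a
  rw [zmodToAddCircle_intCast, AddCircle.coe_eq_zero_iff] at ha
  obtain ⟨k, hk⟩ := ha
  rw [ZMod.intCast_zmod_eq_zero_iff_dvd] 
  refine ⟨k, ?_⟩
  have hn' : (n : ℚ) ≠ 0 := by exact_mod_cast hn
  field_simp at hk
  have : (k : ℚ) * n = m := by simpa using hk
  have h2 : k * n = m := by exact_mod_cast this
  rw [← h2, mul_comm]

theorem exists_zmodToAddCircle_eq {n : ℕ} (hn : n ≠ 0) (x : AddCircle (1 : ℚ))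
    (hx : (n : ℤ) • x = 0) : ∃ a, zmodToAddCircle n a = x := by
  induction x using QuotientAddGroup.induction_on with
  | H r =>
    have hx' : ((((n : ℤ) • r : ℚ)) : AddCircle (1 : ℚ)) = 0 := hx
    rw [AddCircle.coe_eq_zero_iff] at hx'
    obtain ⟨k, hk⟩ := hx'
    have hn' : (n : ℚ) ≠ 0 := by exact_mod_cast hn
    refine ⟨(k : ZMod n), ?_⟩
    rw [zmodToAddCircle_intCast]
    congr 1
    simp at hk
    rw [hk]; field_simp

/-- A homomorphism into the `n`-torsion of `ℚ/ℤ` comes from one into `ℤ/nℤ`. -/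
theorem exists_lift_zmod {n : ℕ} (hn : n ≠ 0) {N : Type v} [AddCommGroup N]
    (h : N →ₗ[ℤ] AddCircle (1 : ℚ)) (hh : ∀ x, (n : ℤ) • h x = 0) :
    ∃ g : N →ₗ[ℤ] ZMod n, ∀ x, zmodToAddCircle n (g x) = h x := by
  let e := LinearEquiv.ofInjective _ (zmodToAddCircle_injective hn)
  refine ⟨e.symm.toLinearMap.comp (h.codRestrict _ fun x => exists_zmodToAddCircle_eq hn _ (hh x)),
    fun x => ?_⟩
  have := e.apply_symm_apply
    (h.codRestrict _ (fun x => exists_zmodToAddCircle_eq hn _ (hh x)) x)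
  exact congrArg Subtype.val this

theorem zsmul_zmod_self (n : ℕ) (a : ZMod n) : (n : ℤ) • a = 0 := by
  simp

/-- A homomorphism `f : P → ℤ/nℤ` factors through `i : P → N` if it vanishes on `i⁻¹(nN)`. -/
theorem exists_factor_zmod {n : ℕ} (hn : n ≠ 0) {N : Type v} [AddCommGroup N]
    {P : Type w} [AddCommGroup P] (i : P →ₗ[ℤ] N) (f : P →ₗ[ℤ] ZMod n)
    (hf : ∀ (x : P) (y : N), (n : ℤ) • y = i x → f x = 0) :
    ∃ g : N →ₗ[ℤ] ZMod n, ∀ x : P, g (i x) = f x := by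
  -- Extending over N/nN, by injectivity of ℚ/ℤ, keeps the values in the n-torsion of ℚ/ℤ, which is
  -- ℤ/nℤ.
  let S : Submodule ℤ N := LinearMap.range (LinearMap.lsmul ℤ N (n : ℤ))
  let φ : P →ₗ[ℤ] N ⧸ S := S.mkQ.comp i
  have hφ : LinearMap.ker φ ≤ LinearMap.ker f := by
    intro x hx
    rw [LinearMap.mem_ker] at hx
    obtain ⟨y, hy⟩ := (Submodule.Quotient.mk_eq_zero S).1 hx
    exact hf x y hy
  have hinj : Function.Injective ((LinearMap.ker φ).liftQ φ le_rfl) := by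
    rw [← LinearMap.ker_eq_bot, Submodule.ker_liftQ_eq_bot']
    rfl
  obtain ⟨h, hh⟩ := (Module.Baer.of_divisible (AddCircle (1 : ℚ))).extension_property
    _ hinj ((zmodToAddCircle n).comp ((LinearMap.ker φ).liftQ f hφ))
  obtain ⟨g, hg⟩ := exists_lift_zmod hn (h.comp S.mkQ) (fun x => by
    rw [← map_smul, LinearMap.comp_apply]
    convert map_zero h
    exact (Submodule.Quotient.mk_eq_zero S).2 ⟨x, rfl⟩)
  refine ⟨g, fun x => zmodToAddCircle_injective hn ?_⟩
  rw [hg]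
  exact congrArg (fun k => k (Submodule.Quotient.mk x)) hh

/-- A character of N/nN detects the nonzero class of `t`; being killed by n, it takes values in
ℤ/nℤ. -/
theorem exists_zmod_ne_zero {n : ℕ} (hn : n ≠ 0) {N : Type v} [AddCommGroup N] (t : N)
    (ht : ∀ y, (n : ℤ) • y ≠ t) : ∃ g : N →ₗ[ℤ] ZMod n, g t ≠ 0 := by
  let S : Submodule ℤ N := LinearMap.range (LinearMap.lsmul ℤ N (n : ℤ))
  have h0 : S.mkQ t ≠ 0 := by
    intro h
    obtain ⟨y, hy⟩ := (Submodule.Quotient.mk_eq_zero S).1 h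
    exact ht y hy
  obtain ⟨c, hc⟩ := CharacterModule.exists_character_apply_ne_zero_of_ne_zero h0
  let h : (N ⧸ S) →ₗ[ℤ] AddCircle (1 : ℚ) := AddMonoidHom.toIntLinearMap c
  obtain ⟨g, hg⟩ := exists_lift_zmod hn (h.comp S.mkQ) (fun x => by
    rw [← map_smul, LinearMap.comp_apply]
    convert map_zero h
    exact (Submodule.Quotient.mk_eq_zero S).2 ⟨x, rfl⟩)
  refine ⟨g, fun h0 => hc ?_⟩
  have := hg t
  rw [h0, map_zero] at this
  exact this.symm

/-! ### Uniform groups -/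

theorem isUniformAbGroup_iff {U : Type u} [AddCommGroup U] :
    IsUniformAbGroup U ↔ Nontrivial U ∧ ∀ x y : U, x ≠ 0 → y ≠ 0 →
      ∃ a b : ℤ, a • x = b • y ∧ a • x ≠ 0 := by
  refine and_congr_right fun _ => ⟨fun h x y hx hy => ?_, fun h B C hB hC => ?_⟩
  · have := h (Submodule.span ℤ {x}) (Submodule.span ℤ {y}) (by simpa using hx) (by simpa using hy)
    obtain ⟨z, hz, hz0⟩ := Submodule.exists_mem_ne_zero_of_ne_bot this
    obtain ⟨a, rfl⟩ := Submodule.mem_span_singleton.1 hz.1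
    obtain ⟨b, hb⟩ := Submodule.mem_span_singleton.1 hz.2
    exact ⟨a, b, hb.symm, hz0⟩
  · obtain ⟨x, hx, hx0⟩ := Submodule.exists_mem_ne_zero_of_ne_bot hB
    obtain ⟨y, hy, hy0⟩ := Submodule.exists_mem_ne_zero_of_ne_bot hC
    obtain ⟨a, b, hab, ha⟩ := h x y hx0 hy0
    intro hbot
    have : a • x ∈ B ⊓ C := ⟨B.smul_mem _ hx, hab ▸ C.smul_mem _ hy⟩
    rw [hbot] at this
    exact ha this

theorem IsUniformAbGroup.of_equiv {U : Type u} {V : Type v} [AddCommGroup U] [AddCommGroup V]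
    (h : IsUniformAbGroup U) (e : U ≃+ V) : IsUniformAbGroup V := by
  rw [isUniformAbGroup_iff] at h ⊢
  obtain ⟨_, h⟩ := h
  refine ⟨e.symm.toEquiv.nontrivial, fun x y hx hy => ?_⟩
  obtain ⟨a, b, hab, ha⟩ := h (e.symm x) (e.symm y) (by simpa using hx) (by simpa using hy)
  rw [← map_zsmul, ← map_zsmul] at hab
  exact ⟨a, b, e.symm.injective hab, fun h0 => ha (by rw [← map_zsmul, h0, map_zero])⟩

/-- By Bézout, q^(k-1) is a multiple of every nonzero element. -/
theorem isUniformAbGroup_zmod_prime_pow {q : ℕ} (hq : q.Prime) {k : ℕ} (hk : k ≠ 0) :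
    IsUniformAbGroup (ZMod (q ^ k)) := by
  rw [isUniformAbGroup_iff]
  have : Fact (1 < q ^ k) := ⟨Nat.one_lt_pow hk hq.one_lt⟩
  have key : ∀ x : ZMod (q ^ k), x ≠ 0 → ∃ a : ℤ, a • x = ((q : ℤ) ^ (k - 1) : ℤ) := by
    intro x hx
    obtain ⟨m, rfl⟩ := ZMod.intCast_surjective x
    have hm : ¬ ((q ^ k : ℕ) : ℤ) ∣ m := by
      rwa [← ZMod.intCast_zmod_eq_zero_iff_dvd]
    have hg : (Int.gcd m (q ^ k : ℕ)) ∣ q ^ k := by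
      exact_mod_cast Int.gcd_dvd_right m (q ^ k : ℕ)
    obtain ⟨i, hi, hgi⟩ := (Nat.dvd_prime_pow hq).1 hg
    have hik : i ≤ k - 1 := by
      by_contra hcon
      have : i = k := by omega
      subst this
      apply hm
      rw [← hgi]; exact Int.gcd_dvd_left ..
    have hdvd : (Int.gcd m (q ^ k : ℕ) : ℤ) ∣ (q : ℤ) ^ (k - 1) := by
      rw [hgi]; push_cast; exact pow_dvd_pow _ hik
    obtain ⟨c, hc⟩ := hdvd
    refine ⟨c * Int.gcdA m (q ^ k : ℕ), ?_⟩
    rw [hc, Int.gcd_eq_gcd_ab]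
    push_cast
    have h0 : ((q : ZMod (q ^ k)) ^ k) = 0 := by exact_mod_cast ZMod.natCast_self (q ^ k)
    rw [h0, zsmul_eq_mul]; push_cast; ring
  refine ⟨inferInstance, fun x y hx hy => ?_⟩
  obtain ⟨a, ha⟩ := key x hx
  obtain ⟨b, hb⟩ := key y hy
  refine ⟨a, b, by rw [ha, hb], ?_⟩
  rw [ha, Ne, ZMod.intCast_zmod_eq_zero_iff_dvd]
  push_cast
  intro h
  have h' : q ^ k ∣ q ^ (k - 1) := by exact_mod_cast h
  have := (Nat.pow_dvd_pow_iff_le_right hq.one_lt).1 h'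
  omega

theorem isUniformNe_zmod_prime_pow {p q : ℕ} (hq : q.Prime) {k : ℕ} (hk : k ≠ 0)
    (h : q ^ k ≠ p) : IsUniformNe p (ZMod (q ^ k)) := by
  refine ⟨isUniformAbGroup_zmod_prime_pow hq hk, ?_⟩
  rintro ⟨e⟩
  have := Nat.card_congr e.toEquiv
  rw [Nat.card_zmod, Nat.card_zmod] at this
  exact h this

theorem isUniformNe_rat_submodule {p : ℕ} (hp : p.Prime) {S : Submodule ℤ ℚ} (hS : S ≠ ⊥) :
    IsUniformNe p S := by
  obtain ⟨x, hx, hx0⟩ := Submodule.exists_mem_ne_zero_of_ne_bot hS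
  refine ⟨isUniformAbGroup_iff.2 ⟨⟨⟨⟨x, hx⟩, 0, fun h => hx0 (congrArg Subtype.val h)⟩⟩, ?_⟩, ?_⟩
  · rintro ⟨y, hy⟩ ⟨z, hz⟩ hy0 hz0
    have hy0' : y ≠ 0 := fun h => hy0 (Subtype.ext h)
    have hz0' : z ≠ 0 := fun h => hz0 (Subtype.ext h)
    -- Both sides equal the product of the numerators.
    have e1 : (z.num * y.den : ℤ) • y = (y.num * z.den : ℤ) • z := by
      simp only [zsmul_eq_mul]
      push_cast
      have h1 := Rat.mul_den_eq_num y
      have h2 := Rat.mul_den_eq_num z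
      linear_combination (z.num : ℚ) * h1 - y.num * h2
    refine ⟨z.num * y.den, y.num * z.den, Subtype.ext e1, fun h => ?_⟩
    have h' : (z.num * y.den : ℤ) • y = 0 := congrArg Subtype.val h
    have := smul_eq_zero.1 h'
    simp [hy0', hz0'] at this
  · rintro ⟨e⟩
    have h1 : (p : ℤ) • (⟨x, hx⟩ : S) = 0 := e.injective (by rw [map_zsmul, map_zero]; simp)
    have h2 : (p : ℤ) • x = 0 := congrArg Subtype.val h1
    have := smul_eq_zero.1 h2
    simp [hx0, hp.ne_zero] at this

/-! ### Independent sequences and the basic contradiction -/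

section Sequences

variable {p : ℕ} {N : Type v} [AddCommGroup N]

open Finsupp (linearCombination)

/-- The span of `w` is pure at q: coefficients divisible by q^j are divided, and the other terms
vanish, so their coefficients may be replaced by 0. -/
theorem zsmul_linearCombination_of_dvd {q : ℕ} {w : ℕ → N} {k : ℕ → ℕ}
    (hw : ∀ (c : ℕ →₀ ℤ) (j : ℕ) (y : N), (q : ℤ) ^ j • y = linearCombination ℤ w c →
      ∀ i, (q : ℤ) ^ j ∣ c i ∨ ((q : ℤ) ^ k i ∣ c i ∧ (q : ℤ) ^ k i • w i = 0))
    (c : ℕ →₀ ℤ) (j : ℕ) (y : N) (hy : (q : ℤ) ^ j • y = linearCombination ℤ w c) :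
    ∃ c', (q : ℤ) ^ j • linearCombination ℤ w c' = linearCombination ℤ w c := by
  classical
  let c' : ℕ →₀ ℤ := c.mapRange (fun a => if (q : ℤ) ^ j ∣ a then a / (q : ℤ) ^ j else 0) (by simp)
  refine ⟨c', ?_⟩
  rw [← map_smul, ← sub_eq_zero, ← map_sub, Finsupp.linearCombination_apply]
  refine Finset.sum_eq_zero fun i _ => ?_
  by_cases hd : (q : ℤ) ^ j ∣ c i
  · have : ((q : ℤ) ^ j • c' - c) i = 0 := by
      simp only [c', Finsupp.sub_apply, Finsupp.smul_apply, Finsupp.mapRange_apply, if_pos hd,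
        smul_eq_mul, Int.mul_ediv_cancel' hd, sub_self]
    simp only [this, zero_smul]
  · obtain ⟨⟨d, hd1⟩, hd2⟩ := (hw c j y hy i).resolve_left hd
    have : ((q : ℤ) ^ j • c' - c) i = - c i := by
      simp only [c', Finsupp.sub_apply, Finsupp.smul_apply, Finsupp.mapRange_apply, if_neg hd,
        smul_zero, zero_sub]
    simp only [this]
    rw [hd1, mul_comm, neg_smul, mul_smul, hd2, smul_zero, neg_zero]

/-- The elements of which a multiple prime to `q` lies in `S`. -/
def primeToClosure (q : ℕ) (S : Submodule ℤ N) : Submodule ℤ N where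
  carrier := {z | ∃ m : ℤ, IsCoprime m (q : ℤ) ∧ m • z ∈ S}
  zero_mem' := ⟨1, isCoprime_one_left, by simp⟩
  add_mem' := by
    rintro a b ⟨m, hm, hma⟩ ⟨n, hn, hnb⟩
    refine ⟨m * n, hm.mul_left hn, ?_⟩
    rw [smul_add]
    refine S.add_mem ?_ ?_
    · rw [mul_comm, mul_smul]; exact S.smul_mem _ hma
    · rw [mul_smul]; exact S.smul_mem _ hnb
  smul_mem' := by
    rintro c a ⟨m, hm, hma⟩
    exact ⟨m, hm, by rw [smul_comm]; exact S.smul_mem _ hma⟩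

theorem exists_eq_prime_pow_mul {q : ℕ} (hq : q.Prime) {n : ℤ} (hn : n ≠ 0) :
    ∃ (j : ℕ) (m : ℤ), IsCoprime m (q : ℤ) ∧ n = (q : ℤ) ^ j * m := by
  have hq' : Prime (q : ℤ) := Nat.prime_iff_prime_int.1 hq
  have hf : FiniteMultiplicity (q : ℤ) n :=
    Int.finiteMultiplicity_iff.2 ⟨by simpa using hq.ne_one, hn⟩
  obtain ⟨m, hm, hm'⟩ := hf.exists_eq_pow_mul_and_not_dvd
  exact ⟨_, m, (hq'.coprime_iff_not_dvd.2 hm').symm, hm⟩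

/-- The closure has division by integers prime to q built in, so purity at q becomes purity. A map
into ℤ/q^k is still determined on the closure by its values on `S`. -/
theorem isPureSubgroup_primeToClosure {q : ℕ} (hq : q.Prime) {S : Submodule ℤ N}
    (hS : ∀ (j : ℕ) (y : N), (q : ℤ) ^ j • y ∈ S → ∃ s ∈ S, (q : ℤ) ^ j • s = (q : ℤ) ^ j • y) :
    IsPureSubgroup (primeToClosure q S) := by
  rintro n y ⟨m, hm, hmy⟩
  rcases eq_or_ne n 0 with rfl | hn
  · exact ⟨0, Submodule.zero_mem _, by simp⟩
  obtain ⟨j, m', hm', rfl⟩ := exists_eq_prime_pow_mul hq hn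
  obtain ⟨s, hs, hsy⟩ := hS j ((m * m') • y) (by
    rw [smul_smul] at hmy ⊢; convert hmy using 2; ring)
  obtain ⟨a, b, hab⟩ : IsCoprime (m * m') ((q : ℤ) ^ j) := (hm.mul_left hm').pow_right
  -- After multiplication by q^j, s becomes m m' y, so by Bézout this combination becomes y.
  refine ⟨a • s + (b * (q : ℤ) ^ j) • y, ⟨m * m', hm.mul_left hm', ?_⟩, ?_⟩
  · have : (m * m') • (a • s + (b * (q : ℤ) ^ j) • y)
        = (m * m' * a) • s + b • ((q : ℤ) ^ j • (m * m') • y) := by module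
    rw [this, ← hsy]
    exact S.add_mem (S.smul_mem _ hs) (S.smul_mem _ (S.smul_mem _ hs))
  · have : ((q : ℤ) ^ j * m') • (a • s + (b * (q : ℤ) ^ j) • y)
        = (m' * a) • ((q : ℤ) ^ j • s) + ((q : ℤ) ^ j * m' * (b * (q : ℤ) ^ j)) • y := by module
    rw [this, hsy, smul_smul, smul_smul, ← add_smul]
    congr 1
    linear_combination ((q : ℤ) ^ j * m') * hab

/-- By `hw` the n-th coordinate on the span of `w` is well defined modulo q^(k n) and extends to N,
for each n separately. Restricted to the pure closure of the span these maps are pointwise finite,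
so re-extending them together keeps them finite on all of N. -/
theorem HasFamilyExtension.exists_zmod_family (h : HasFamilyExtension p N) {q : ℕ}
    (hq : q.Prime) (w : ℕ → N) (k : ℕ → ℕ) (hk : ∀ n, k n ≠ 0) (hkp : ∀ n, q ^ k n ≠ p)
    (hw : ∀ (c : ℕ →₀ ℤ) (j : ℕ) (y : N), (q : ℤ) ^ j • y = linearCombination ℤ w c →
      ∀ i, (q : ℤ) ^ j ∣ c i ∨ ((q : ℤ) ^ k i ∣ c i ∧ (q : ℤ) ^ k i • w i = 0)) :
    ∃ g : ∀ n, N →ₗ[ℤ] ZMod (q ^ k n), (∀ n m, g n (w m) = if m = n then 1 else 0) ∧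
      ∀ x, {n | g n x ≠ 0}.Finite := by
  classical
  let φ : ∀ n, (ℕ →₀ ℤ) →ₗ[ℤ] ZMod (q ^ k n) := fun n =>
    (Int.castAddHom (ZMod (q ^ k n))).toIntLinearMap.comp (Finsupp.lapply n)
  have hφ : ∀ n c, φ n c = (c n : ZMod (q ^ k n)) := fun n c => rfl
  have ext : ∀ n, ∃ g : N →ₗ[ℤ] ZMod (q ^ k n), ∀ c, g (linearCombination ℤ w c) = φ n c := by
    intro n
    refine exists_factor_zmod (pow_ne_zero _ hq.ne_zero) _ _ fun c y hy => ?_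
    rw [hφ, ZMod.intCast_zmod_eq_zero_iff_dvd]
    push_cast at hy ⊢
    rcases hw c (k n) y hy n with h | h
    exacts [h, h.1]
  choose f hf using ext
  let S := LinearMap.range (linearCombination ℤ w)
  have hpure : IsPureSubgroup (primeToClosure q S) := by
    refine isPureSubgroup_primeToClosure hq fun j y ⟨c, hc⟩ => ?_
    obtain ⟨c', hc'⟩ := zsmul_linearCombination_of_dvd hw c j y hc.symm
    exact ⟨_, ⟨c', rfl⟩, by rw [hc', hc]⟩
  obtain ⟨g, hg, hgf⟩ := h _ hpure (fun n => ZMod (q ^ k n))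
    (fun n => isUniformNe_zmod_prime_pow hq (hk n) (hkp n))
    (fun n => (f n).comp (Submodule.subtype _)) (by
      rintro ⟨z, m, hm, c, hc⟩
      -- Here m z has coordinates c with m prime to q, so the n-th map vanishes at z once c n = 0.
      refine c.support.finite_toSet.subset fun n hn => ?_
      rw [Finset.mem_coe, Finsupp.mem_support_iff]
      intro hcn
      apply hn
      obtain ⟨a, b, hab⟩ : IsCoprime m ((q : ℤ) ^ k n) := hm.pow_right
      have h1 : m • f n z = 0 := by
        rw [← map_smul, ← hc, hf, hφ, hcn, Int.cast_zero]
      have h2 : (q : ℤ) ^ k n • f n z = 0 := by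
        have := zsmul_zmod_self (q ^ k n) (f n z)
        push_cast at this; exact this
      change f n z = 0
      rw [← one_smul ℤ (f n z), ← hab, add_smul, mul_smul, mul_smul, h1, h2]; simp)
  refine ⟨g, fun n m => ?_, hgf⟩
  have hwm : w m = linearCombination ℤ w (Finsupp.single m 1) := by simp
  have := hg n ⟨w m, 1, isCoprime_one_left, by rw [one_smul, hwm]; exact ⟨_, rfl⟩⟩
  refine this.trans ?_
  change f n (w m) = _
  rw [hwm, hf, hφ, Finsupp.single_apply]
  split_ifs <;> simp

/-- A sequence of elements `x` with `x n = w n + q ^ d n • x (n + 1)`, where `w` is independent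
in the sense of `exists_zmod_family`, cannot exist. -/
theorem HasFamilyExtension.false_of_sequence (h : HasFamilyExtension p N) {q : ℕ}
    (hq : q.Prime) (x : ℕ → N) (e k : ℕ → ℕ) (he : Monotone e) (hk : ∀ n, e n - e 0 < k n)
    (hek : ∀ n, ∃ m > n, k n ≤ e m - e 0)
    (hkp : ∀ n, q ^ k n ≠ p)
    (hw : ∀ (c : ℕ →₀ ℤ) (j : ℕ) (y : N), (q : ℤ) ^ j • y =
        linearCombination ℤ (fun n => x n - (q : ℤ) ^ (e (n + 1) - e n) • x (n + 1)) c →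
      ∀ i, (q : ℤ) ^ j ∣ c i ∨ ((q : ℤ) ^ k i ∣ c i ∧
        (q : ℤ) ^ k i • (x i - (q : ℤ) ^ (e (i + 1) - e i) • x (i + 1)) = 0)) : False := by
  obtain ⟨g, hg, hgf⟩ := h.exists_zmod_family hq _ k (fun n => by have := hk n; omega) hkp hw
  -- Telescoping writes x 0 as the sum over i < m of q^(e i - e 0) w i, plus q^(e m - e 0) x m;
  -- apply g n.
  have hsum : ∀ n m, g n (x 0) = (if n < m then ((q : ℤ) ^ (e n - e 0)) else (0 : ℤ) : ℤ) +
      (q : ℤ) ^ (e m - e 0) • g n (x m) := by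
    intro n m
    induction m with
    | zero => simp
    | succ m ih =>
      have h1 := hg n m
      rw [map_sub, sub_eq_iff_eq_add, map_smul] at h1
      have h2 : e (m + 1) - e 0 = (e m - e 0) + (e (m + 1) - e m) := by
        have := he (Nat.zero_le m); have := he (Nat.le_succ m); simp only [Nat.succ_eq_add_one] at this; omega
      rw [ih, h1, smul_add, h2, pow_add, mul_smul, ← add_assoc]
      congr 1
      rcases lt_trichotomy n m with hnm | rfl | hnm
      · rw [if_pos hnm, if_neg hnm.ne', if_pos (by omega)]; simp
      · rw [if_neg (lt_irrefl _), if_pos rfl, if_pos (by omega)]; simp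
      · rw [if_neg (by omega), if_neg hnm.ne, if_neg (by omega)]; simp
  -- For large m the last term dies, leaving q^(e n - e 0), which is nonzero modulo q^(k n).
  have hne : ∀ n, g n (x 0) ≠ 0 := by
    intro n h0
    obtain ⟨m, hm, hkm⟩ := hek n
    rw [hsum n m, if_pos hm] at h0
    have h3 : (q : ℤ) ^ (e m - e 0) • g n (x m) = 0 := by
      obtain ⟨r, hr⟩ := Nat.exists_eq_add_of_le hkm
      have := zsmul_zmod_self (q ^ k n) (g n (x m))
      push_cast at this
      rw [hr, pow_add, mul_comm, mul_smul, this, smul_zero]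
    rw [h3, add_zero, ZMod.intCast_zmod_eq_zero_iff_dvd] at h0
    have h4 : q ^ k n ∣ q ^ (e n - e 0) := by exact_mod_cast h0
    have := (Nat.pow_dvd_pow_iff_le_right hq.one_lt).1 h4
    have := hk n
    omega
  have : {n | g n (x 0) ≠ 0} = Set.univ := Set.eq_univ_of_forall hne
  exact Set.infinite_univ (this ▸ hgf (x 0))

end Sequences

/-! ### Bounded primary components and finiteness modulo q -/

section Bounded

variable {p : ℕ} {N : Type v} [AddCommGroup N]

open Finsupp (linearCombination)

/-- If q^(k+1) x = q^(k+2) u, then x - q u works with h = k. Otherwise pass to k + 1, which lowers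
the exponent j. -/
theorem exists_finite_height_of_not_bounded {q : ℕ} (j k : ℕ) (x : N)
    (hx : (q : ℤ) ^ j • (q : ℤ) ^ k • x = 0) (hk : ∀ y, (q : ℤ) ^ (k + 1) • y ≠ (q : ℤ) ^ k • x) :
    ∃ h ≥ k, ∃ y : N, (q : ℤ) ^ (h + 1) • y = 0 ∧ ∀ z, (q : ℤ) ^ (h + 1) • z ≠ (q : ℤ) ^ h • y := by
  induction j generalizing k with
  | zero => exact absurd (by simpa using hx.symm) (hk 0)
  | succ j ih =>
    by_cases hu : ∃ u, (q : ℤ) ^ (k + 1 + 1) • u = (q : ℤ) ^ (k + 1) • x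
    · obtain ⟨u, hu⟩ := hu
      refine ⟨k, le_rfl, x - (q : ℤ) • u, ?_, fun z hz => hk (z + u) ?_⟩
      · rw [smul_sub, smul_smul, ← pow_succ, hu, sub_self]
      · rw [smul_add, hz, smul_sub, smul_smul, ← pow_succ]; abel
    · push Not at hu
      obtain ⟨h, hh, y⟩ := ih (k + 1) (by
        rw [smul_smul] at hx ⊢; convert hx using 2; ring) hu
      exact ⟨h, by omega, y⟩

/-- Induction on j. Let m be the last index violating the claim at j + 1 and multiply the relation
by q^(h m - j): earlier terms vanish and later ones fall into q^(h m + 1) N. What remains would put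
q^(h m) x m there too. -/
theorem dvd_coeff_of_heights {q : ℕ} (hq : q.Prime) {h : ℕ → ℕ} (hh : StrictMono h) {x : ℕ → N}
    (hx0 : ∀ n, (q : ℤ) ^ (h n + 1) • x n = 0)
    (hx : ∀ n z, (q : ℤ) ^ (h n + 1) • z ≠ (q : ℤ) ^ h n • x n) (j : ℕ) (c : ℕ →₀ ℤ) (y : N)
    (hy : (q : ℤ) ^ j • y =
      linearCombination ℤ (fun n => x n - (q : ℤ) ^ (h (n + 1) - h n) • x (n + 1)) c) (i : ℕ) :
    (q : ℤ) ^ (min j (h i + 1)) ∣ c i := by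
  classical
  have hq' : Prime (q : ℤ) := Nat.prime_iff_prime_int.1 hq
  have hw0 : ∀ n, (q : ℤ) ^ (h n + 1) • (x n - (q : ℤ) ^ (h (n + 1) - h n) • x (n + 1)) = 0 := by
    intro n
    have h1 : h n + 1 + (h (n + 1) - h n) = h (n + 1) + 1 := by
      have := hh (Nat.lt_succ_self n); simp only [Nat.succ_eq_add_one] at this; omega
    rw [smul_sub, hx0, smul_smul, ← pow_add, h1, hx0, sub_zero]
  induction j generalizing y i with
  | zero => simp
  | succ j ih =>
    have ih' := ih ((q : ℤ) • y) (by rw [smul_smul, ← pow_succ, hy])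
    by_contra hbad
    let B := c.support.filter fun i => ¬ (q : ℤ) ^ (min (j + 1) (h i + 1)) ∣ c i
    have hiB : i ∈ B := by
      rw [Finset.mem_filter, Finsupp.mem_support_iff]
      exact ⟨fun h0 => hbad (by rw [h0]; exact dvd_zero _), hbad⟩
    obtain ⟨m, hmB, hmax⟩ : ∃ m ∈ B, ∀ i ∈ B, i ≤ m :=
      ⟨B.max' ⟨i, hiB⟩, B.max'_mem _, fun a ha => B.le_max' a ha⟩
    obtain ⟨hms, hmbad⟩ := Finset.mem_filter.1 hmB
    have hjm : j ≤ h m := by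
      by_contra hlt
      apply hmbad
      have := ih' m
      rwa [min_eq_right (by omega)] at this ⊢
    obtain ⟨d, hd⟩ : (q : ℤ) ^ j ∣ c m := by
      have := ih' m
      rwa [min_eq_left (by omega)] at this
    have hqd : ¬ (q : ℤ) ∣ d := by
      intro hdvd
      apply hmbad
      rw [min_eq_left (by omega), hd, pow_succ]
      exact mul_dvd_mul_left _ hdvd
    let R : Submodule ℤ N := LinearMap.range (LinearMap.lsmul ℤ N ((q : ℤ) ^ (h m + 1)))
    have hR : ∀ z, (q : ℤ) ^ (h m + 1) • z ∈ R := fun z => ⟨z, rfl⟩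
    have htot : (q : ℤ) ^ (h m - j) •
        linearCombination ℤ (fun n => x n - (q : ℤ) ^ (h (n + 1) - h n) • x (n + 1)) c ∈ R := by
      rw [← hy, smul_smul, ← pow_add]
      convert hR y using 3
      omega
    rw [Finsupp.linearCombination_apply, Finsupp.sum, ← Finset.add_sum_erase _ _ hms, smul_add,
      Finset.smul_sum] at htot
    have hrest : ∑ i ∈ c.support.erase m, (q : ℤ) ^ (h m - j) • c i •
        (x i - (q : ℤ) ^ (h (i + 1) - h i) • x (i + 1)) ∈ R := by
      refine R.sum_mem fun i hi => ?_
      obtain ⟨him, his⟩ := Finset.mem_erase.1 hi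
      rcases lt_or_gt_of_ne him with hlt | hgt
      · have h1 := hh hlt
        have hdvd : (q : ℤ) ^ (h i + 1) ∣ (q : ℤ) ^ (h m - j) * c i := by
          refine dvd_trans (pow_dvd_pow _ ?_) (by
            rw [pow_add]; exact mul_dvd_mul_left _ (ih' i) :
            (q : ℤ) ^ (h m - j + min j (h i + 1)) ∣ _)
          omega
        obtain ⟨a, ha⟩ := hdvd
        rw [smul_smul, ha, mul_comm, mul_smul, hw0, smul_zero]
        exact R.zero_mem
      · have h1 := hh hgt
        have hgood : (q : ℤ) ^ (min (j + 1) (h i + 1)) ∣ c i := by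
          by_contra hb
          have := hmax i (Finset.mem_filter.2 ⟨his, hb⟩)
          omega
        rw [min_eq_left (by omega)] at hgood
        obtain ⟨a, ha⟩ := hgood
        have : (q : ℤ) ^ (h m - j) * c i = (q : ℤ) ^ (h m + 1) * a := by
          rw [ha, ← mul_assoc, ← pow_add]; congr 2; omega
        rw [smul_smul, this, mul_smul]
        exact hR _
    have hmain := (R.add_mem_iff_left hrest).1 htot
    have h1 : h m < h (m + 1) := hh (Nat.lt_succ_self m)
    rw [smul_smul, hd, ← mul_assoc, ← pow_add, show h m - j + j = h m by omega, smul_sub,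
      smul_smul _ _ (x (m + 1)), show (q : ℤ) ^ h m * d * (q : ℤ) ^ (h (m + 1) - h m) =
        (q : ℤ) ^ (h m + 1) * (d * (q : ℤ) ^ (h (m + 1) - h m - 1)) by
        rw [show h (m + 1) - h m = (h (m + 1) - h m - 1) + 1 by omega]
        simp only [Nat.add_sub_cancel]; ring, mul_smul ((q : ℤ) ^ (h m + 1))] at hmain
    have hmain' := (R.sub_mem_iff_left (hR _)).1 hmain
    obtain ⟨a, b, hab⟩ := (hq'.coprime_iff_not_dvd.2 hqd).symm
    have hfin : (q : ℤ) ^ h m • x m ∈ R := by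
      have : (q : ℤ) ^ h m • x m = a • (((q : ℤ) ^ h m * d) • x m) +
          (q : ℤ) ^ (h m + 1) • b • x m := by
        rw [smul_smul, smul_smul, ← add_smul]
        congr 1
        linear_combination (-(q : ℤ) ^ h m) * hab
      rw [this]
      exact R.add_mem (R.smul_mem _ hmain') (hR _)
    obtain ⟨z, hz⟩ := hfin
    exact hx m z hz

/-- The `q`-primary component of `N` is bounded modulo a divisible subgroup. -/
theorem HasFamilyExtension.bounded_mod_divisible (hN : HasFamilyExtension p N) (hp : p.Prime)
    {q : ℕ} (hq : q.Prime) :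
    ∃ k : ℕ, ∀ x : N, (∃ j : ℕ, (q : ℤ) ^ j • x = 0) →
      ∃ y : N, (q : ℤ) ^ (k + 1) • y = (q : ℤ) ^ k • x := by
  by_contra hcon
  push Not at hcon
  have hex : ∀ k : ℕ, ∃ h ≥ k, ∃ y : N, (q : ℤ) ^ (h + 1) • y = 0 ∧
      ∀ z, (q : ℤ) ^ (h + 1) • z ≠ (q : ℤ) ^ h • y := by
    intro k
    obtain ⟨x, ⟨j, hj⟩, hx⟩ := hcon k
    exact exists_finite_height_of_not_bounded j k x
      (by rw [smul_comm, hj, smul_zero]) hx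
  choose H hH Y hY0 hY using hex
  -- The recursion makes the heights strictly increase. Starting at 1 makes the exponents H (t n) +
  -- 1 at least 2, so the power of q is never the prime p.
  let t : ℕ → ℕ := fun n => Nat.rec 1 (fun _ a => H a + 1) n
  have ht : ∀ n, t (n + 1) = H (t n) + 1 := fun n => rfl
  have hmono : StrictMono fun n => H (t n) := by
    refine strictMono_nat_of_lt_succ fun n => ?_
    have := hH (t (n + 1))
    rw [ht] at this ⊢
    omega
  have h1 : ∀ n, 1 ≤ H (t n) := fun n =>
    le_trans (hH (t 0)) (hmono.monotone (Nat.zero_le n))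
  refine hN.false_of_sequence hq (fun n => Y (t n)) (fun n => H (t n)) (fun n => H (t n) + 1)
    hmono.monotone (fun n => by omega) (fun n => ?_) (fun n => ?_) fun c j y hy i => ?_
  · refine ⟨n + 1 + H (t 0) + H (t n) + 1, by omega, ?_⟩
    have := hmono.le_apply (x := n + 1 + H (t 0) + H (t n) + 1)
    omega
  · intro h
    exact Nat.Prime.not_prime_pow (by have := h1 n; omega) (h ▸ hp)
  · have := dvd_coeff_of_heights hq hmono (fun n => hY0 (t n)) (fun n => hY (t n)) j c y hy i
    rcases le_total j (H (t i) + 1) with hle | hle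
    · left; rwa [min_eq_left hle] at this
    · right
      rw [min_eq_right hle] at this
      refine ⟨this, ?_⟩
      have h2 : H (t i) + 1 + (H (t (i + 1)) - H (t i)) = H (t (i + 1)) + 1 := by
        have : H (t i) < H (t (i + 1)) := hmono (Nat.lt_succ_self i)
        omega
      rw [smul_sub, hY0, smul_smul, ← pow_add, h2, hY0, sub_zero]

/-- For torsion-free `X`, a sequence in `X` cannot be independent modulo `q`. -/
theorem HasFamilyExtension.not_independent_mod (hN : HasFamilyExtension p N) (hp : p.Prime)
    (htf : ∀ (n : ℤ) (x : N), n ≠ 0 → n • x = 0 → x = 0)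
    {q : ℕ} (hq : q.Prime) (x : ℕ → N) : ∃ (c : ℕ →₀ ℤ) (y : N),
      (q : ℤ) • y = linearCombination ℤ x c ∧ ∃ i, ¬ (q : ℤ) ∣ c i := by
  by_contra hcon
  push Not at hcon
  have hq0 : (q : ℤ) ≠ 0 := by exact_mod_cast hq.ne_zero
  -- Torsion-freeness lets q be cancelled repeatedly, so independence modulo q passes to all powers
  -- of q.
  have hpow : ∀ (j : ℕ) (c : ℕ →₀ ℤ) (y : N), (q : ℤ) ^ j • y = linearCombination ℤ x c →
      ∀ i, (q : ℤ) ^ j ∣ c i := by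
    intro j
    induction j with
    | zero => intro c y _ i; simp
    | succ j ih =>
      intro c y hy
      have hd := hcon c ((q : ℤ) ^ j • y) (by rw [smul_smul, ← pow_succ', hy])
      let c' : ℕ →₀ ℤ := c.mapRange (fun a => a / q) (by simp)
      have hc' : c = (q : ℤ) • c' := by
        ext i
        simp [c', Int.mul_ediv_cancel' (hd i)]
      have h2 := ih c' y (by
        rw [← sub_eq_zero]
        refine htf q _ hq0 ?_
        rw [smul_sub, smul_smul, ← pow_succ', hy, ← map_smul, ← hc', sub_self])
      intro i
      rw [hc', Finsupp.smul_apply, smul_eq_mul, pow_succ']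
      exact mul_dvd_mul_left _ (h2 i)
  refine hN.false_of_sequence hq x id (fun n => n + 2) monotone_id (fun n => by simp)
    (fun n => ⟨n + 2, by omega, by simp⟩)
    (fun n h => Nat.Prime.not_prime_pow (by omega) (h ▸ hp)) fun c j y hy i => Or.inl ?_
  -- In terms of `x` the i-th coefficient is c i - q c (i - 1). This change of coordinates is
  -- unitriangular, so divisibility of c i is recovered by induction on i.
  let c' : ℕ →₀ ℤ := c - (q : ℤ) • c.mapDomain (· + 1)
  have hc' : linearCombination ℤ (fun n => x n - (q : ℤ) ^ (id (n + 1) - id n) • x (n + 1)) c =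
      linearCombination ℤ x c' := by
    simp only [c', map_sub, map_smul, Finsupp.linearCombination_mapDomain]
    simp only [Finsupp.linearCombination_apply, Finsupp.sum, Finset.smul_sum, ← Finset.sum_sub_distrib]
    refine Finset.sum_congr rfl fun i _ => ?_
    simp only [id, Nat.add_sub_cancel_left, pow_one, smul_sub, Function.comp]
    rw [smul_comm]
  rw [hc'] at hy
  have hd := hpow j c' y hy
  induction i with
  | zero =>
    have := hd 0
    have h0 : c.mapDomain (· + 1) 0 = 0 := Finsupp.mapDomain_of_notMem_range _ _ (by simp)
    simpa [c', h0] using this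
  | succ i ih =>
    have := hd (i + 1)
    have h0 : c.mapDomain (· + 1) (i + 1) = c i :=
      Finsupp.mapDomain_apply (add_left_injective 1) _ _
    simp only [c', Finsupp.sub_apply, Finsupp.smul_apply, h0, smul_eq_mul] at this
    exact (dvd_sub_left (Dvd.dvd.mul_left ih _)).1 this

end Bounded

/-! ### Torsion-free groups: rank-one and reduced pure subgroups -/

section RankOne

variable {p : ℕ} {N : Type v} [AddCommGroup N]

/-- The elements that have a nonzero multiple in `ℤ z`. -/
def rationalHull (z : N) : Submodule ℤ N where
  carrier := {y | ∃ m : ℤ, m ≠ 0 ∧ ∃ n : ℤ, m • y = n • z}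
  zero_mem' := ⟨1, one_ne_zero, 0, by simp⟩
  add_mem' := by
    rintro a b ⟨m, hm, k, hk⟩ ⟨n, hn, l, hl⟩
    refine ⟨m * n, mul_ne_zero hm hn, n * k + m * l, ?_⟩
    rw [smul_add, mul_comm, mul_smul, hk, mul_comm, mul_smul, hl]
    module
  smul_mem' := by
    rintro c a ⟨m, hm, k, hk⟩
    exact ⟨m, hm, c * k, by rw [smul_comm, hk, smul_smul]⟩

theorem self_mem_rationalHull (z : N) : z ∈ rationalHull z := ⟨1, one_ne_zero, 1, rfl⟩

theorem mem_rationalHull_of_zsmul_mem {z : N} (n : ℤ) (y : N) (hn : n ≠ 0)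
    (h : n • y ∈ rationalHull z) : y ∈ rationalHull z := by
  obtain ⟨m, hm, k, hk⟩ := h
  exact ⟨m * n, mul_ne_zero hm hn, k, by rw [mul_smul, hk]⟩

theorem rationalHull_le {z : N} {S : Submodule ℤ N} (hz : z ∈ S)
    (hS : ∀ (n : ℤ) (y : N), n ≠ 0 → n • y ∈ S → y ∈ S) : rationalHull z ≤ S := by
  rintro y ⟨m, hm, n, hn⟩
  exact hS m y hm (hn ▸ S.smul_mem _ hz)

theorem isPureSubgroup_rationalHull (z : N) : IsPureSubgroup (rationalHull z) :=
  isPureSubgroup_of_torsionFree_quotient mem_rationalHull_of_zsmul_mem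

variable (htf : ∀ (n : ℤ) (x : N), n ≠ 0 → n • x = 0 → x = 0)

include htf

/-- The hull is pure and isomorphic to a nonzero subgroup of ℚ, hence an admissible target; extend
the family whose only nonzero member is this isomorphism. -/
theorem HasFamilyExtension.exists_retraction_rationalHull (hN : HasFamilyExtension p N)
    (hp : p.Prime) {z : N} (hz : z ≠ 0) :
    ∃ ρ : N →ₗ[ℤ] rationalHull z, ∀ y : rationalHull z, ρ y = y := by
  have hinj : Function.Injective (LinearMap.toSpanSingleton ℤ N z) := by
    rw [injective_iff_map_eq_zero]
    intro n hn
    by_contra h0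
    exact hz (htf n z h0 hn)
  obtain ⟨φ, hφ⟩ := (Module.Baer.of_divisible ℚ).extension_property _ hinj
    (Int.castAddHom ℚ).toIntLinearMap
  have hφz : φ z = 1 := by
    have := congrArg (fun k => k 1) hφ
    simpa using this
  let W := rationalHull z
  have hφW : Function.Injective (φ.comp W.subtype) := by
    rw [injective_iff_map_eq_zero]
    rintro ⟨y, m, hm, n, hn⟩ hy
    have hy' : φ y = 0 := hy
    have h1 := congrArg φ hn
    rw [map_smul, map_smul, hy', hφz, smul_zero] at h1
    have h2 : n = 0 := by simpa using h1.symm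
    rw [h2, zero_smul] at hn
    exact Subtype.ext (htf m y hm hn)
  let e := LinearEquiv.ofInjective _ hφW
  have hne : LinearMap.range (φ.comp W.subtype) ≠ ⊥ := by
    intro hbot
    have : (φ.comp W.subtype) ⟨z, self_mem_rationalHull z⟩ ∈ (⊥ : Submodule ℤ ℚ) :=
      hbot ▸ ⟨_, rfl⟩
    rw [Submodule.mem_bot] at this
    exact one_ne_zero (hφz.symm.trans this)
  obtain ⟨g, hg, -⟩ := hN W (isPureSubgroup_rationalHull z)
    (fun _ => LinearMap.range (φ.comp W.subtype)) (fun _ => isUniformNe_rat_submodule hp hne)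
    (fun n => if n = 0 then e.toLinearMap else 0) (fun x => by
      refine (Set.finite_singleton 0).subset fun n hn => ?_
      by_contra h0
      have h0' : n ≠ 0 := h0
      exact hn (by rw [if_neg h0']; rfl))
  refine ⟨e.symm.toLinearMap.comp (g 0), fun y => ?_⟩
  have := hg 0 y
  rw [if_pos rfl] at this
  rw [LinearMap.comp_apply, this]
  exact e.symm_apply_apply y

/-- The power of q in m is cancelled by torsion-freeness, the part prime to q by Bézout. -/
theorem exists_pow_zsmul_eq_of_zsmul {q : ℕ} (hq : q.Prime) {m : ℤ} (hm : m ≠ 0) {y : N}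
    (h : ∀ j : ℕ, ∃ z, (q : ℤ) ^ j • z = m • y) (j : ℕ) : ∃ z, (q : ℤ) ^ j • z = y := by
  obtain ⟨i, m', hm', rfl⟩ := exists_eq_prime_pow_mul hq hm
  obtain ⟨v, hv⟩ := h (i + j)
  have h1 : (q : ℤ) ^ j • v = m' • y := by
    rw [← sub_eq_zero]
    refine htf ((q : ℤ) ^ i) _ (pow_ne_zero _ (by exact_mod_cast hq.ne_zero)) ?_
    rw [smul_sub, smul_smul, smul_smul, ← pow_add, hv, sub_self]
  obtain ⟨a, b, hab⟩ : IsCoprime m' ((q : ℤ) ^ j) := hm'.pow_right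
  refine ⟨a • v + b • y, ?_⟩
  have : (q : ℤ) ^ j • (a • v + b • y) = a • ((q : ℤ) ^ j • v) + (b * (q : ℤ) ^ j) • y := by module
  rw [this, h1, smul_smul, ← add_smul, hab, one_smul]

/-- In a reduced pure subgroup of a torsion-free group which is not divisible by `q`, no nonzero
element is divisible by all powers of `q`. -/
theorem HasFamilyExtension.eq_zero_of_forall_pow (hN : HasFamilyExtension p N) (hp : p.Prime)
    {F : Submodule ℤ N} (hF : ∀ (n : ℤ) (y : N), n ≠ 0 → n • y ∈ F → y ∈ F)
    (hred : ∀ D ≤ F, IsDivisibleSubgroup D → D = ⊥) {q : ℕ} (hq : q.Prime)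
    {x : N} (hxq : ∀ y, (q : ℤ) • y ≠ x) {s : N} (hs : s ∈ F)
    (hsq : ∀ j : ℕ, ∃ z, (q : ℤ) ^ j • z = s) : s = 0 := by
  by_contra hs0
  have hnd : ¬ IsDivisibleSubgroup (rationalHull s) := by
    intro hd
    have := self_mem_rationalHull s
    rw [hred _ (rationalHull_le hs hF) hd] at this
    exact hs0 this
  unfold IsDivisibleSubgroup at hnd
  push Not at hnd
  -- F is reduced, so the hull of s contains some t not divisible by a prime r; t remains divisible
  -- by all powers of q.
  obtain ⟨r, hr, t, ht, htr⟩ := hnd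
  have htr' : ∀ y, (r : ℤ) • y ≠ t := fun y hy =>
    htr y (mem_rationalHull_of_zsmul_mem _ _ (by exact_mod_cast hr.ne_zero) (hy ▸ ht)) hy
  have htq : ∀ j : ℕ, ∃ z, (q : ℤ) ^ j • z = t := by
    obtain ⟨m, hm, n, hn⟩ := ht
    refine exists_pow_zsmul_eq_of_zsmul htf hq hm fun j => ?_
    obtain ⟨z, hz⟩ := hsq j
    exact ⟨n • z, by rw [smul_comm, hz, hn]⟩
  -- Retract onto the hull of r x + t. If ρ t ≠ 0, a nonzero multiple of x, hence x itself, would be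
  -- divisible by all powers of q. If ρ t = 0, then r x + t = r ρ x and r divides t.
  have hw0 : (r : ℤ) • x + t ≠ 0 := fun h =>
    htr' (-x) (by rw [smul_neg]; exact neg_eq_of_add_eq_zero_right h)
  obtain ⟨ρ, hρ⟩ := hN.exists_retraction_rationalHull htf hp hw0
  have hρt : (ρ t : N) = 0 := by
    have hdiv : ∀ j : ℕ, ∃ z, (q : ℤ) ^ j • z = (ρ t : N) := by
      intro j
      obtain ⟨z, hz⟩ := htq j
      exact ⟨ρ z, congrArg Subtype.val ((map_smul ρ _ _).symm.trans (congrArg ρ hz))⟩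
    obtain ⟨m, hm, n, hn⟩ := (ρ t).2
    rcases eq_or_ne n 0 with rfl | hn0
    · rw [zero_smul] at hn
      exact htf m _ hm hn
    · exfalso
      obtain ⟨z, hz⟩ := exists_pow_zsmul_eq_of_zsmul htf hq (y := x)
        (mul_ne_zero hn0 (by exact_mod_cast hr.ne_zero : (r : ℤ) ≠ 0)) (fun j => by
          obtain ⟨z₁, hz₁⟩ := hdiv j
          obtain ⟨z₂, hz₂⟩ := htq j
          refine ⟨m • z₁ - n • z₂, ?_⟩
          rw [smul_sub, smul_comm, hz₁, smul_comm, hz₂, hn]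
          module) 1
      exact hxq z (by simpa using hz)
  have h1 := congrArg Subtype.val (hρ ⟨_, self_mem_rationalHull _⟩)
  simp only [map_add, map_smul, Submodule.coe_add, hρt, add_zero, Submodule.coe_smul] at h1
  refine htr' (ρ x - x) ?_
  rw [smul_sub, h1]
  abel

/-- One step in the construction of a complement of a reduced pure subgroup. -/
theorem HasFamilyExtension.exists_larger_summand (hN : HasFamilyExtension p N) (hp : p.Prime)
    {F : Submodule ℤ N} (hF : ∀ (n : ℤ) (y : N), n ≠ 0 → n • y ∈ F → y ∈ F)
    {q : ℕ} (hFq : ∀ s ∈ F, (∀ j : ℕ, ∃ z, (q : ℤ) ^ j • z = s) → s = 0)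
    (hq0 : (q : ℤ) ≠ 0)
    {G C : Submodule ℤ N} (hGF : G ≤ F) (hGC : IsCompl G C) (hne : G ≠ F) :
    ∃ G', G ≤ G' ∧ G' ≤ F ∧ (∃ C', IsCompl G' C') ∧
      ∃ r ∈ G', ∀ g ∈ G, ∀ y, r ≠ g + (q : ℤ) • y := by
  obtain ⟨f, hfF, hfG⟩ := SetLike.exists_of_lt (lt_of_le_of_ne hGF hne)
  have hdec : ∀ y, ∃ g ∈ G, ∃ c ∈ C, g + c = y := fun y =>
    Submodule.mem_sup.1 (hGC.sup_eq_top ▸ Submodule.mem_top)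
  have hdisj : ∀ y, y ∈ G → y ∈ C → y = 0 := fun y h1 h2 =>
    (Submodule.disjoint_def.1 hGC.disjoint) y h1 h2
  obtain ⟨g, hg, c, hc, rfl⟩ := hdec f
  have hcF : c ∈ F := (F.add_mem_iff_right (hGF hg)).1 hfF
  have hc0 : c ≠ 0 := by
    rintro rfl
    exact hfG (by simpa using hg)
  have hCt : ∀ (n : ℤ) (y : N), n ≠ 0 → n • y ∈ C → y ∈ C := by
    intro n y hn hy
    obtain ⟨g', hg', c', hc', rfl⟩ := hdec y
    rw [smul_add] at hy
    have := hdisj _ (G.smul_mem n hg') ((C.add_mem_iff_left (C.smul_mem n hc')).1 hy)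
    rw [htf n g' hn this, zero_add]
    exact hc'
  have hWF := rationalHull_le hcF hF
  have hWC := rationalHull_le hc hCt
  obtain ⟨ρ, hρ⟩ := hN.exists_retraction_rationalHull htf hp hc0
  -- The hull of c lies in C and is a summand, so it can be moved from C to G.
  refine ⟨G ⊔ rationalHull c, le_sup_left, sup_le hGF hWF, ⟨C ⊓ LinearMap.ker ρ, ?_⟩, ?_⟩
  · constructor
    · rw [Submodule.disjoint_def]
      rintro y hy ⟨hyC, hyρ⟩
      obtain ⟨g', hg', w, hw, rfl⟩ := Submodule.mem_sup.1 hy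
      have h0 := hdisj g' hg' ((C.add_mem_iff_left (hWC hw)).1 hyC)
      rw [h0, zero_add] at hyρ ⊢
      have h1 := hρ ⟨w, hw⟩
      rw [LinearMap.mem_ker.1 hyρ] at h1
      exact (congrArg Subtype.val h1).symm
    · rw [codisjoint_iff_le_sup]
      intro y _
      obtain ⟨g', hg', c', hc', rfl⟩ := hdec y
      have hker : c' - ρ c' ∈ LinearMap.ker ρ := by
        rw [LinearMap.mem_ker, map_sub, hρ, sub_self]
      exact Submodule.mem_sup.2 ⟨g' + ρ c', Submodule.add_mem_sup hg' (ρ c').2, c' - ρ c',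
        ⟨C.sub_mem hc' (hWC (ρ c').2), hker⟩, by abel⟩
  -- Divide c by the highest possible power of q. The quotient r lies in C and is not divisible by
  -- q, hence avoids G + qN.
  · have hcq : ∃ j : ℕ, ∀ z, (q : ℤ) ^ j • z ≠ c := by
      by_contra hcon
      push Not at hcon
      exact hc0 (hFq c hcF hcon)
    classical
    have hj0 : Nat.find hcq ≠ 0 := by
      intro h0
      have := Nat.find_spec hcq
      rw [h0] at this
      exact this c (by simp)
    obtain ⟨j, hj⟩ := Nat.exists_eq_succ_of_ne_zero hj0
    have hmin := Nat.find_min hcq (m := j) (by omega)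
    push Not at hmin
    obtain ⟨r, hr⟩ := hmin
    have hspec := Nat.find_spec hcq
    rw [hj] at hspec
    have hrW : r ∈ rationalHull c := mem_rationalHull_of_zsmul_mem _ _ (pow_ne_zero j hq0)
      (hr ▸ self_mem_rationalHull c)
    refine ⟨r, Submodule.mem_sup_right hrW, fun g' hg' y hy => ?_⟩
    obtain ⟨g₁, hg₁, c₁, hc₁, rfl⟩ := hdec y
    have h2 : r - (q : ℤ) • c₁ = g' + (q : ℤ) • g₁ := by rw [hy, smul_add]; abel
    have h3 := hdisj (r - (q : ℤ) • c₁) (h2 ▸ G.add_mem hg' (G.smul_mem _ hg₁))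
      (C.sub_mem (hWC hrW) (C.smul_mem _ hc₁))
    refine hspec c₁ ?_
    rw [pow_succ, mul_smul, ← sub_eq_zero.1 h3, hr]

/-- A reduced pure subgroup of a torsion-free group with the extension property is a summand. -/
theorem HasFamilyExtension.exists_isCompl_of_torsionFree (hN : HasFamilyExtension p N)
    (hp : p.Prime) {F : Submodule ℤ N}
    (hF : ∀ (n : ℤ) (y : N), n ≠ 0 → n • y ∈ F → y ∈ F)
    (hred : ∀ D ≤ F, IsDivisibleSubgroup D → D = ⊥) : ∃ C, IsCompl F C := by
  by_contra hcon
  have hFd : ¬ IsDivisibleSubgroup F := fun h => hcon h.exists_isCompl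
  unfold IsDivisibleSubgroup at hFd
  push Not at hFd
  obtain ⟨q, hq, x, hx, hxq⟩ := hFd
  have hq0 : (q : ℤ) ≠ 0 := by exact_mod_cast hq.ne_zero
  have hxq' : ∀ y, (q : ℤ) • y ≠ x := fun y hy => hxq y (hF q y hq0 (hy ▸ hx)) hy
  have hFq : ∀ s ∈ F, (∀ j : ℕ, ∃ z, (q : ℤ) ^ j • z = s) → s = 0 := fun s hs h =>
    hN.eq_zero_of_forall_pow htf hp hF hred hq hxq' hs h
  let T := {G : Submodule ℤ N // G ≤ F ∧ ∃ C, IsCompl G C}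
  have step : ∀ G : T, ∃ G' : T, G.1 ≤ G'.1 ∧ ∃ r ∈ G'.1, ∀ g ∈ G.1, ∀ y, r ≠ g + (q : ℤ) • y := by
    rintro ⟨G, hGF, C, hC⟩
    obtain ⟨G', h1, h2, h3, h4⟩ := hN.exists_larger_summand htf hp hF hFq hq0 hGF hC
      (by rintro rfl; exact hcon ⟨C, hC⟩)
    exact ⟨⟨G', h2, h3⟩, h1, h4⟩
  choose next hle r hr hrn using step
  -- If F is no summand the enlargement never stops, and the new elements r (G n) are independent
  -- modulo q.
  let G : ℕ → T := fun n => Nat.rec ⟨⊥, bot_le, ⊤, isCompl_bot_top⟩ (fun _ a => next a) n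
  have hmono : Monotone fun n => (G n).1 := monotone_nat_of_le_succ fun n => hle (G n)
  obtain ⟨c, y, hy, i, hi⟩ := hN.not_independent_mod hp htf hq (fun n => r (G n))
  classical
  -- At the last coefficient not divisible by q, earlier r (G i) lie in G m and later terms in qN,
  -- forcing r (G m) into G m + qN.
  let B := c.support.filter fun i => ¬ (q : ℤ) ∣ c i
  have hiB : i ∈ B := by
    rw [Finset.mem_filter, Finsupp.mem_support_iff]
    exact ⟨fun h0 => hi (by rw [h0]; exact dvd_zero _), hi⟩
  obtain ⟨m, hmB, hmax⟩ : ∃ m ∈ B, ∀ i ∈ B, i ≤ m :=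
    ⟨B.max' ⟨i, hiB⟩, B.max'_mem _, fun a ha => B.le_max' a ha⟩
  obtain ⟨hms, hmbad⟩ := Finset.mem_filter.1 hmB
  let S := (G m).1 ⊔ LinearMap.range (LinearMap.lsmul ℤ N (q : ℤ))
  have hS : ∀ z, (q : ℤ) • z ∈ S := fun z => Submodule.mem_sup_right ⟨z, rfl⟩
  have hrest : ∑ i ∈ c.support.erase m, c i • r (G i) ∈ S := by
    refine S.sum_mem fun i hi => ?_
    obtain ⟨him, his⟩ := Finset.mem_erase.1 hi
    rcases lt_or_gt_of_ne him with hlt | hgt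
    · exact S.smul_mem _ (Submodule.mem_sup_left (hmono (Nat.succ_le_of_lt hlt) (hr (G i))))
    · have : (q : ℤ) ∣ c i := by
        by_contra hb
        have := hmax i (Finset.mem_filter.2 ⟨his, hb⟩)
        omega
      obtain ⟨a, ha⟩ := this
      rw [ha, mul_smul]
      exact hS _
  have htot : (q : ℤ) • y ∈ S := hS y
  rw [hy, Finsupp.linearCombination_apply, Finsupp.sum, ← Finset.add_sum_erase _ _ hms] at htot
  have hmain := (S.add_mem_iff_left hrest).1 htot
  obtain ⟨a, b, hab⟩ := ((Nat.prime_iff_prime_int.1 hq).coprime_iff_not_dvd.2 hmbad).symm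
  have hfin : r (G m) ∈ S := by
    have : r (G m) = a • c m • r (G m) + (q : ℤ) • b • r (G m) := by
      rw [smul_smul, smul_smul, ← add_smul, mul_comm (q : ℤ), hab, one_smul]
    rw [this]
    exact S.add_mem (S.smul_mem _ hmain) (hS _)
  obtain ⟨g, hg, _, ⟨z, rfl⟩, hgz⟩ := Submodule.mem_sup.1 hfin
  exact hrn (G m) g hg z hgz.symm

end RankOne

/-! ### Subgroups pure-independent of a pure subgroup -/

section PureIndependent

variable {N : Type v} [AddCommGroup N]

/-- `H` meets `L` trivially and `H ⊕ L` is pure. -/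
def IsPureIndependent (L H : Submodule ℤ N) : Prop :=
  (∀ x ∈ H, x ∈ L → x = 0) ∧ IsPureSubgroup (H ⊔ L)

theorem IsPureIndependent.isPureSubgroup {L H : Submodule ℤ N} (h : IsPureIndependent L H) :
    IsPureSubgroup H := by
  intro n y hy
  obtain ⟨x, hx, hxy⟩ := h.2 n y (Submodule.mem_sup_left hy)
  obtain ⟨a, ha, l, hl, rfl⟩ := Submodule.mem_sup.1 hx
  refine ⟨a, ha, ?_⟩
  rw [smul_add] at hxy
  have hl' : n • l = n • y - n • a := by rw [← hxy]; abel
  have := h.1 (n • l) (hl' ▸ H.sub_mem hy (H.smul_mem n ha)) (L.smul_mem n hl)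
  rw [← hxy, this, add_zero]

theorem exists_maximal_isPureIndependent {L : Submodule ℤ N} (hL : IsPureSubgroup L) :
    ∃ H, IsPureIndependent L H ∧ ∀ H', IsPureIndependent L H' → H ≤ H' → H' = H := by
  obtain ⟨H, -, hH⟩ := zorn_le_nonempty₀ {H | IsPureIndependent L H} (by
    intro c hc hchain H₀ hH₀
    have hmem : ∀ x, x ∈ sSup c → ∃ H ∈ c, x ∈ H := fun x =>
      (Submodule.mem_sSup_of_directed ⟨H₀, hH₀⟩ hchain.directedOn).1
    refine ⟨sSup c, ⟨fun x hx hxL => ?_, fun n y hy => ?_⟩, fun H hH => le_sSup hH⟩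
    · obtain ⟨H, hHc, hxH⟩ := hmem x hx
      exact (hc hHc).1 x hxH hxL
    · obtain ⟨a, ha, l, hl, hal⟩ := Submodule.mem_sup.1 hy
      obtain ⟨H, hHc, haH⟩ := hmem a ha
      obtain ⟨x, hx, hxy⟩ := (hc hHc).2 n y (hal ▸ Submodule.add_mem_sup haH hl)
      exact ⟨x, sup_le_sup_right (le_sSup hHc) L hx, hxy⟩) ⊥
    ⟨fun x hx _ => hx, by rwa [bot_sup_eq]⟩
  exact ⟨H, hH.prop, fun H' h1 h2 => le_antisymm (hH.le_of_ge h1 h2) h2⟩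

theorem IsPureIndependent.of_quotient {L H : Submodule ℤ N} (hH : IsPureIndependent L H)
    {H' : Submodule ℤ (N ⧸ H)} (h : IsPureIndependent (L.map H.mkQ) H') :
    IsPureIndependent L (H'.comap H.mkQ) := by
  refine ⟨fun x hx hxL => ?_, ?_⟩
  · have := h.1 _ hx ⟨x, hxL, rfl⟩
    exact hH.1 x ((Submodule.Quotient.mk_eq_zero H).1 this) hxL
  · have h2 := hH.isPureSubgroup.comap_mkQ h.2
    convert h2 using 1
    ext x
    simp only [Submodule.mem_comap, Submodule.mem_sup]
    constructor
    · rintro ⟨a, ha, l, hl, rfl⟩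
      exact ⟨_, ha, _, ⟨l, hl, rfl⟩, (map_add _ _ _).symm⟩
    · rintro ⟨a, ha, _, ⟨l, hl, rfl⟩, hal⟩
      refine ⟨x - l, ?_, l, hl, by abel⟩
      rw [map_sub, ← hal]
      simpa using ha

/-- H is maximal by Zorn. It is a complement of L as soon as the image of L is all of N/H. -/
theorem exists_isPureIndependent_quotient {L : Submodule ℤ N} (hL : IsPureSubgroup L) :
    ∃ H, IsPureIndependent L H ∧
      ∀ H' : Submodule ℤ (N ⧸ H), IsPureIndependent (L.map H.mkQ) H' → H' = ⊥ := by
  obtain ⟨H, hH, hmax⟩ := exists_maximal_isPureIndependent hL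
  refine ⟨H, hH, fun H' hH' => ?_⟩
  have h1 := hmax _ (hH.of_quotient hH') (fun x hx => by
    rw [Submodule.mem_comap, Submodule.mkQ_apply, (Submodule.Quotient.mk_eq_zero H).2 hx]
    exact H'.zero_mem)
  rw [eq_bot_iff]
  intro x hx
  obtain ⟨x, rfl⟩ := H.mkQ_surjective x
  have : x ∈ H'.comap H.mkQ := hx
  rw [h1] at this
  exact (Submodule.Quotient.mk_eq_zero H).2 this

/-- In N/L the image of y has order q^(h+1), and q^h times it is not divisible by q^(h+1); so it
generates a pure cyclic subgroup. Since y itself has no larger order, its span misses L. -/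
theorem isPureIndependent_span_singleton {L : Submodule ℤ N} (hL : IsPureSubgroup L) {q : ℕ}
    (hq : q.Prime) {h : ℕ} {y : N} (hy : (q : ℤ) ^ (h + 1) • y = 0)
    (hyL : ∀ z, (q : ℤ) ^ h • y - (q : ℤ) ^ (h + 1) • z ∉ L) :
    IsPureIndependent L (Submodule.span ℤ {y}) := by
  have key : ∀ (u : ℤ), IsCoprime u (q : ℤ) → ∀ z,
      (u * (q : ℤ) ^ h) • y - (q : ℤ) ^ (h + 1) • z ∉ L := by
    rintro u ⟨a, b, hab⟩ z hz
    refine hyL (a • z) ?_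
    have : (q : ℤ) ^ h • y - (q : ℤ) ^ (h + 1) • a • z =
        a • ((u * (q : ℤ) ^ h) • y - (q : ℤ) ^ (h + 1) • z) + b • ((q : ℤ) ^ (h + 1) • y) := by
      have e : (q : ℤ) ^ h = a * (u * (q : ℤ) ^ h) + b * (q : ℤ) ^ (h + 1) := by
        linear_combination (-(q : ℤ) ^ h) * hab
      nth_rewrite 1 [e]
      module
    rw [this, hy, smul_zero, add_zero]
    exact L.smul_mem _ hz
  refine ⟨fun x hx hxL => ?_, hL.of_le le_sup_right fun n z hn hz => ?_⟩
  · obtain ⟨a, rfl⟩ := Submodule.mem_span_singleton.1 hx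
    rcases eq_or_ne a 0 with rfl | ha
    · simp
    obtain ⟨i, u, hu, rfl⟩ := exists_eq_prime_pow_mul hq ha
    rcases le_or_gt i h with hih | hih
    · exfalso
      refine key u hu 0 ?_
      have : (u * (q : ℤ) ^ h) • y - (q : ℤ) ^ (h + 1) • (0 : N) =
          (q : ℤ) ^ (h - i) • ((q : ℤ) ^ i * u) • y := by
        rw [smul_zero, sub_zero, smul_smul, ← mul_assoc, ← pow_add, Nat.sub_add_cancel hih,
          mul_comm]
      rw [this]
      exact L.smul_mem _ hxL
    · obtain ⟨r, rfl⟩ := Nat.exists_eq_add_of_le (Nat.succ_le_of_lt hih)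
      rw [pow_add, mul_assoc, mul_comm, mul_smul, Nat.succ_eq_add_one, hy, smul_zero]
  · obtain ⟨x, hx, l, hl, hxl⟩ := Submodule.mem_sup.1 hz
    obtain ⟨a, rfl⟩ := Submodule.mem_span_singleton.1 hx
    suffices ∃ b : ℤ, a • y = (n * b) • y by
      obtain ⟨b, hb⟩ := this
      refine ⟨b • y, Submodule.mem_sup_left (Submodule.smul_mem _ _ (Submodule.mem_span_singleton_self y)), ?_⟩
      rw [smul_smul, ← hb, ← hxl, add_sub_cancel_left]
      exact hl
    rcases eq_or_ne a 0 with rfl | ha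
    · exact ⟨0, by simp⟩
    obtain ⟨s, u, hu, rfl⟩ := exists_eq_prime_pow_mul hq ha
    obtain ⟨i, m, hm, rfl⟩ := exists_eq_prime_pow_mul hq hn
    rcases le_or_gt s h with hsh | hsh
    -- Otherwise q^(h - s) times the relation would put u q^h y into q^(h+1) N + L.
    · have his : i ≤ s := by
        by_contra hlt
        refine key u hu ((q : ℤ) ^ (i - s - 1) • m • z) ?_
        have e1 : (q : ℤ) ^ (h + 1) • (q : ℤ) ^ (i - s - 1) • m • z =
            (q : ℤ) ^ (h - s) • ((q : ℤ) ^ i * m) • z := by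
          simp only [smul_smul, ← mul_assoc, ← pow_add]
          congr 3; omega
        have e2 : (u * (q : ℤ) ^ h) • y = (q : ℤ) ^ (h - s) • ((q : ℤ) ^ s * u) • y := by
          rw [smul_smul, ← mul_assoc, ← pow_add, Nat.sub_add_cancel hsh, mul_comm]
        rw [e1, e2, ← smul_sub, ← hxl, sub_add_cancel_left]
        exact L.smul_mem _ (L.neg_mem hl)
      obtain ⟨α, β, hαβ⟩ : IsCoprime m ((q : ℤ) ^ (h + 1)) := hm.pow_right
      refine ⟨(q : ℤ) ^ (s - i) * u * α, ?_⟩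
      have e3 : (q : ℤ) ^ s * u = (q : ℤ) ^ i * m * ((q : ℤ) ^ (s - i) * u * α) +
          ((q : ℤ) ^ s * u * β) * (q : ℤ) ^ (h + 1) := by
        have : (q : ℤ) ^ s = (q : ℤ) ^ i * (q : ℤ) ^ (s - i) := by
          rw [← pow_add]; congr 1; omega
        rw [this]
        linear_combination (-(q : ℤ) ^ i * (q : ℤ) ^ (s - i) * u) * hαβ
      rw [e3, add_smul, mul_smul _ ((q : ℤ) ^ (h + 1)), hy, smul_zero, add_zero]
    · obtain ⟨r, rfl⟩ := Nat.exists_eq_add_of_le (Nat.succ_le_of_lt hsh)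
      refine ⟨0, ?_⟩
      rw [pow_add, mul_assoc, mul_comm, mul_smul, Nat.succ_eq_add_one, hy, smul_zero, mul_zero,
        zero_smul]

/-- The `q`-primary component of `N`. -/
def primaryPart (N : Type v) [AddCommGroup N] (q : ℕ) : Submodule ℤ N where
  carrier := {x | ∃ j : ℕ, (q : ℤ) ^ j • x = 0}
  zero_mem' := ⟨0, by simp⟩
  add_mem' := by
    rintro a b ⟨i, hi⟩ ⟨j, hj⟩
    refine ⟨i + j, ?_⟩
    rw [smul_add, pow_add, mul_comm, mul_smul, hi, mul_comm, mul_smul, hj]; simp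
  smul_mem' := by
    rintro c a ⟨i, hi⟩
    exact ⟨i, by rw [smul_comm, hi, smul_zero]⟩

/-- The image of q^k N_q is the whole q-primary component of N/L, which is pure. It meets L
trivially because purity divides an element of the intersection by q^k inside L, where q^k kills
q-primary elements. -/
theorem isPureIndependent_map_primaryPart {L : Submodule ℤ N} (hL : IsPureSubgroup L) {q : ℕ}
    (hq : q.Prime) {k : ℕ} (hk : ∀ x ∈ L, x ∈ primaryPart N q → (q : ℤ) ^ k • x = 0)
    (hs : ∀ s : N, (q : ℤ) • s = 0 → ∀ h : ℕ, ∃ z, s - (q : ℤ) ^ h • z ∈ L) :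
    IsPureIndependent L ((primaryPart N q).map (LinearMap.lsmul ℤ N ((q : ℤ) ^ k))) ∧
    ∀ (j : ℕ) (z : N), (q : ℤ) ^ j • z ∈ L →
      z ∈ (primaryPart N q).map (LinearMap.lsmul ℤ N ((q : ℤ) ^ k)) ⊔ L := by
  have claim : ∀ (j : ℕ) (z : N), (q : ℤ) ^ j • z ∈ L →
      z ∈ (primaryPart N q).map (LinearMap.lsmul ℤ N ((q : ℤ) ^ k)) ⊔ L := by
    intro j
    induction j with
    | zero => intro z hz; exact Submodule.mem_sup_right (by simpa using hz)
    | succ j ih =>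
      intro z hz
      obtain ⟨l, hl, hlz⟩ := hL _ z hz
      have h0 : (q : ℤ) ^ (j + 1) • (z - l) = 0 := by rw [smul_sub, hlz, sub_self]
      -- Modulo L, q^j (z - l) equals q^(j+k) v. Subtracting q^k v lowers the exponent, and v can be
      -- corrected by L to be q-primary.
      obtain ⟨v, hv⟩ := hs ((q : ℤ) ^ j • (z - l)) (by rw [smul_smul, ← pow_succ', h0]) (j + k)
      have h1 := ih (z - l - (q : ℤ) ^ k • v) (by
        rw [smul_sub, smul_smul, ← pow_add]; exact hv)
      have h2 : (q : ℤ) ^ (j + k + 1) • v ∈ L := by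
        have : (q : ℤ) ^ (j + k + 1) • v = (q : ℤ) ^ (j + 1) • (z - l) -
            (q : ℤ) • ((q : ℤ) ^ j • (z - l) - (q : ℤ) ^ (j + k) • v) := by
          module
        rw [this, h0, zero_sub]
        exact L.neg_mem (L.smul_mem _ hv)
      obtain ⟨m, hm, hmv⟩ := hL _ v h2
      have h3 : (q : ℤ) ^ k • (v - m) ∈
          (primaryPart N q).map (LinearMap.lsmul ℤ N ((q : ℤ) ^ k)) :=
        ⟨v - m, ⟨j + k + 1, by rw [smul_sub, hmv, sub_self]⟩, rfl⟩
      have : z = (z - l - (q : ℤ) ^ k • v) + ((q : ℤ) ^ k • (v - m) + (l + (q : ℤ) ^ k • m)) := by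
        rw [smul_sub]; abel
      rw [this]
      exact Submodule.add_mem _ h1 (Submodule.add_mem_sup h3 (L.add_mem hl (L.smul_mem _ hm)))
  refine ⟨⟨?_, hL.of_le le_sup_right fun n y hn hy => ?_⟩, claim⟩
  · rintro _ ⟨u, ⟨j, hj⟩, rfl⟩ hu
    obtain ⟨l, hl, hlu⟩ := hL _ u hu
    have := hk l hl ⟨j + k, by rw [pow_add, mul_smul, hlu, smul_comm, hj, smul_zero]⟩
    rw [hlu] at this
    exact this
  · obtain ⟨_, ⟨u, ⟨j, hj⟩, rfl⟩, l, hl, hul⟩ := Submodule.mem_sup.1 hy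
    have h1 : (q : ℤ) ^ j • n • y ∈ L := by
      rw [← hul, smul_add, LinearMap.lsmul_apply, smul_comm, hj, smul_zero, zero_add]
      exact L.smul_mem _ hl
    obtain ⟨i, m, hm, rfl⟩ := exists_eq_prime_pow_mul hq hn
    obtain ⟨α, β, hαβ⟩ : IsCoprime m ((q : ℤ) ^ j) := hm.pow_right
    refine ⟨(α * m) • y, claim (j + i) _ ?_, ?_⟩
    · have : (q : ℤ) ^ (j + i) • (α * m) • y = α • (q : ℤ) ^ j • ((q : ℤ) ^ i * m) • y := by module
      rw [this]
      exact L.smul_mem _ h1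
    · have : ((q : ℤ) ^ i * m) • y - ((q : ℤ) ^ i * m) • (α * m) • y =
          β • (q : ℤ) ^ j • ((q : ℤ) ^ i * m) • y := by
        rw [smul_smul, smul_smul, smul_smul, ← sub_smul]
        congr 1
        linear_combination (-((q : ℤ) ^ i * m)) * hαβ
      rw [this]
      exact L.smul_mem _ h1

/-- If no nonzero subgroup is pure-independent of `L`, and `L` has bounded primary components, then
`N / L` is torsion-free. -/
theorem mem_of_zsmul_mem_of_maximal {L : Submodule ℤ N} (hL : IsPureSubgroup L)
    (hb : ∀ q : ℕ, q.Prime → ∃ k : ℕ, ∀ x ∈ L, x ∈ primaryPart N q → (q : ℤ) ^ k • x = 0)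
    (hmax : ∀ H, IsPureIndependent L H → H = ⊥) (n : ℤ) (y : N) (hn : n ≠ 0)
    (hy : n • y ∈ L) : y ∈ L := by
  have hprime : ∀ q : ℕ, q.Prime → ∀ y, (q : ℤ) • y ∈ L → y ∈ L := by
    intro q hq y hy
    obtain ⟨k, hk⟩ := hb q hq
    obtain ⟨l, hl, hly⟩ := hL _ y hy
    by_cases hs : ∀ s : N, (q : ℤ) • s = 0 → ∀ h : ℕ, ∃ z, s - (q : ℤ) ^ h • z ∈ L
    · obtain ⟨h1, h2⟩ := isPureIndependent_map_primaryPart hL hq hk hs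
      have h3 := h2 1 y (by rwa [pow_one])
      rwa [hmax _ h1, bot_sup_eq] at h3
    · exfalso
      push Not at hs
      obtain ⟨s, hs0, hsh⟩ := hs
      classical
      have hne : Nat.find hsh ≠ 0 := by
        intro h0
        have := Nat.find_spec hsh
        rw [h0] at this
        exact this s (by simp)
      obtain ⟨h, hh⟩ := Nat.exists_eq_succ_of_ne_zero hne
      have hmin := Nat.find_min hsh (m := h) (by omega)
      push Not at hmin
      obtain ⟨y₁, hy₁⟩ := hmin
      have hspec := Nat.find_spec hsh
      rw [hh, Nat.succ_eq_add_one] at hspec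
      have h1 : (q : ℤ) ^ (h + 1) • y₁ ∈ L := by
        have : (q : ℤ) ^ (h + 1) • y₁ = (q : ℤ) • s - (q : ℤ) • (s - (q : ℤ) ^ h • y₁) := by module
        rw [this, hs0, zero_sub]
        exact L.neg_mem (L.smul_mem _ hy₁)
      obtain ⟨l', hl', hly'⟩ := hL _ y₁ h1
      have hnot : ∀ z, (q : ℤ) ^ h • (y₁ - l') - (q : ℤ) ^ (h + 1) • z ∉ L := by
        intro z hz
        refine hspec z ?_
        have : s - (q : ℤ) ^ (h + 1) • z = (s - (q : ℤ) ^ h • y₁) + (q : ℤ) ^ h • l' +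
            ((q : ℤ) ^ h • (y₁ - l') - (q : ℤ) ^ (h + 1) • z) := by
          rw [smul_sub]; abel
        rw [this]
        exact L.add_mem (L.add_mem hy₁ (L.smul_mem _ hl')) hz
      have hbot := hmax _ (isPureIndependent_span_singleton hL hq (y := y₁ - l')
        (by rw [smul_sub, hly', sub_self]) hnot)
      rw [Submodule.span_singleton_eq_bot] at hbot
      exact hnot 0 (by rw [hbot]; simp)
  have hnat : ∀ m : ℕ, m ≠ 0 → ∀ y, (m : ℤ) • y ∈ L → y ∈ L := by
    intro m
    induction m using Nat.recOnMul with
    | zero => intro h; exact absurd rfl h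
    | one => intro _ y hy; simpa using hy
    | prime r hr => intro _; exact hprime r hr
    | mul a b iha ihb =>
      intro h y hy
      refine ihb (right_ne_zero_of_mul h) y (iha (left_ne_zero_of_mul h) _ ?_)
      rw [smul_smul]; exact_mod_cast hy
  refine hnat n.natAbs (by simpa using hn) y ?_
  rcases Int.natAbs_eq n with h | h
  · rwa [← h]
  · rw [show (n.natAbs : ℤ) = -n by omega, neg_smul]
    exact L.neg_mem hy

theorem IsPureIndependent.bounded_map_mkQ {L H : Submodule ℤ N}
    (hH : IsPureIndependent L H) {q k : ℕ}
    (hk : ∀ x ∈ L, x ∈ primaryPart N q → (q : ℤ) ^ k • x = 0) :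
    ∀ x ∈ L.map H.mkQ, x ∈ primaryPart (N ⧸ H) q → (q : ℤ) ^ k • x = 0 := by
  rintro _ ⟨x, hx, rfl⟩ ⟨j, hj⟩
  rw [← map_smul] at hj ⊢
  have := hH.1 _ ((Submodule.Quotient.mk_eq_zero H).1 hj) (L.smul_mem _ hx)
  rw [hk x hx ⟨j, this⟩, map_zero]

theorem IsPureIndependent.map_mkQ {L H : Submodule ℤ N}
    (hH : IsPureIndependent L H) : IsPureSubgroup (L.map H.mkQ) := by
  have := hH.2.map_mkQ (le_sup_left : H ≤ H ⊔ L)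
  rwa [Submodule.map_sup, Submodule.mkQ_map_self, bot_sup_eq] at this

end PureIndependent

/-! ### Splitting torsion off rank-one subgroups -/

section TorsionSplitting

variable {p : ℕ} {N : Type v} [AddCommGroup N]

theorem mem_rationalHull_zero {x : N} : x ∈ rationalHull (0 : N) ↔ ∃ m : ℤ, m ≠ 0 ∧ m • x = 0 := by
  simp [rationalHull]

theorem rationalHull_zero_le (z : N) : rationalHull (0 : N) ≤ rationalHull z :=
  rationalHull_le (Submodule.zero_mem _) mem_rationalHull_of_zsmul_mem

/-- For almost all primes `q`, `z` is as divisible by powers of `q` as it is modulo torsion. -/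
theorem HasFamilyExtension.finite_primes_torsion (hN : HasFamilyExtension p N) (hp : p.Prime)
    (z : N) : {q : ℕ | q.Prime ∧ q ≠ p ∧ ∃ h : ℕ,
      (∃ y, z - (q : ℤ) ^ h • y ∈ rationalHull (0 : N)) ∧ ∀ y, (q : ℤ) ^ h • y ≠ z}.Finite := by
  classical
  set S := {q : ℕ | q.Prime ∧ q ≠ p ∧ ∃ h : ℕ,
      (∃ y, z - (q : ℤ) ^ h • y ∈ rationalHull (0 : N)) ∧ ∀ y, (q : ℤ) ^ h • y ≠ z}
  -- Each exceptional prime gives a map into ℤ/q^h nonzero at z. Other indices carry the zero map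
  -- into ℤ/4, whose order is never p.
  have data : ∀ q : ℕ, ∃ b e : ℕ, b.Prime ∧ e ≠ 0 ∧ b ^ e ≠ p ∧
      ∃ f : N →ₗ[ℤ] ZMod (b ^ e), (q ∈ S → b = q ∧ f z ≠ 0 ∧
        ∃ y, z - (b : ℤ) ^ e • y ∈ rationalHull (0 : N)) ∧ (q ∉ S → f = 0) := by
    intro q
    by_cases hq : q ∈ S
    · obtain ⟨hqp, hne, h, hy, hz⟩ := hq
      have hh : h ≠ 0 := by
        rintro rfl
        exact hz z (by simp)
      obtain ⟨f, hf⟩ := exists_zmod_ne_zero (n := q ^ h) (pow_ne_zero _ hqp.ne_zero) z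
        (by push_cast; exact hz)
      refine ⟨q, h, hqp, hh, ?_, f, fun _ => ⟨rfl, hf, hy⟩,
        fun hn => absurd ⟨hqp, hne, h, hy, hz⟩ hn⟩
      intro hpow
      have h1 : h = 1 := by
        by_contra h1
        exact Nat.Prime.not_prime_pow (by omega) (hpow ▸ hp)
      exact hne (by rw [← hpow, h1, pow_one])
    · exact ⟨2, 2, Nat.prime_two, two_ne_zero,
        fun h => Nat.Prime.not_prime_pow le_rfl (h ▸ hp), 0, fun h => absurd h hq, fun _ => rfl⟩
  choose b e hb he hbe f hf hf0 using data
  -- A torsion element killed by m is seen only by primes dividing m, so on torsion the family is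
  -- pointwise finite.
  obtain ⟨g, hg, hgf⟩ := hN _ (isPureSubgroup_rationalHull (0 : N)) (fun n => ZMod (b n ^ e n))
    (fun n => isUniformNe_zmod_prime_pow (hb n) (he n) (hbe n))
    (fun n => (f n).comp (Submodule.subtype _)) (by
      rintro ⟨x, hx⟩
      obtain ⟨m, hm, hmx⟩ := mem_rationalHull_zero.1 hx
      refine (Set.finite_Iic m.natAbs).subset fun n hn => ?_
      have hnS : n ∈ S := by
        by_contra h
        exact hn (by rw [hf0 n h]; rfl)
      have hbn := (hf n hnS).1
      by_contra hlt
      have hcop : IsCoprime m ((b n : ℤ) ^ e n) := by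
        refine IsCoprime.pow_right ?_
        refine ((Nat.prime_iff_prime_int.1 (hb n)).coprime_iff_not_dvd.2 fun hd => hlt ?_).symm
        rw [hbn] at hd
        exact Nat.le_of_dvd (Int.natAbs_pos.2 hm) (Int.natCast_dvd.1 hd)
      obtain ⟨α, β, hαβ⟩ := hcop
      apply hn
      have h1 : m • f n x = 0 := by rw [← map_smul, hmx, map_zero]
      have h2 : (b n : ℤ) ^ e n • f n x = 0 := by
        have := zsmul_zmod_self (b n ^ e n) (f n x)
        push_cast at this; exact this
      change f n x = 0
      rw [← one_smul ℤ (f n x), ← hαβ, add_smul, mul_smul, mul_smul, h1, h2]; simp)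
  refine (hgf z).subset fun n hn => ?_
  obtain ⟨-, hfz, y, hy⟩ := hf n hn
  -- Maps into ℤ/b^e agree on z and on the torsion element z - b^e y, so g n z = f n z ≠ 0 at each
  -- exceptional prime.
  have hkill : ∀ (k : N →ₗ[ℤ] ZMod (b n ^ e n)),
      k (z - (b n : ℤ) ^ e n • y) = k z := by
    intro k
    have h2 : (b n : ℤ) ^ e n • k y = 0 := by
      have := zsmul_zmod_self (b n ^ e n) (k y)
      push_cast at this; exact this
    rw [map_sub, map_smul, h2, sub_zero]
  intro h0
  exact hfz ((hkill (f n)).symm.trans ((hg n ⟨_, hy⟩).symm.trans ((hkill (g n)).trans h0)))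

/-- Up to a `q`-primary element, `z` is as divisible by powers of `q` as it is modulo torsion. -/
theorem exists_primary_correction {q : ℕ} (hq : q.Prime) {k : ℕ}
    (hk : ∀ x ∈ primaryPart N q, (q : ℤ) ^ k • x = 0) (z : N) :
    ∃ t ∈ primaryPart N q, ∀ h : ℕ, (∃ y, z - (q : ℤ) ^ h • y ∈ rationalHull (0 : N)) →
      ∃ y, (q : ℤ) ^ h • y = z - t := by
  have key : ∀ h : ℕ, (∃ y, z - (q : ℤ) ^ h • y ∈ rationalHull (0 : N)) →
      ∃ t ∈ primaryPart N q, ∃ y, (q : ℤ) ^ h • y = z - t := by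
    rintro h ⟨y, hy⟩
    obtain ⟨m, hm, hmy⟩ := mem_rationalHull_zero.1 hy
    obtain ⟨j, m', hm', rfl⟩ := exists_eq_prime_pow_mul hq hm
    obtain ⟨α, β, hαβ⟩ : IsCoprime m' ((q : ℤ) ^ h) := hm'.pow_right
    refine ⟨(α * m') • (z - (q : ℤ) ^ h • y), ⟨j, ?_⟩, y + β • (z - (q : ℤ) ^ h • y), ?_⟩
    · rw [smul_smul, show (q : ℤ) ^ j * (α * m') = α * ((q : ℤ) ^ j * m') by ring, mul_smul, hmy,
        smul_zero]
    · have e : (α * m') • (z - (q : ℤ) ^ h • y) =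
          (1 - β * (q : ℤ) ^ h) • (z - (q : ℤ) ^ h • y) := by
        congr 1; linear_combination hαβ
      rw [e]
      module
  have hmono : ∀ h h' : ℕ, h ≤ h' → ∀ x : N, (∃ y, (q : ℤ) ^ h' • y = x) →
      ∃ y, (q : ℤ) ^ h • y = x := by
    rintro h h' hh x ⟨y, rfl⟩
    exact ⟨(q : ℤ) ^ (h' - h) • y, by rw [smul_smul, ← pow_add, Nat.add_sub_cancel' hh]⟩
  -- If so, the corrections for h ≥ k all coincide: two of them differ by q^k times a q-primary
  -- element, which is zero.
  by_cases hP : ∃ y, z - (q : ℤ) ^ k • y ∈ rationalHull (0 : N)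
  · obtain ⟨t, ht, y, hy⟩ := key k hP
    refine ⟨t, ht, fun h hh => ?_⟩
    rcases le_total h k with hle | hle
    · exact hmono _ _ hle _ ⟨y, hy⟩
    · obtain ⟨t', ht', y', hy'⟩ := key h hh
      obtain ⟨y'', hy''⟩ := hmono _ _ hle _ ⟨y', hy'⟩
      have h1 : (q : ℤ) ^ k • (y'' - y) = t - t' := by rw [smul_sub, hy'', hy]; abel
      obtain ⟨i, hi⟩ := (primaryPart N q).sub_mem ht ht'
      have h2 := hk (y'' - y) ⟨i + k, by rw [pow_add, mul_smul, h1, hi]⟩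
      rw [h1] at h2
      exact ⟨y', by rw [hy', sub_eq_zero.1 h2]⟩
  · classical
    -- Otherwise only powers of q below a bound matter, and the correction for the largest one
    -- serves.
    have hex : ∃ k : ℕ, ¬ ∃ y, z - (q : ℤ) ^ k • y ∈ rationalHull (0 : N) := ⟨k, hP⟩
    have hne : Nat.find hex ≠ 0 := by
      intro h0
      have := Nat.find_spec hex
      rw [h0] at this
      exact this ⟨z, by simp⟩
    obtain ⟨l, hl⟩ := Nat.exists_eq_succ_of_ne_zero hne
    obtain ⟨t, ht, hy⟩ := key l (not_not.1 (Nat.find_min hex (m := l) (by omega)))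
    refine ⟨t, ht, fun h hh => hmono _ _ ?_ _ hy⟩
    by_contra hlt
    obtain ⟨y, hy⟩ := hh
    refine Nat.find_spec hex ⟨(q : ℤ) ^ (h - Nat.find hex) • y, ?_⟩
    rwa [smul_smul, ← pow_add, Nat.add_sub_cancel' (by omega)]

theorem exists_zsmul_eq_of_primary {q r : ℕ} (hq : q.Prime) (hr : r.Prime) (hqr : q ≠ r) {t : N}
    (ht : t ∈ primaryPart N r) (h : ℕ) : ∃ y, (q : ℤ) ^ h • y = t := by
  obtain ⟨j, hj⟩ := ht
  obtain ⟨α, β, hαβ⟩ : IsCoprime ((q : ℤ) ^ h) ((r : ℤ) ^ j) :=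
    (Nat.isCoprime_iff_coprime.2 ((Nat.coprime_primes hq hr).2 hqr)).pow
  refine ⟨α • t, ?_⟩
  rw [smul_smul, mul_comm]
  nth_rewrite 2 [← one_smul ℤ t]
  rw [← hαβ, add_smul, mul_smul β, hj, smul_zero, add_zero]

/-- An element may be changed by a torsion element so that it becomes as divisible as it is
modulo torsion. -/
theorem HasFamilyExtension.exists_torsion_correction (hN : HasFamilyExtension p N) (hp : p.Prime)
    (hb : ∀ q : ℕ, q.Prime → ∃ k : ℕ, ∀ x ∈ primaryPart N q, (q : ℤ) ^ k • x = 0) (z : N) :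
    ∃ z', z - z' ∈ rationalHull (0 : N) ∧ ∀ n : ℤ, n ≠ 0 →
      (∃ y, z' - n • y ∈ rationalHull (0 : N)) → ∃ y, n • y = z' := by
  classical
  have hprim : ∀ q : ℕ, q.Prime → primaryPart N q ≤ rationalHull (0 : N) := by
    rintro q hq x ⟨j, hj⟩
    exact mem_rationalHull_zero.2 ⟨_, pow_ne_zero j (by exact_mod_cast hq.ne_zero), hj⟩
  have hcor : ∀ q : ℕ, ∃ t : N, q.Prime → t ∈ primaryPart N q ∧
      ∀ h : ℕ, (∃ y, z - (q : ℤ) ^ h • y ∈ rationalHull (0 : N)) →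
        ∃ y, (q : ℤ) ^ h • y = z - t := by
    intro q
    by_cases hq : q.Prime
    · obtain ⟨k, hk⟩ := hb q hq
      obtain ⟨t, ht, h⟩ := exists_primary_correction hq hk z
      exact ⟨t, fun _ => ⟨ht, h⟩⟩
    · exact ⟨0, fun h => absurd h hq⟩
  choose t ht using hcor
  -- p is outside the scope of `finite_primes_torsion`, so it is corrected too. A correction at one
  -- prime is divisible by all powers of the others and does not disturb them.
  let S := insert p (hN.finite_primes_torsion hp z).toFinset
  have hSp : ∀ q ∈ S, q.Prime := by
    intro q hq
    rcases Finset.mem_insert.1 hq with rfl | hq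
    · exact hp
    · exact ((hN.finite_primes_torsion hp z).mem_toFinset.1 hq).1
  have hsumT : ∑ q ∈ S, t q ∈ rationalHull (0 : N) :=
    Submodule.sum_mem _ fun q hq => hprim q (hSp q hq) (ht q (hSp q hq)).1
  let z' := z - ∑ q ∈ S, t q
  have hzz' : ∀ y : N, z' - y ∈ rationalHull (0 : N) ↔ z - y ∈ rationalHull (0 : N) := by
    intro y
    rw [show z - y = z' - y + ∑ q ∈ S, t q by simp only [z']; abel]
    exact (Submodule.add_mem_iff_left _ hsumT).symm
  have hpow : ∀ q : ℕ, q.Prime → ∀ h : ℕ,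
      (∃ y, z' - (q : ℤ) ^ h • y ∈ rationalHull (0 : N)) → ∃ y, (q : ℤ) ^ h • y = z' := by
    rintro q hq h ⟨y, hy⟩
    rw [hzz'] at hy
    let R : Submodule ℤ N := LinearMap.range (LinearMap.lsmul ℤ N ((q : ℤ) ^ h))
    have hrest : ∀ s : Finset ℕ, s ⊆ S → q ∉ s → ∑ r ∈ s, t r ∈ R := by
      intro s hs hqs
      refine R.sum_mem fun r hr => ?_
      have hrp := hSp r (hs hr)
      exact exists_zsmul_eq_of_primary hq hrp (by rintro rfl; exact hqs hr) (ht r hrp).1 h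
    suffices z' ∈ R from this
    by_cases hqS : q ∈ S
    · have : z' = (z - t q) - ∑ r ∈ S.erase q, t r := by
        simp only [z']
        rw [← Finset.add_sum_erase _ _ hqS]; abel
      rw [this]
      exact R.sub_mem ((ht q hq).2 h ⟨y, hy⟩) (hrest _ (Finset.erase_subset _ _)
        (Finset.notMem_erase _ _))
    · refine R.sub_mem ?_ (hrest S (Finset.Subset.refl _) hqS)
      by_contra hzR
      apply hqS
      refine Finset.mem_insert_of_mem ((hN.finite_primes_torsion hp z).mem_toFinset.2
        ⟨hq, ?_, h, ⟨y, hy⟩, fun y hy => hzR ⟨y, hy⟩⟩)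
      rintro rfl
      exact hqS (Finset.mem_insert_self _ _)
  have hnat : ∀ n : ℕ, n ≠ 0 → (∃ y, z' - (n : ℤ) • y ∈ rationalHull (0 : N)) →
      ∃ y, (n : ℤ) • y = z' := by
    intro n
    induction n using Nat.recOnPrimeCoprime with
    | zero => intro h; exact absurd rfl h
    | prime_pow q h hq => intro _; push_cast; exact hpow q hq h
    | coprime a b ha hb hab iha ihb =>
      rintro - ⟨y, hy⟩
      push_cast at hy ⊢
      obtain ⟨y₁, hy₁⟩ := iha (by omega) ⟨(b : ℤ) • y, by rwa [smul_smul]⟩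
      obtain ⟨y₂, hy₂⟩ := ihb (by omega) ⟨(a : ℤ) • y, by rwa [smul_smul, mul_comm]⟩
      obtain ⟨α, β, hαβ⟩ := Nat.isCoprime_iff_coprime.2 hab
      refine ⟨α • y₂ + β • y₁, ?_⟩
      have : ((a : ℤ) * b) • (α • y₂ + β • y₁) =
          (α * a) • ((b : ℤ) • y₂) + (β * b) • ((a : ℤ) • y₁) := by module
      rw [this, hy₁, hy₂, ← add_smul, hαβ, one_smul]
  refine ⟨z', by simpa [z'] using hsumT, fun n hn ⟨y, hy⟩ => ?_⟩
  rcases Int.natAbs_eq n with h | h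
  · rw [h]
    exact hnat _ (by simpa using hn) ⟨y, by rwa [← h]⟩
  · obtain ⟨x, hx⟩ := hnat n.natAbs (by simpa using hn) ⟨-y, by
      rw [show (n.natAbs : ℤ) = -n by omega]; simpa using hy⟩
    exact ⟨-x, by rw [← hx, h]; simp⟩

/-- If the primary components are bounded, the torsion subgroup splits off from every subgroup of
torsion-free rank one. -/
theorem HasFamilyExtension.exists_complement_torsion (hN : HasFamilyExtension p N) (hp : p.Prime)
    (hb : ∀ q : ℕ, q.Prime → ∃ k : ℕ, ∀ x ∈ primaryPart N q, (q : ℤ) ^ k • x = 0)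
    {z : N} (hz : z ∉ rationalHull (0 : N)) :
    ∃ C : Submodule ℤ N, (∀ x ∈ C, x ∈ rationalHull (0 : N) → x = 0) ∧
      C ⊔ rationalHull (0 : N) = rationalHull z := by
  obtain ⟨z', hzz', hz'⟩ := hN.exists_torsion_correction hp hb z
  set T := rationalHull (0 : N) with hT
  have hTz : ∀ x, T ≤ rationalHull x := rationalHull_zero_le
  have hTt : ∀ (n : ℤ) (x : N), n ≠ 0 → n • x ∈ T → x ∈ T := mem_rationalHull_of_zsmul_mem
  have hz'T : z' ∉ T := fun h => hz (by
    have := T.add_mem hzz' h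
    rwa [sub_add_cancel] at this)
  have hhull : rationalHull z' = rationalHull z := by
    apply le_antisymm
    · refine rationalHull_le ?_ mem_rationalHull_of_zsmul_mem
      have := (rationalHull z).sub_mem (self_mem_rationalHull z) (hTz z hzz')
      rwa [sub_sub_cancel] at this
    · refine rationalHull_le ?_ mem_rationalHull_of_zsmul_mem
      have := (rationalHull z').add_mem (hTz z' hzz') (self_mem_rationalHull z')
      rwa [sub_add_cancel] at this
  have hzero : ∀ n : ℤ, n • z' ∈ T → n = 0 := fun n hn => by
    by_contra h0
    exact hz'T (hTt n z' h0 hn)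
  -- By the choice of z', T stays pure in N/P. After a maximal pure-independent H is divided out,
  -- the quotient by T is torsion-free, whereas the hull of z is torsion modulo P; so its image lies
  -- in T + H, and the preimage of H gives the complement.
  let P := Submodule.span ℤ {z'}
  have hmk : ∀ x, P.mkQ x = 0 ↔ ∃ n : ℤ, n • z' = x := fun x =>
    (Submodule.Quotient.mk_eq_zero P).trans Submodule.mem_span_singleton
  have hTpure : IsPureSubgroup (T.map P.mkQ) := by
    intro n y hy
    rcases eq_or_ne n 0 with rfl | hn
    · exact ⟨0, Submodule.zero_mem _, by simp⟩
    obtain ⟨y, rfl⟩ := P.mkQ_surjective y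
    obtain ⟨t, ht, hty⟩ := hy
    rw [← map_smul, ← sub_eq_zero, ← map_sub, hmk] at hty
    obtain ⟨m, hm⟩ := hty
    have hd : Int.gcd m n ≠ 0 := fun h => hn (Int.gcd_eq_zero_iff.1 h).2
    obtain ⟨m₁, n₁, hcop, hm₁, hn₁⟩ := Int.exists_gcd_one (Nat.pos_of_ne_zero hd)
    have hcop' : IsCoprime m₁ n₁ := Int.isCoprime_iff_gcd_eq_one.2 hcop
    set d : ℤ := (Int.gcd m n : ℤ)
    have hd0 : d ≠ 0 := Int.natCast_ne_zero.2 hd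
    have h1 : m₁ • z' + n₁ • y ∈ T := by
      refine hTt d _ hd0 ?_
      have : d • (m₁ • z' + n₁ • y) = m • z' + n • y := by rw [hm₁, hn₁]; module
      rw [this, hm, sub_add_cancel]
      exact ht
    -- Bézout shows z' divisible by n₁ modulo torsion, hence outright: z' = n₁ w. Then y + m₁ w is
    -- the torsion element needed.
    obtain ⟨α, β, hαβ⟩ := hcop'
    have hn₁0 : n₁ ≠ 0 := by
      rintro rfl
      exact hn (by rw [hn₁, zero_mul])
    obtain ⟨w, hw⟩ := hz' n₁ hn₁0 ⟨β • z' - α • y, by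
      have : z' - n₁ • (β • z' - α • y) = α • (m₁ • z' + n₁ • y) := by
        nth_rewrite 1 [← one_smul ℤ z']
        rw [← hαβ]; module
      rw [this]
      exact T.smul_mem _ h1⟩
    have h2 : n • (y + m₁ • w) = t := by
      have : n • (y + m₁ • w) = n • y + m • z' := by
        rw [← hw, hn₁, hm₁]; module
      rw [this, hm]; abel
    refine ⟨P.mkQ (y + m₁ • w), ⟨_, hTt n _ hn (h2 ▸ ht), rfl⟩, ?_⟩
    rw [← map_smul, ← map_smul, h2, ← sub_eq_zero, ← map_sub, hmk]
    exact ⟨m, hm⟩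
  have hTb : ∀ q : ℕ, q.Prime → ∃ k : ℕ, ∀ x ∈ T.map P.mkQ, x ∈ primaryPart (N ⧸ P) q →
      (q : ℤ) ^ k • x = 0 := by
    intro q hq
    obtain ⟨k, hk⟩ := hb q hq
    refine ⟨k, ?_⟩
    rintro _ ⟨x, hx, rfl⟩ ⟨j, hj⟩
    rw [← map_smul, hmk] at hj
    obtain ⟨n, hn⟩ := hj
    have h0 := hzero n (hn ▸ T.smul_mem _ hx)
    rw [h0, zero_smul] at hn
    rw [← map_smul, hk x ⟨j, hn.symm⟩, map_zero]
  obtain ⟨H, hH, hmax⟩ := exists_isPureIndependent_quotient hTpure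
  have htfree := mem_of_zsmul_mem_of_maximal hH.map_mkQ
    (fun q hq => (hTb q hq).imp fun k hk => hH.bounded_map_mkQ hk) hmax
  have hCT : ∀ x ∈ H.comap P.mkQ, x ∈ T → x = 0 := by
    intro x hx hxT
    have := hH.1 _ hx ⟨x, hxT, rfl⟩
    rw [hmk] at this
    obtain ⟨n, rfl⟩ := this
    rw [hzero n hxT, zero_smul]
  refine ⟨H.comap P.mkQ ⊓ rationalHull z, fun x hx hxT => hCT x hx.1 hxT, ?_⟩
  refine le_antisymm (sup_le inf_le_right (hTz z)) fun y hy => ?_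
  obtain ⟨m, hm, n, hn⟩ : y ∈ rationalHull z' := hhull ▸ hy
  have h1 : H.mkQ (P.mkQ y) ∈ (T.map P.mkQ).map H.mkQ := by
    refine htfree m _ hm ?_
    rw [← map_smul, ← map_smul, (hmk _).2 ⟨n, hn.symm⟩, map_zero]
    exact Submodule.zero_mem _
  obtain ⟨_, ⟨t, ht, rfl⟩, hty⟩ := h1
  rw [← sub_eq_zero, ← map_sub] at hty
  have hmem : P.mkQ t - P.mkQ y ∈ H := (Submodule.Quotient.mk_eq_zero H).1 hty
  rw [← map_sub] at hmem
  refine Submodule.mem_sup.2 ⟨y - t, ⟨?_, (rationalHull z).sub_mem hy (hTz z ht)⟩, t, ht, by abel⟩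
  have := H.neg_mem hmem
  rw [← map_neg, neg_sub] at this
  exact this

end TorsionSplitting

/-! ### Complements of pure subgroups -/

section Splitting

variable {p : ℕ} {N : Type v} [AddCommGroup N]

theorem isDivisibleSubgroup_sup {D E : Submodule ℤ N} (hD : IsDivisibleSubgroup D)
    (hE : IsDivisibleSubgroup E) : IsDivisibleSubgroup (D ⊔ E) := by
  intro r hr x hx
  obtain ⟨d, hd, e, he, rfl⟩ := Submodule.mem_sup.1 hx
  obtain ⟨d', hd', rfl⟩ := hD r hr d hd
  obtain ⟨e', he', rfl⟩ := hE r hr e he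
  exact ⟨d' + e', Submodule.add_mem_sup hd' he', smul_add _ _ _⟩

/-- The largest divisible subgroup of `L`. -/
def divisiblePart (L : Submodule ℤ N) : Submodule ℤ N where
  carrier := {x | ∃ E ≤ L, IsDivisibleSubgroup E ∧ x ∈ E}
  zero_mem' := ⟨⊥, bot_le, fun r _ x hx => ⟨0, by simp, by simpa using hx.symm⟩, by simp⟩
  add_mem' := by
    rintro a b ⟨D, hDL, hD, ha⟩ ⟨E, hEL, hE, hb⟩
    exact ⟨D ⊔ E, sup_le hDL hEL, isDivisibleSubgroup_sup hD hE, Submodule.add_mem_sup ha hb⟩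
  smul_mem' := by
    rintro c a ⟨D, hDL, hD, ha⟩
    exact ⟨D, hDL, hD, D.smul_mem c ha⟩

theorem divisiblePart_le (L : Submodule ℤ N) : divisiblePart L ≤ L := by
  rintro x ⟨E, hEL, -, hx⟩
  exact hEL hx

theorem isDivisibleSubgroup_divisiblePart (L : Submodule ℤ N) :
    IsDivisibleSubgroup (divisiblePart L) := by
  rintro r hr x ⟨E, hEL, hE, hx⟩
  obtain ⟨y, hy, rfl⟩ := hE r hr x hx
  exact ⟨y, ⟨E, hEL, hE, hy⟩, rfl⟩

/-- The primary components of a reduced pure subgroup are bounded. -/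
theorem HasFamilyExtension.bounded_of_reduced (hN : HasFamilyExtension p N) (hp : p.Prime)
    {L : Submodule ℤ N} (hL : IsPureSubgroup L)
    (hred : ∀ D ≤ L, IsDivisibleSubgroup D → D = ⊥) {q : ℕ} (hq : q.Prime) :
    ∃ k : ℕ, ∀ x ∈ L, x ∈ primaryPart N q → (q : ℤ) ^ k • x = 0 := by
  obtain ⟨k, hk⟩ := (hN.subgroup hL).bounded_mod_divisible hp hq
  refine ⟨k, fun x hx hxq => ?_⟩
  -- Divisibility by q comes from the choice of k, and by other primes from being q-primary;
  -- reducedness then makes this subgroup zero.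
  have hdiv : IsDivisibleSubgroup
      ((L ⊓ primaryPart N q).map (LinearMap.lsmul ℤ N ((q : ℤ) ^ k))) := by
    rintro r hr _ ⟨y, ⟨hyL, j, hj⟩, rfl⟩
    rcases eq_or_ne r q with rfl | hrq
    · obtain ⟨z, hz⟩ := hk ⟨y, hyL⟩ ⟨j, Subtype.ext hj⟩
      have hz' : (r : ℤ) ^ (k + 1) • (z : N) = (r : ℤ) ^ k • y := congrArg Subtype.val hz
      refine ⟨(r : ℤ) ^ k • (z : N), ⟨z, ⟨z.2, j + (k + 1), ?_⟩, rfl⟩, ?_⟩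
      · rw [pow_add, mul_smul, hz', smul_comm, hj, smul_zero]
      · rw [smul_smul, ← pow_succ', hz']; rfl
    · obtain ⟨α, β, hαβ⟩ : IsCoprime (r : ℤ) ((q : ℤ) ^ j) :=
        (Nat.isCoprime_iff_coprime.2 ((Nat.coprime_primes hr hq).2 hrq)).pow_right
      refine ⟨(q : ℤ) ^ k • α • y, ⟨α • y, ⟨L.smul_mem _ hyL, j, ?_⟩, rfl⟩, ?_⟩
      · rw [smul_comm, hj, smul_zero]
      · have : (r : ℤ) • (q : ℤ) ^ k • α • y =
            (q : ℤ) ^ k • ((α * r + β * (q : ℤ) ^ j) • y - β • (q : ℤ) ^ j • y) := by module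
        rw [this, hαβ, hj, one_smul, smul_zero, sub_zero]; rfl
  have hbot := hred _ (by
    rintro _ ⟨y, hy, rfl⟩
    exact L.smul_mem _ hy.1) hdiv
  have hmem : (q : ℤ) ^ k • x ∈ (L ⊓ primaryPart N q).map (LinearMap.lsmul ℤ N ((q : ℤ) ^ k)) :=
    ⟨x, ⟨hx, hxq⟩, rfl⟩
  rwa [hbot] at hmem

/-- Boundedness makes N/L torsion-free, so L contains the torsion T. Since T splits off rank-one
subgroups, a nonzero divisible subgroup of L/T would give one of L; so L/T is reduced and has a
complement G in N/T. A nonzero element of G would lift, by the same splitting, to a rank-one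
subgroup pure-independent of L. -/
theorem HasFamilyExtension.eq_top_of_maximal (hN : HasFamilyExtension p N) (hp : p.Prime)
    {L : Submodule ℤ N} (hL : IsPureSubgroup L)
    (hred : ∀ D ≤ L, IsDivisibleSubgroup D → D = ⊥)
    (hmax : ∀ H, IsPureIndependent L H → H = ⊥) : L = ⊤ := by
  have hbL := fun (q : ℕ) (hq : q.Prime) => hN.bounded_of_reduced hp hL hred hq
  have hLt := mem_of_zsmul_mem_of_maximal hL hbL hmax
  set T := rationalHull (0 : N) with hT
  have hTL : T ≤ L := rationalHull_le L.zero_mem hLt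
  have hTz : ∀ x, T ≤ rationalHull x := rationalHull_zero_le
  have hTt : ∀ (n : ℤ) (x : N), n ≠ 0 → n • x ∈ T → x ∈ T := mem_rationalHull_of_zsmul_mem
  have hb : ∀ q : ℕ, q.Prime → ∃ k : ℕ, ∀ x ∈ primaryPart N q, (q : ℤ) ^ k • x = 0 := by
    intro q hq
    obtain ⟨k, hk⟩ := hbL q hq
    refine ⟨k, fun x hx => hk x (hTL ?_) hx⟩
    obtain ⟨j, hj⟩ := hx
    exact mem_rationalHull_zero.2 ⟨_, pow_ne_zero j (by exact_mod_cast hq.ne_zero), hj⟩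
  have hmk : ∀ x, T.mkQ x = 0 ↔ x ∈ T := fun x => Submodule.Quotient.mk_eq_zero T
  have hX := hN.quotient (isPureSubgroup_rationalHull (0 : N))
  have htf : ∀ (n : ℤ) (x : N ⧸ T), n ≠ 0 → n • x = 0 → x = 0 := by
    intro n x hn hx
    obtain ⟨x, rfl⟩ := T.mkQ_surjective x
    rw [← map_smul, hmk] at hx
    exact (hmk x).2 (hTt n x hn hx)
  have hFmem : ∀ x, T.mkQ x ∈ L.map T.mkQ ↔ x ∈ L := by
    intro x
    rw [← Submodule.mem_comap, Submodule.comap_map_mkQ, sup_eq_right.2 hTL]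
  have hF : ∀ (n : ℤ) (x : N ⧸ T), n ≠ 0 → n • x ∈ L.map T.mkQ → x ∈ L.map T.mkQ := by
    intro n x hn hx
    obtain ⟨x, rfl⟩ := T.mkQ_surjective x
    rw [← map_smul, hFmem] at hx
    exact (hFmem x).2 (hLt n x hn hx)
  have hFred : ∀ D ≤ L.map T.mkQ, IsDivisibleSubgroup D → D = ⊥ := by
    intro D hDF hD
    by_contra hbot
    obtain ⟨x, hx, hx0⟩ := Submodule.exists_mem_ne_zero_of_ne_bot hbot
    obtain ⟨z, rfl⟩ := T.mkQ_surjective x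
    have hzT : z ∉ T := fun h => hx0 ((hmk z).2 h)
    obtain ⟨C, hCT, hC⟩ := hN.exists_complement_torsion hp hb hzT
    have hCz : C ≤ rationalHull z := hC ▸ le_sup_left
    have hCdiv : IsDivisibleSubgroup C := by
      intro r hr c hc
      have hcD : T.mkQ c ∈ D := by
        obtain ⟨m, hm, n, hn⟩ := hCz hc
        have hn' : m • T.mkQ c ∈ D := by
          rw [← map_smul, hn, map_smul]; exact D.smul_mem _ hx
        obtain ⟨d, hd, hdc⟩ := forall_exists_zsmul_eq_of_prime hD m hm _ hn'
        have := htf m (d - T.mkQ c) hm (by rw [smul_sub, hdc, sub_self])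
        rwa [← sub_eq_zero.1 this]
      obtain ⟨d, hd, hdc⟩ := hD r hr _ hcD
      obtain ⟨y, rfl⟩ := T.mkQ_surjective d
      rw [← map_smul, ← sub_eq_zero, ← map_sub, hmk] at hdc
      have hr0 : (r : ℤ) ≠ 0 := by exact_mod_cast hr.ne_zero
      have hyz : y ∈ rationalHull z := by
        refine mem_rationalHull_of_zsmul_mem _ y hr0 ?_
        have := (rationalHull z).add_mem (hTz z hdc) (hCz hc)
        rwa [sub_add_cancel] at this
      rw [← hC] at hyz
      obtain ⟨c', hc', t, ht, rfl⟩ := Submodule.mem_sup.1 hyz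
      refine ⟨c', hc', ?_⟩
      rw [← sub_eq_zero]
      refine hCT _ (C.sub_mem (C.smul_mem _ hc') hc) ?_
      have : (r : ℤ) • c' - c = ((r : ℤ) • (c' + t) - c) - (r : ℤ) • t := by
        rw [smul_add]; abel
      rw [this]
      exact T.sub_mem hdc (T.smul_mem _ ht)
    have hCbot := hred C (hCz.trans (rationalHull_le ((hFmem z).1 (hDF hx)) hLt)) hCdiv
    rw [hCbot, bot_sup_eq] at hC
    exact hzT (by rw [hT, hC]; exact self_mem_rationalHull z)
  obtain ⟨G, hG⟩ := hX.exists_isCompl_of_torsionFree htf hp hF hFred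
  have hdec : ∀ y, ∃ f ∈ L.map T.mkQ, ∃ g ∈ G, f + g = y := fun y =>
    Submodule.mem_sup.1 (hG.sup_eq_top ▸ Submodule.mem_top)
  have hdisj : ∀ y, y ∈ L.map T.mkQ → y ∈ G → y = 0 := fun y h1 h2 =>
    (Submodule.disjoint_def.1 hG.disjoint) y h1 h2
  have hGt : ∀ (n : ℤ) (x : N ⧸ T), n ≠ 0 → n • x ∈ G → x ∈ G := by
    intro n x hn hx
    obtain ⟨f, hf, g, hg, rfl⟩ := hdec x
    rw [smul_add] at hx
    have := hdisj _ (Submodule.smul_mem _ n hf) ((G.add_mem_iff_left (G.smul_mem n hg)).1 hx)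
    rw [htf n f hn this, zero_add]
    exact hg
  by_contra hne
  have hGbot : G ≠ ⊥ := by
    rintro rfl
    refine hne (eq_top_iff.2 fun x _ => (hFmem x).1 ?_)
    have := hG.sup_eq_top
    rw [sup_bot_eq] at this
    rw [this]; trivial
  obtain ⟨x, hx, hx0⟩ := Submodule.exists_mem_ne_zero_of_ne_bot hGbot
  obtain ⟨z, rfl⟩ := T.mkQ_surjective x
  have hzT : z ∉ T := fun h => hx0 ((hmk z).2 h)
  obtain ⟨C, hCT, hC⟩ := hN.exists_complement_torsion hp hb hzT
  have hCz : C ≤ rationalHull z := hC ▸ le_sup_left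
  have hCG : ∀ c ∈ C, T.mkQ c ∈ G := by
    intro c hc
    obtain ⟨m, hm, n, hn⟩ := hCz hc
    refine hGt m _ hm ?_
    rw [← map_smul, hn, map_smul]
    exact G.smul_mem _ hx
  have hgood : IsPureIndependent L C := by
    refine ⟨fun c hc hcL => hCT c hc ((hmk c).1 (hdisj _ ((hFmem c).2 hcL) (hCG c hc))), ?_⟩
    refine isPureSubgroup_of_torsionFree_quotient fun n y hn hy => ?_
    obtain ⟨c, hc, l, hl, hcl⟩ := Submodule.mem_sup.1 hy
    obtain ⟨f, ⟨l', hl', rfl⟩, g, hg, hfg⟩ := hdec (T.mkQ y)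
    obtain ⟨w, rfl⟩ := T.mkQ_surjective g
    have h1 : n • T.mkQ w = T.mkQ c := by
      rw [← sub_eq_zero]
      refine hdisj _ ?_ (G.sub_mem (G.smul_mem n hg) (hCG c hc))
      have : n • T.mkQ w - T.mkQ c = T.mkQ (l - n • l') := by
        have h2 := congrArg T.mkQ hcl
        rw [map_smul, ← hfg, map_add, smul_add] at h2
        rw [map_sub, map_smul, sub_eq_sub_iff_add_eq_add, add_comm (n • _), ← h2, add_comm]
      rw [this]
      exact ⟨_, L.sub_mem hl (L.smul_mem n hl'), rfl⟩
    have hw : w ∈ rationalHull z := by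
      refine mem_rationalHull_of_zsmul_mem n w hn ?_
      rw [← map_smul, ← sub_eq_zero, ← map_sub, hmk] at h1
      have := (rationalHull z).add_mem (hTz z h1) (hCz hc)
      rwa [sub_add_cancel] at this
    have h3 : y - (l' + w) ∈ T := by
      rw [← hmk, map_sub, map_add, hfg, sub_self]
    have h4 : rationalHull z ≤ C ⊔ L := hC ▸ sup_le_sup_left hTL C
    have : y = (y - (l' + w)) + l' + w := by abel
    rw [this]
    exact Submodule.add_mem _ (Submodule.mem_sup_right (L.add_mem (hTL h3) hl')) (h4 hw)
  rw [hmax C hgood, bot_sup_eq] at hC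
  exact hzT (by rw [hT, hC]; exact self_mem_rationalHull z)

/-- For a maximal pure-independent H, the image of L in N/H stays reduced because H ∩ L = 0, so it
is everything and H is a complement. -/
theorem HasFamilyExtension.exists_isCompl_of_reduced (hN : HasFamilyExtension p N) (hp : p.Prime)
    {L : Submodule ℤ N} (hL : IsPureSubgroup L)
    (hred : ∀ D ≤ L, IsDivisibleSubgroup D → D = ⊥) : ∃ C, IsCompl L C := by
  obtain ⟨H, hH, hmax⟩ := exists_isPureIndependent_quotient hL
  have hmk : ∀ x, H.mkQ x = 0 ↔ x ∈ H := fun x => Submodule.Quotient.mk_eq_zero H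
  have htop := (hN.quotient hH.isPureSubgroup).eq_top_of_maximal hp hH.map_mkQ (by
    intro D hDL hD
    have hdiv : IsDivisibleSubgroup (D.comap H.mkQ ⊓ L) := by
      rintro r hr x ⟨hxD, hxL⟩
      obtain ⟨d, hd, hdx⟩ := hD r hr _ hxD
      obtain ⟨l, hl, rfl⟩ := hDL hd
      refine ⟨l, ⟨hd, hl⟩, ?_⟩
      rw [← map_smul, ← sub_eq_zero, ← map_sub, hmk] at hdx
      exact sub_eq_zero.1 (hH.1 _ hdx (L.sub_mem (L.smul_mem _ hl) hxL))
    have hbot := hred _ inf_le_right hdiv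
    rw [eq_bot_iff]
    intro d hd
    obtain ⟨l, hl, rfl⟩ := hDL hd
    have : l ∈ D.comap H.mkQ ⊓ L := ⟨hd, hl⟩
    rw [hbot, Submodule.mem_bot] at this
    rw [this, map_zero]
    exact Submodule.zero_mem _) hmax
  refine ⟨H, ?_, ?_⟩
  · rw [Submodule.disjoint_def]
    exact fun x hxL hxH => hH.1 x hxH hxL
  · rw [codisjoint_iff_le_sup]
    intro x _
    have : H.mkQ x ∈ L.map H.mkQ := by rw [htop]; trivial
    rwa [← Submodule.mem_comap, Submodule.comap_map_mkQ, sup_comm] at this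

/-- A group with the extension property is pure-split. -/
theorem HasFamilyExtension.isPureSplit (hN : HasFamilyExtension p N) (hp : p.Prime) :
    IsPureSplit N := by
  intro L hL
  let D := divisiblePart L
  have hD : IsDivisibleSubgroup D := isDivisibleSubgroup_divisiblePart L
  have hDL : D ≤ L := divisiblePart_le L
  have hmk : ∀ x, D.mkQ x = 0 ↔ x ∈ D := fun x => Submodule.Quotient.mk_eq_zero D
  have hLmem : ∀ x, D.mkQ x ∈ L.map D.mkQ ↔ x ∈ L := by
    intro x
    rw [← Submodule.mem_comap, Submodule.comap_map_mkQ, sup_eq_right.2 hDL]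
  obtain ⟨C', hC'⟩ := (hN.quotient (isPureSubgroup_of_isDivisible hD)).exists_isCompl_of_reduced hp
    (hL.map_mkQ hDL) (by
      intro E hEL hE
      have hdiv : IsDivisibleSubgroup (E.comap D.mkQ) := by
        intro r hr x hx
        obtain ⟨e, he, hex⟩ := hE r hr _ hx
        obtain ⟨y, rfl⟩ := D.mkQ_surjective e
        rw [← map_smul, ← sub_eq_zero, ← map_sub, hmk] at hex
        obtain ⟨d, hd, hdx⟩ := hD r hr _ hex
        refine ⟨y - d, ?_, ?_⟩
        · rw [Submodule.mem_comap, map_sub, (hmk d).2 hd, sub_zero]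
          exact he
        · rw [smul_sub, hdx]; abel
      rw [eq_bot_iff]
      intro e he
      obtain ⟨x, rfl⟩ := D.mkQ_surjective e
      have hx : x ∈ D := ⟨_, fun y hy => (hLmem y).1 (hEL hy), hdiv, he⟩
      exact (hmk x).2 hx)
  obtain ⟨C₀, hC₀⟩ := hD.exists_isCompl
  -- The preimage of C' meets L in D; intersecting with a complement of D removes that overlap.
  refine ⟨C'.comap D.mkQ ⊓ C₀, ?_, ?_⟩
  · rw [Submodule.disjoint_def]
    rintro x hxL ⟨hxC, hxC₀⟩
    have := (Submodule.disjoint_def.1 hC'.disjoint) _ ((hLmem x).2 hxL) hxC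
    exact (Submodule.disjoint_def.1 hC₀.disjoint) x ((hmk x).1 this) hxC₀
  · rw [codisjoint_iff_le_sup]
    intro y _
    obtain ⟨_, ⟨l, hl, rfl⟩, c', hc', hlc⟩ :=
      Submodule.mem_sup.1 (hC'.sup_eq_top ▸ Submodule.mem_top : D.mkQ y ∈ _)
    obtain ⟨d, hd, c, hc, hdc⟩ :=
      Submodule.mem_sup.1 (hC₀.sup_eq_top ▸ Submodule.mem_top : y - l ∈ _)
    refine Submodule.mem_sup.2 ⟨l + d, L.add_mem hl (hDL hd), c, ⟨?_, hc⟩, ?_⟩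
    · change D.mkQ c ∈ C'
      have : c = y - l - d := by rw [← hdc]; abel
      rw [this, map_sub, map_sub, (hmk d).2 hd, sub_zero, ← hlc, add_sub_cancel_left]
      exact hc'
    · rw [add_assoc, hdc]; abel

end Splitting

/-! ### Invariance under isomorphism -/

section Congr

variable {M : Type u} {M' : Type w} {N : Type v} {N' : Type w}
  [AddCommGroup M] [AddCommGroup M'] [AddCommGroup N] [AddCommGroup N']

theorem IsRelInjective.congr_left (e : M ≃+ M') (h : IsRelInjective M N) :
    IsRelInjective M' N := by
  intro L f
  obtain ⟨g, hg⟩ := h L (e.symm.toIntLinearEquiv.toLinearMap.comp f)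
  refine ⟨e.toIntLinearEquiv.toLinearMap.comp g, fun x => ?_⟩
  have := congrArg e (hg x)
  simpa using this

theorem IsRelPureInjective.congr_left (e : M ≃+ M') (h : IsRelPureInjective M N) :
    IsRelPureInjective M' N := by
  intro L hL f
  obtain ⟨g, hg⟩ := h L hL (e.symm.toIntLinearEquiv.toLinearMap.comp f)
  refine ⟨e.toIntLinearEquiv.toLinearMap.comp g, fun x => ?_⟩
  have := congrArg e (hg x)
  simpa using this

theorem IsPureSubgroup.comap_equiv {e : N ≃+ N'} {L : Submodule ℤ N'} (hL : IsPureSubgroup L) :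
    IsPureSubgroup (L.comap e.toIntLinearEquiv.toLinearMap) := by
  intro n y hy
  have hy' : n • e y ∈ L := by rw [← map_zsmul]; exact hy
  obtain ⟨x, hx, hxy⟩ := hL n (e y) hy'
  refine ⟨e.symm x, ?_, e.injective ?_⟩
  · change e (e.symm x) ∈ L
    rwa [e.apply_symm_apply]
  · rw [map_zsmul, map_zsmul, e.apply_symm_apply, hxy]

theorem IsRelInjective.congr_right (e : N ≃+ N') (h : IsRelInjective M N) :
    IsRelInjective M N' := by
  intro L f
  obtain ⟨g, hg⟩ := h (L.comap e.toIntLinearEquiv.toLinearMap)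
    (f.comp (e.toIntLinearEquiv.toLinearMap.restrict fun _ hx => hx))
  refine ⟨g.comp e.symm.toIntLinearEquiv.toLinearMap, fun x => ?_⟩
  have hx : e (e.symm x) ∈ L := by rw [e.apply_symm_apply]; exact x.2
  refine (hg ⟨e.symm x, hx⟩).trans (congrArg f (Subtype.ext ?_))
  exact e.apply_symm_apply x

theorem IsRelPureInjective.congr_right (e : N ≃+ N') (h : IsRelPureInjective M N) :
    IsRelPureInjective M N' := by
  intro L hL f
  obtain ⟨g, hg⟩ := h (L.comap e.toIntLinearEquiv.toLinearMap) hL.comap_equiv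
    (f.comp (e.toIntLinearEquiv.toLinearMap.restrict fun _ hx => hx))
  refine ⟨g.comp e.symm.toIntLinearEquiv.toLinearMap, fun x => ?_⟩
  have hx : e (e.symm x) ∈ L := by rw [e.apply_symm_apply]; exact x.2
  refine (hg ⟨e.symm x, hx⟩).trans (congrArg f (Subtype.ext ?_))
  exact e.apply_symm_apply x

theorem IsPureSplit.of_equiv (e : N ≃+ N') (h : IsPureSplit N) : IsPureSplit N' := by
  intro L hL
  obtain ⟨C, hC⟩ := h (L.comap e.toIntLinearEquiv.toLinearMap) hL.comap_equiv
  refine ⟨C.map e.toIntLinearEquiv.toLinearMap, ?_, ?_⟩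
  · rw [Submodule.disjoint_def]
    rintro _ hx ⟨c, hc, rfl⟩
    have := (Submodule.disjoint_def.1 hC.disjoint) c hx hc
    rw [this, map_zero]
  · rw [codisjoint_iff_le_sup]
    intro y _
    obtain ⟨l, hl, c, hc, hlc⟩ :=
      Submodule.mem_sup.1 (hC.sup_eq_top ▸ Submodule.mem_top : e.symm y ∈ _)
    refine Submodule.mem_sup.2 ⟨e l, hl, e c, ⟨c, hc, rfl⟩, ?_⟩
    rw [← map_add, hlc, e.apply_symm_apply]

end Congr

theorem IsPoor.of_equiv {M : Type u} {M' : Type w} [AddCommGroup M] [AddCommGroup M']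
    (e : M ≃+ M') (h : IsPoor.{u, v} M) : IsPoor.{w, v} M' := by
  intro N _ inst hN
  -- The ℤ-module structure on an abelian group is unique.
  obtain rfl : AddCommGroup.toIntModule N = inst := Subsingleton.elim _ _
  exact h N (hN.congr_left e.symm)

theorem IsPiPoor.of_equiv {M : Type u} {M' : Type w} [AddCommGroup M] [AddCommGroup M']
    (e : M ≃+ M') (h : IsPiPoor.{u, v} M) : IsPiPoor.{w, v} M' := by
  intro N _ inst hN
  obtain rfl : AddCommGroup.toIntModule N = inst := Subsingleton.elim _ _
  exact h N (hN.congr_left e.symm)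

/-! ### The group `⨁ ℤ_q` -/

/-- An element of prime order spans a simple group; Bézout decomposes across coprime factors. -/
theorem mem_sSup_simples_of_squarefree {N : Type v} [AddCommGroup N] (n : ℕ) (hn : Squarefree n)
    (x : N) (hx : (n : ℤ) • x = 0) :
    x ∈ sSup {S : Submodule ℤ N | IsSimpleModule ℤ S} := by
  induction n using Nat.recOnMul generalizing x with
  | zero => exact absurd hn not_squarefree_zero
  | one =>
    have : x = 0 := by simpa using hx
    rw [this]; exact Submodule.zero_mem _
  | prime q hq =>
    rcases eq_or_ne x 0 with rfl | hx0
    · exact Submodule.zero_mem _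
    have hsimple : IsSimpleModule ℤ (Submodule.span ℤ {x}) := by
      rw [isSimpleModule_iff_isAtom]
      refine ⟨by simpa using hx0, fun S hS => ?_⟩
      by_contra hbot
      obtain ⟨s, hs, hs0⟩ := Submodule.exists_mem_ne_zero_of_ne_bot hbot
      obtain ⟨c, rfl⟩ := Submodule.mem_span_singleton.1 (hS.le hs)
      have hqc : ¬ (q : ℤ) ∣ c := by
        rintro ⟨d, rfl⟩
        exact hs0 (by rw [mul_comm, mul_smul, hx, smul_zero])
      obtain ⟨α, β, hαβ⟩ := (Nat.prime_iff_prime_int.1 hq).coprime_iff_not_dvd.2 hqc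
      refine hS.not_ge ?_
      rw [Submodule.span_singleton_le_iff_mem, ← one_smul ℤ x, ← hαβ, add_smul, mul_smul, hx,
        smul_zero, zero_add, mul_smul]
      exact S.smul_mem _ hs
    exact le_sSup (show Submodule.span ℤ {x} ∈ {S : Submodule ℤ N | IsSimpleModule ℤ S} from hsimple)
      (Submodule.mem_span_singleton_self x)
  | mul a b iha ihb =>
    have hab : Nat.Coprime a b := Nat.coprime_of_squarefree_mul hn
    obtain ⟨α, β, hαβ⟩ := Nat.isCoprime_iff_coprime.2 hab
    push_cast at hx
    rw [← one_smul ℤ x, ← hαβ, add_smul, mul_smul, mul_smul]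
    refine Submodule.add_mem _ (Submodule.smul_mem _ _ ?_) (Submodule.smul_mem _ _ ?_)
    · exact ihb hn.of_mul_right _ (by rw [smul_smul, mul_comm]; exact hx)
    · exact iha hn.of_mul_left _ (by rw [smul_smul]; exact hx)

/-- If qx ∉ ℤq²x, some map from the span of qx to ℤ/q is nonzero at qx, but an extension to N would
kill qx. So every element has squarefree order. -/
theorem isPoor_directSum_zmod_prime : IsPoor.{0, v} (⨁ p : Nat.Primes, ZMod (p : ℕ)) := by
  classical
  intro N _ inst hN
  obtain rfl : AddCommGroup.toIntModule N = inst := Subsingleton.elim _ _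
  have key : ∀ (q : ℕ), q.Prime → ∀ x : N, ∃ c : ℤ, (q : ℤ) • x = (c * q * q) • x := by
    intro q hq x
    by_contra hcon
    push Not at hcon
    let L := Submodule.span ℤ {(q : ℤ) • x}
    obtain ⟨f, hf⟩ := exists_zmod_ne_zero hq.ne_zero
      (⟨(q : ℤ) • x, Submodule.mem_span_singleton_self _⟩ : L) (by
        rintro ⟨y, hy⟩ h
        obtain ⟨c, rfl⟩ := Submodule.mem_span_singleton.1 hy
        refine hcon c ?_
        have : (q : ℤ) • c • (q : ℤ) • x = (q : ℤ) • x := congrArg Subtype.val h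
        rw [← this]; module)
    obtain ⟨g, hg⟩ := hN L ((DirectSum.lof ℤ Nat.Primes (fun p => ZMod (p : ℕ)) ⟨q, hq⟩).comp f)
    apply hf
    have h1 := hg ⟨(q : ℤ) • x, Submodule.mem_span_singleton_self _⟩
    have h2 := congrArg (fun m => DirectSum.component ℤ Nat.Primes (fun p => ZMod (p : ℕ)) ⟨q, hq⟩ m) h1
    have h3 := (DirectSum.component.lof_self ℤ (M := fun p : Nat.Primes => ZMod (p : ℕ))
      (⟨q, hq⟩ : Nat.Primes) (f ⟨(q : ℤ) • x, Submodule.mem_span_singleton_self _⟩)).symm.trans h2.symm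
    refine h3.trans ?_
    simp only [map_smul]
    exact zsmul_zmod_self q _
  have hsq : ∀ x : N, ∃ n : ℕ, Squarefree n ∧ (n : ℤ) • x = 0 := by
    intro x
    -- Infinite order is recorded as 0, which is divisible by q², so it is excluded as well.
    refine ⟨addOrderOf x, ?_, by simp [natCast_zsmul]⟩
    rw [Nat.squarefree_iff_prime_squarefree]
    intro q hq hdvd
    obtain ⟨c, hc⟩ := key q hq x
    have h1 : ((q : ℤ) - c * q * q) • x = 0 := by rw [sub_smul, hc, sub_self]
    have h2 := (Int.natCast_dvd_natCast.2 hdvd).trans (addOrderOf_dvd_iff_zsmul_eq_zero.2 h1)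
    push_cast at h2
    rw [show (q : ℤ) - c * q * q = q * (1 - c * q) by ring] at h2
    have h3 := Int.dvd_of_mul_dvd_mul_left (by exact_mod_cast hq.ne_zero) h2
    have h4 : (q : ℤ) ∣ 1 := by
      have := dvd_add h3 (Dvd.intro_left c rfl : (q : ℤ) ∣ c * q)
      simpa using this
    exact hq.one_lt.ne' (by exact_mod_cast Int.eq_one_of_dvd_one (by positivity) h4)
  refine IsSemisimpleModule.of_sSup_simples_eq_top (eq_top_iff.2 fun x _ => ?_)
  obtain ⟨n, hn, hx⟩ := hsq x
  exact mem_sSup_simples_of_squarefree n hn x hx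

/-- For odd q the product is q-divisible, so by purity L is too and the q-component of f vanishes.
The 2-component kills L ∩ 2N = 2L, hence extends. -/
theorem isRelPureInjective_pi_zmod_two_pow :
    IsRelPureInjective (⨁ p : Nat.Primes, ZMod (p : ℕ)) (∀ k : ℕ, ZMod (2 ^ k)) := by
  classical
  intro L hL f
  let G := fun p : Nat.Primes => ZMod (p : ℕ)
  let t : Nat.Primes := ⟨2, Nat.prime_two⟩
  have hzero : ∀ (q : Nat.Primes) (x : L) (y : ∀ k : ℕ, ZMod (2 ^ k)), (q : ℤ) • y = x →
      DirectSum.component ℤ Nat.Primes G q (f x) = 0 := by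
    intro q x y hy
    obtain ⟨z, hz, hzy⟩ := hL q y (by rw [hy]; exact x.2)
    have : x = (q : ℤ) • (⟨z, hz⟩ : L) := Subtype.ext (by rw [← hy, ← hzy]; rfl)
    rw [this, map_smul, map_smul]
    exact zsmul_zmod_self q _
  obtain ⟨g, hg⟩ := exists_factor_zmod (n := 2) two_ne_zero L.subtype
    ((DirectSum.component ℤ Nat.Primes G t).comp f) (fun x y hy => hzero t x y hy)
  refine ⟨(DirectSum.lof ℤ Nat.Primes G t).comp g, fun x => ?_⟩
  refine DirectSum.ext_component ℤ fun q => ?_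
  by_cases hq : q = t
  · subst hq
    rw [LinearMap.comp_apply, DirectSum.component.lof_self]
    exact hg x
  · have h2q : IsCoprime (q : ℤ) (2 : ℤ) := by
      have : Nat.Coprime q 2 := (Nat.coprime_primes q.2 Nat.prime_two).2 fun h => hq (Subtype.ext h)
      exact_mod_cast Nat.isCoprime_iff_coprime.2 this
    have hdiv : ∀ k : ℕ, ∃ y : ZMod (2 ^ k), (q : ℤ) • y = (x : ∀ k : ℕ, ZMod (2 ^ k)) k := by
      intro k
      obtain ⟨α, β, hαβ⟩ : IsCoprime (q : ℤ) ((2 : ℤ) ^ k) := h2q.pow_right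
      refine ⟨α • (x : ∀ k : ℕ, ZMod (2 ^ k)) k, ?_⟩
      have h0 : ((2 : ℤ) ^ k) • (x : ∀ k : ℕ, ZMod (2 ^ k)) k = 0 := by
        have := zsmul_zmod_self (2 ^ k) ((x : ∀ k : ℕ, ZMod (2 ^ k)) k)
        push_cast at this; exact this
      rw [smul_smul, mul_comm, eq_sub_of_add_eq hαβ, sub_smul, mul_smul, h0, smul_zero, one_smul,
        sub_zero]
    choose y hy using hdiv
    rw [hzero q x y (funext hy), LinearMap.comp_apply, DirectSum.component.of, dif_neg (Ne.symm hq)]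

theorem not_isPureSplit_pi_zmod_two_pow : ¬ IsPureSplit (∀ k : ℕ, ZMod (2 ^ k)) := by
  intro h
  obtain ⟨C, hC⟩ := h _ (isPureSubgroup_rationalHull 0)
  set T := rationalHull (0 : ∀ k : ℕ, ZMod (2 ^ k))
  have hkill : ∀ (k : ℕ) (a : ZMod (2 ^ k)) (j : ℕ), k ≤ j → ((2 : ℤ) ^ j) • a = 0 := by
    intro k a j hkj
    have := zsmul_zmod_self (2 ^ k) a
    push_cast at this
    rw [← Nat.sub_add_cancel hkj, pow_add, mul_smul, this, smul_zero]
  -- Since k/2 is unbounded, x is divisible by every power of 2 modulo torsion, so its component in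
  -- C is too and vanishes. Since k - k/2 is also unbounded, x is not torsion.
  let x : ∀ k : ℕ, ZMod (2 ^ k) := fun k => 2 ^ (k / 2)
  have hdec : ∀ y, ∃ t ∈ T, ∃ c ∈ C, t + c = y := fun y =>
    Submodule.mem_sup.1 (hC.sup_eq_top ▸ Submodule.mem_top)
  obtain ⟨t, ht, c, hc, htc⟩ := hdec x
  have hc0 : c = 0 := by
    funext k
    let y : ∀ k : ℕ, ZMod (2 ^ k) := fun i => if k ≤ i / 2 then 2 ^ (i / 2 - k) else 0
    obtain ⟨t', ht', c', hc', htc'⟩ := hdec y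
    have hxy : x - (2 : ℤ) ^ k • y ∈ T := by
      refine mem_rationalHull_zero.2 ⟨2 ^ (2 * k), by positivity, ?_⟩
      funext i
      by_cases hi : k ≤ i / 2
      · have : (x - (2 : ℤ) ^ k • y) i = 0 := by
          have hy : y i = 2 ^ (i / 2 - k) := if_pos hi
          rw [Pi.sub_apply, Pi.smul_apply, hy, zsmul_eq_mul]
          push_cast
          rw [← pow_add, Nat.add_sub_cancel' hi, sub_self]
        rw [Pi.smul_apply, this, smul_zero]; rfl
      · exact hkill i _ _ (by omega)
    have hcc : c - (2 : ℤ) ^ k • c' = 0 := by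
      refine (Submodule.disjoint_def.1 hC.disjoint) _ ?_ (C.sub_mem hc (C.smul_mem _ hc'))
      have : c - (2 : ℤ) ^ k • c' = (x - (2 : ℤ) ^ k • y) - (t - (2 : ℤ) ^ k • t') := by
        rw [← htc, ← htc', smul_add]; abel
      rw [this]
      exact T.sub_mem hxy (T.sub_mem ht (T.smul_mem _ ht'))
    rw [sub_eq_zero.1 hcc, Pi.smul_apply]
    exact hkill k _ k le_rfl
  rw [hc0, add_zero] at htc
  rw [htc] at ht
  obtain ⟨m, hm, hmx⟩ := mem_rationalHull_zero.1 ht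
  have h1 := congrFun hmx (2 * m.natAbs)
  have h2 : ((m * 2 ^ m.natAbs : ℤ) : ZMod (2 ^ (2 * m.natAbs))) = 0 := by
    refine Eq.trans ?_ h1
    rw [Pi.smul_apply, zsmul_eq_mul]
    push_cast
    have : 2 * m.natAbs / 2 = m.natAbs := by omega
    simp only [x, this]
  rw [ZMod.intCast_zmod_eq_zero_iff_dvd] at h2
  push_cast at h2
  rw [two_mul, pow_add] at h2
  have h3 := Int.dvd_of_mul_dvd_mul_right (by positivity) h2
  have h4 : 2 ^ m.natAbs ∣ m.natAbs := by
    have := Int.natAbs_dvd_natAbs.2 h3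
    simpa [Int.natAbs_pow] using this
  have h5 := Nat.le_of_dvd (Int.natAbs_pos.2 hm) h4
  exact absurd (Nat.lt_two_pow_self (n := m.natAbs)) (by omega)

theorem not_isPiPoor_directSum_zmod_prime :
    ¬ IsPiPoor.{0, v} (⨁ p : Nat.Primes, ZMod (p : ℕ)) := by
  intro h
  let e : (∀ k : ℕ, ZMod (2 ^ k)) ≃+ ULift.{v} (∀ k : ℕ, ZMod (2 ^ k)) := AddEquiv.ulift.symm
  exact not_isPureSplit_pi_zmod_two_pow
    ((h _ (isRelPureInjective_pi_zmod_two_pow.congr_right e)).of_equiv e.symm)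

/-! ### The complements of `primeSummands` -/

/-- In a uniform group other than `ℤ/pℤ`, elements of order `p` are divisible by `p`. -/
theorem exists_zsmul_eq_of_uniform {U : Type u} [AddCommGroup U] (hU : IsUniformAbGroup U)
    {p : ℕ} (hp : p.Prime) (hne : ¬ Nonempty (U ≃+ ZMod p)) (x : U) (hx : (p : ℤ) • x = 0) :
    ∃ y, (p : ℤ) • y = x := by
  rcases eq_or_ne x 0 with rfl | hx0
  · exact ⟨0, smul_zero _⟩
  by_contra hcon
  push Not at hcon
  refine hne ?_
  rw [isUniformAbGroup_iff] at hU
  have hp' := Nat.prime_iff_prime_int.1 hp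
  -- By uniformity x is a multiple of every nonzero a. As x is not divisible by p, the multiplier is
  -- prime to p and p a = 0; so a lies in the span of x, and U has order p.
  have hmem : ∀ a : U, a ≠ 0 → ∃ m : ℤ, m • a = x := by
    intro a ha
    obtain ⟨b, m, hbm, hb⟩ := hU.2 x a hx0 ha
    have hpb : ¬ (p : ℤ) ∣ b := by
      rintro ⟨d, rfl⟩
      exact hb (by rw [mul_comm, mul_smul, hx, smul_zero])
    obtain ⟨α, β, hαβ⟩ := hp'.coprime_iff_not_dvd.2 hpb
    refine ⟨β * m, ?_⟩
    rw [mul_smul, ← hbm, smul_smul]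
    nth_rewrite 2 [← one_smul ℤ x]
    rw [← hαβ, add_smul, mul_smul α, hx, smul_zero, zero_add]
  have hgen : ∀ a : U, a ∈ AddSubgroup.zmultiples x := by
    intro a
    rcases eq_or_ne a 0 with rfl | ha
    · exact zero_mem _
    obtain ⟨m, hm⟩ := hmem a ha
    have hpm : ¬ (p : ℤ) ∣ m := by
      rintro ⟨d, rfl⟩
      exact hcon (d • a) (by rw [smul_smul, hm])
    have hpa : (p : ℤ) • a = 0 := by
      by_contra hpa
      obtain ⟨k, hk⟩ := hmem _ hpa
      exact hcon (k • a) (by rw [smul_comm, hk])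
    obtain ⟨α, β, hαβ⟩ := hp'.coprime_iff_not_dvd.2 hpm
    refine ⟨β, ?_⟩
    change β • x = a
    rw [← hm, smul_smul]
    nth_rewrite 2 [← one_smul ℤ a]
    rw [← hαβ, add_smul, mul_smul α, hpa, smul_zero, zero_add]
  have hord : addOrderOf x = p := by
    have : Fact p.Prime := ⟨hp⟩
    exact addOrderOf_eq_prime (by rw [← natCast_zsmul]; exact hx) hx0
  have hcard : Nat.card U = p := by
    rw [← hord, addOrderOf_eq_card_of_forall_mem_zmultiples hgen]
  have hcyc : IsAddCyclic U := ⟨x, hgen⟩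
  exact ⟨(hcard ▸ zmodAddCyclicAddEquiv hcyc : ZMod p ≃+ U).symm⟩

/-! ### Coordinates on the sum of all copies -/

section Copies

variable {Γ : Type w} {A : Γ → Type u} [∀ γ, AddCommGroup (A γ)]

open scoped Classical in
/-- The inclusion of the `n`-th copy of `A γ`. -/
noncomputable def copyInclusion (A : Γ → Type u) [∀ γ, AddCommGroup (A γ)] (γ : Γ) (n : ℕ) :
    A γ →ₗ[ℤ] CountableCopiesSum A :=
  (DirectSum.lof ℤ Γ (fun γ => ⨁ _n : ℕ, A γ) γ).comp (DirectSum.lof ℤ ℕ (fun _ => A γ) n)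

/-- The projection onto the `n`-th copy of `A γ`. -/
noncomputable def copyProjection (A : Γ → Type u) [∀ γ, AddCommGroup (A γ)] (γ : Γ) (n : ℕ) :
    CountableCopiesSum A →ₗ[ℤ] A γ :=
  (DirectSum.component ℤ ℕ (fun _ => A γ) n).comp
    (DirectSum.component ℤ Γ (fun γ => ⨁ _n : ℕ, A γ) γ)

theorem copyProjection_copyInclusion_self (γ : Γ) (n : ℕ) (a : A γ) :
    copyProjection A γ n (copyInclusion A γ n a) = a := by
  classical
  simp only [copyProjection, copyInclusion, LinearMap.comp_apply]
  erw [DirectSum.component.lof_self, DirectSum.component.lof_self]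

theorem copyProjection_copyInclusion_of_ne {γ δ : Γ} {n m : ℕ} (h : γ ≠ δ ∨ n ≠ m) (a : A γ) :
    copyProjection A δ m (copyInclusion A γ n a) = 0 := by
  classical
  by_cases hγ : γ = δ
  · subst hγ
    have hn := h.resolve_left (fun h => h rfl)
    simp only [copyProjection, copyInclusion, LinearMap.comp_apply]
    erw [DirectSum.component.lof_self, DirectSum.component.of, dif_neg hn]
  · simp only [copyProjection, copyInclusion, LinearMap.comp_apply]
    erw [DirectSum.component.of, dif_neg hγ]
    exact map_zero _

theorem ext_copyProjection {x y : CountableCopiesSum A}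
    (h : ∀ γ n, copyProjection A γ n x = copyProjection A γ n y) : x = y :=
  DirectSum.ext_component ℤ fun γ => DirectSum.ext_component ℤ fun n => h γ n

theorem induction_copies {P : CountableCopiesSum A → Prop} (h0 : P 0)
    (hadd : ∀ x y, P x → P y → P (x + y)) (hi : ∀ γ n a, P (copyInclusion A γ n a))
    (x : CountableCopiesSum A) : P x := by
  classical
  induction x using DirectSum.induction_on with
  | zero => exact h0
  | of γ y =>
    induction y using DirectSum.induction_on with
    | zero => rwa [map_zero]
    | of n a => 
      have := hi γ n a
      simp only [copyInclusion, LinearMap.comp_apply, DirectSum.lof_eq_of] at this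
      convert this
    | add a b ha hb => rw [map_add]; exact hadd _ _ ha hb
  | add a b ha hb => exact hadd _ _ ha hb

theorem finite_copyProjection_ne_zero (x : CountableCopiesSum A) :
    {i : Γ × ℕ | copyProjection A i.1 i.2 x ≠ 0}.Finite := by
  induction x using induction_copies with
  | h0 => simp
  | hadd x y hx hy =>
    refine (hx.union hy).subset fun i hi => ?_
    by_contra hcon
    rw [Set.mem_union, not_or] at hcon
    have h1 := not_not.1 hcon.1
    have h2 := not_not.1 hcon.2
    exact hi (by rw [map_add, h1, h2, add_zero])
  | hi γ n a =>
    refine (Set.finite_singleton (γ, n)).subset fun i hi => ?_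
    by_contra hcon
    refine hi (copyProjection_copyInclusion_of_ne ?_ a)
    by_contra h
    push Not at h
    exact hcon (Prod.ext h.1.symm h.2.symm)

/-- The n-th map uses the n-th copy of `A (γ n)`, so repetitions among the γ n cause no collisions.
-/
theorem exists_linearMap_of_finite_support {W : Type v} [AddCommGroup W] {U : ℕ → Type}
    [∀ n, AddCommGroup (U n)] (f : ∀ n, W →ₗ[ℤ] U n) (hf : ∀ x, {n | f n x ≠ 0}.Finite)
    (γ : ℕ → Γ) (e : ∀ n, U n →ₗ[ℤ] A (γ n)) :
    ∃ F : W →ₗ[ℤ] CountableCopiesSum A, ∀ x n, copyProjection A (γ n) n (F x) = e n (f n x) := by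
  classical
  let s : W → Finset ℕ := fun x => (hf x).toFinset
  have hs : ∀ x n, n ∉ s x → f n x = 0 := fun x n hn => by
    by_contra h
    exact hn ((hf x).mem_toFinset.2 h)
  let F₀ : W → CountableCopiesSum A := fun x =>
    ∑ n ∈ s x, copyInclusion A (γ n) n (e n (f n x))
  have hF₀ : ∀ x (t : Finset ℕ), s x ⊆ t →
      F₀ x = ∑ n ∈ t, copyInclusion A (γ n) n (e n (f n x)) := by
    intro x t ht
    refine Finset.sum_subset ht fun n _ hn => ?_
    rw [hs x n hn, map_zero, map_zero]
  have hadd : ∀ x y, F₀ (x + y) = F₀ x + F₀ y := by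
    intro x y
    let t := s x ∪ s y ∪ s (x + y)
    rw [hF₀ x t (fun a ha => by simp [t, ha]), hF₀ y t (fun a ha => by simp [t, ha]),
      hF₀ (x + y) t (fun a ha => by simp [t, ha]), ← Finset.sum_add_distrib]
    simp only [map_add]
  refine ⟨(AddMonoidHom.mk' F₀ hadd).toIntLinearMap, fun x n => ?_⟩
  change copyProjection A (γ n) n (F₀ x) = _
  rw [hF₀ x (insert n (s x)) (Finset.subset_insert _ _), map_sum,
    Finset.sum_eq_single n (fun m _ hm => copyProjection_copyInclusion_of_ne (Or.inr hm) _)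
    (fun h => absurd (Finset.mem_insert_self _ _) h), copyProjection_copyInclusion_self]

theorem nonempty_copySummand_equiv_iff (γ : Γ) (n p : ℕ) :
    Nonempty (copySummand A γ n ≃+ ZMod p) ↔ Nonempty (A γ ≃+ ZMod p) := by
  have hinj : Function.Injective (copyInclusion A γ n) :=
    Function.LeftInverse.injective (g := copyProjection A γ n)
      (copyProjection_copyInclusion_self γ n)
  have e : A γ ≃+ copySummand A γ n := (LinearEquiv.ofInjective _ hinj).toAddEquiv
  exact ⟨fun ⟨f⟩ => ⟨e.trans f⟩, fun ⟨f⟩ => ⟨e.symm.trans f⟩⟩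

theorem mem_primeSummands_iff {p : ℕ} {x : CountableCopiesSum A} :
    x ∈ primeSummands A p ↔
      ∀ γ, ¬ Nonempty (A γ ≃+ ZMod p) → ∀ n, copyProjection A γ n x = 0 := by
  classical
  constructor
  · intro hx γ hγ n
    have hle : primeSummands A p ≤ LinearMap.ker (copyProjection A γ n) := by
      refine iSup_le fun δ => iSup_le fun m => iSup_le fun h => ?_
      rintro _ ⟨a, rfl⟩
      rw [nonempty_copySummand_equiv_iff] at h
      exact copyProjection_copyInclusion_of_ne (Or.inl (by rintro rfl; exact hγ h)) a
    exact hle hx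
  · intro hx
    obtain ⟨s, hs⟩ : ∃ s : Finset (Γ × ℕ), ∀ i ∉ s, copyProjection A i.1 i.2 x = 0 :=
      ⟨(finite_copyProjection_ne_zero x).toFinset, fun i hi => by
        by_contra h
        exact hi ((finite_copyProjection_ne_zero x).mem_toFinset.2 h)⟩
    have hsum : x = ∑ i ∈ s, copyInclusion A i.1 i.2 (copyProjection A i.1 i.2 x) := by
      refine ext_copyProjection fun γ n => ?_
      rw [map_sum]
      by_cases hi : (γ, n) ∈ s
      · rw [Finset.sum_eq_single (γ, n) (fun j _ hj => ?_) (fun h => absurd hi h),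
          copyProjection_copyInclusion_self]
        refine copyProjection_copyInclusion_of_ne ?_ _
        by_contra h
        push Not at h
        exact hj (Prod.ext h.1 h.2)
      · rw [hs _ hi]
        refine (Finset.sum_eq_zero fun j hj => copyProjection_copyInclusion_of_ne ?_ _).symm
        by_contra h
        push Not at h
        exact hi (by rw [← h.1, ← h.2]; exact hj)
    rw [hsum]
    refine Submodule.sum_mem _ fun i _ => ?_
    by_cases hi : Nonempty (A i.1 ≃+ ZMod p)
    · refine Submodule.mem_iSup_of_mem i.1 (Submodule.mem_iSup_of_mem i.2
        (Submodule.mem_iSup_of_mem ((nonempty_copySummand_equiv_iff i.1 i.2 p).2 hi) ⟨_, rfl⟩))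
    · rw [hx i.1 hi, map_zero]
      exact Submodule.zero_mem _

theorem exists_isCompl_primeSummands (A : Γ → Type u) [∀ γ, AddCommGroup (A γ)] (p : ℕ) :
    ∃ K : Submodule ℤ (CountableCopiesSum A), IsCompl (primeSummands A p) K := by
  classical
  let K : Submodule ℤ (CountableCopiesSum A) :=
    ⨅ (γ : Γ) (_ : Nonempty (A γ ≃+ ZMod p)) (n : ℕ), LinearMap.ker (copyProjection A γ n)
  have hK : ∀ x, x ∈ K ↔ ∀ γ, Nonempty (A γ ≃+ ZMod p) → ∀ n, copyProjection A γ n x = 0 := by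
    intro x
    simp only [K, Submodule.mem_iInf, LinearMap.mem_ker]
  refine ⟨K, ?_, ?_⟩
  · rw [Submodule.disjoint_def]
    intro x hx hxK
    refine ext_copyProjection fun γ n => ?_
    rw [map_zero]
    by_cases h : Nonempty (A γ ≃+ ZMod p)
    · exact (hK x).1 hxK γ h n
    · exact mem_primeSummands_iff.1 hx γ h n
  · rw [codisjoint_iff_le_sup]
    intro x _
    induction x using induction_copies with
    | h0 => exact Submodule.zero_mem _
    | hadd x y hx hy => exact Submodule.add_mem _ (hx trivial) (hy trivial)
    | hi γ n a =>
      by_cases h : Nonempty (A γ ≃+ ZMod p)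
      · refine Submodule.mem_sup_left (mem_primeSummands_iff.2 fun δ hδ m => ?_)
        exact copyProjection_copyInclusion_of_ne (Or.inl (by rintro rfl; exact hδ h)) a
      · refine Submodule.mem_sup_right ((hK _).2 fun δ hδ m => ?_)
        exact copyProjection_copyInclusion_of_ne (Or.inl (by rintro rfl; exact h hδ)) a

theorem exists_retraction_complement {p : ℕ} {K : Submodule ℤ (CountableCopiesSum A)}
    (hK : IsCompl (primeSummands A p) K) :
    ∃ π : CountableCopiesSum A →ₗ[ℤ] K, (∀ x : K, π x = x) ∧
      (∀ x ∈ primeSummands A p, π x = 0) ∧ ∀ x, x - π x ∈ primeSummands A p := by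
  have h1 : ∀ x : K, Submodule.projectionOnto _ _ hK.symm x = x :=
    Submodule.projectionOnto_apply_left hK.symm
  have h2 : ∀ x ∈ primeSummands A p, Submodule.projectionOnto _ _ hK.symm x = 0 := fun x hx =>
    (Submodule.projectionOnto_apply_eq_zero_iff hK.symm).2 hx
  refine ⟨Submodule.projectionOnto _ _ hK.symm, h1, h2, fun x => ?_⟩
  refine (Submodule.projectionOnto_apply_eq_zero_iff hK.symm).1 ?_
  rw [map_sub, h1, sub_self]

/-- Assemble the family into one map to M and project to K. This changes it only by elements of V,
invisible to coordinates outside ℤ/pℤ; the coordinates of an extension are pointwise finite because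
M is a direct sum. -/
theorem IsRelPureInjective.hasFamilyExtension {p : ℕ} (hA : IsUniformRepresentatives A)
    {K : Submodule ℤ (CountableCopiesSum A)} (hK : IsCompl (primeSummands A p) K)
    {N : Type v} [AddCommGroup N] (h : IsRelPureInjective K N) : HasFamilyExtension p N := by
  intro W hW U _ hU f hf
  have hrep : ∀ n, ∃ γ, Nonempty (U n ≃+ A γ) := by
    intro n
    obtain ⟨γ, ⟨e⟩⟩ := hA.exists_equiv (ULift.{u} (U n)) ((hU n).1.of_equiv AddEquiv.ulift.symm)
    exact ⟨γ, ⟨AddEquiv.ulift.symm.trans e⟩⟩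
  choose γ e using hrep
  have hγ : ∀ n, ¬ Nonempty (A (γ n) ≃+ ZMod p) := fun n ⟨i⟩ => (hU n).2 ⟨(e n).some.trans i⟩
  let e' : ∀ n, U n ≃ₗ[ℤ] A (γ n) := fun n => (e n).some.toIntLinearEquiv
  obtain ⟨F, hF⟩ := exists_linearMap_of_finite_support f hf γ (fun n => (e' n).toLinearMap)
  obtain ⟨π, -, -, hπ⟩ := exists_retraction_complement hK
  obtain ⟨g, hg⟩ := h W hW (π.comp F)
  refine ⟨fun n => (e' n).symm.toLinearMap.comp
    ((copyProjection A (γ n) n).comp (K.subtype.comp g)), fun n x => ?_, fun x => ?_⟩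
  · have h1 : copyProjection A (γ n) n (g x) = e' n (f n x) := by
      have h2 := mem_primeSummands_iff.1 (hπ (F x)) (γ n) (hγ n) n
      rw [map_sub, hF, sub_eq_zero] at h2
      rw [hg]
      exact h2.symm
    change (e' n).symm (copyProjection A (γ n) n (g x)) = _
    rw [h1, LinearEquiv.symm_apply_apply]
  · refine Set.Finite.subset (Set.Finite.preimage (f := fun n => (γ n, n))
      (fun a _ b _ hab => (Prod.ext_iff.1 hab).2) (finite_copyProjection_ne_zero (g x : CountableCopiesSum A)))
      fun n hn h0 => hn ?_
    change (e' n).symm (copyProjection A (γ n) n (g x)) = 0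
    have h0' : copyProjection A (γ n) n (g x) = 0 := h0
    rw [h0', map_zero]

theorem isPiPoor_complement {p : ℕ} (hp : p.Prime) (hA : IsUniformRepresentatives A)
    {K : Submodule ℤ (CountableCopiesSum A)} (hK : IsCompl (primeSummands A p) K) :
    IsPiPoor.{max w u, v} K := by
  intro N _ inst hN
  obtain rfl : AddCommGroup.toIntModule N = inst := Subsingleton.elim _ _
  exact (hN.hasFamilyExtension hA hK).isPureSplit hp

/-- Divide each coordinate outside V by p; the resulting z has x - p z ∈ V, and its projection to K
is the quotient. -/
theorem exists_zsmul_eq_complement {p : ℕ} (hp : p.Prime) (hA : IsUniformRepresentatives A)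
    {K : Submodule ℤ (CountableCopiesSum A)} (hK : IsCompl (primeSummands A p) K) (x : K)
    (hx : (p : ℤ) • x = 0) : ∃ y : K, (p : ℤ) • y = x := by
  classical
  obtain ⟨π, hπ, hπ0, -⟩ := exists_retraction_complement hK
  have hcomp : ∀ γ n, (p : ℤ) • copyProjection A γ n x = 0 := by
    intro γ n
    rw [← map_smul]
    have : (p : ℤ) • (x : CountableCopiesSum A) = 0 := congrArg Subtype.val hx
    rw [this, map_zero]
  have hch : ∀ i : Γ × ℕ, ∃ y : A i.1, ¬ Nonempty (A i.1 ≃+ ZMod p) →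
      (p : ℤ) • y = copyProjection A i.1 i.2 x := by
    intro i
    by_cases h : Nonempty (A i.1 ≃+ ZMod p)
    · exact ⟨0, fun h' => absurd h h'⟩
    · obtain ⟨y, hy⟩ := exists_zsmul_eq_of_uniform (hA.uniform i.1) hp h _ (hcomp i.1 i.2)
      exact ⟨y, fun _ => hy⟩
  choose y hy using hch
  let s := (finite_copyProjection_ne_zero (x : CountableCopiesSum A)).toFinset
  let z : CountableCopiesSum A := ∑ i ∈ s, copyInclusion A i.1 i.2 (y i)
  have hz : (x : CountableCopiesSum A) - (p : ℤ) • z ∈ primeSummands A p := by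
    refine mem_primeSummands_iff.2 fun γ hγ n => ?_
    rw [map_sub, map_smul, map_sum, sub_eq_zero]
    by_cases hi : (γ, n) ∈ s
    · rw [Finset.sum_eq_single (γ, n) (fun j _ hj => ?_) (fun h => absurd hi h),
        copyProjection_copyInclusion_self, hy _ hγ]
      refine copyProjection_copyInclusion_of_ne ?_ _
      by_contra h
      push Not at h
      exact hj (Prod.ext h.1 h.2)
    · have h0 : copyProjection A γ n x = 0 := by
        by_contra h
        exact hi ((finite_copyProjection_ne_zero _).mem_toFinset.2 h)
      have hsum : ∑ j ∈ s, copyProjection A γ n (copyInclusion A j.1 j.2 (y j)) = 0 := by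
        refine Finset.sum_eq_zero fun j hj => copyProjection_copyInclusion_of_ne ?_ _
        by_contra h
        push Not at h
        obtain ⟨j₁, j₂⟩ := j
        obtain ⟨rfl, rfl⟩ := h
        exact hi hj
      rw [h0, hsum, smul_zero]
  refine ⟨π z, ?_⟩
  have := hπ0 _ hz
  rw [map_sub, hπ, map_smul, sub_eq_zero] at this
  exact this.symm

end Copies

/-! ### Failure of poorness at ℤ/p² -/

/-- If the elements of order `p` of `M` are divisible by `p`, then `M` is `ℤ/p²ℤ`-injective. -/
theorem isRelInjective_zmod_prime_sq {M : Type u} [AddCommGroup M] {p : ℕ} (hp : p.Prime)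
    (hM : ∀ x : M, (p : ℤ) • x = 0 → ∃ y, (p : ℤ) • y = x) :
    IsRelInjective M (ZMod (p ^ 2)) := by
  intro L f
  have hp' := Nat.prime_iff_prime_int.1 hp
  have hpp : ((p : ℤ) ^ 2) • (1 : ZMod (p ^ 2)) = 0 := by
    have := zsmul_zmod_self (p ^ 2) 1
    push_cast at this; exact this
  by_cases h1 : (1 : ZMod (p ^ 2)) ∈ L
  · have htop : ∀ x : ZMod (p ^ 2), x ∈ L := by
      intro x
      obtain ⟨c, rfl⟩ := ZMod.intCast_surjective x
      have := L.smul_mem c h1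
      rwa [zsmul_eq_mul, mul_one] at this
    exact ⟨f.comp (LinearMap.id.codRestrict L htop), fun x => rfl⟩
  have hL : ∀ x ∈ L, ∃ c : ℤ, x = c • (p : ℤ) • (1 : ZMod (p ^ 2)) := by
    intro x hx
    obtain ⟨c, rfl⟩ := ZMod.intCast_surjective x
    by_cases hpc : (p : ℤ) ∣ c
    · obtain ⟨d, rfl⟩ := hpc
      exact ⟨d, by simp [mul_comm]⟩
    · exfalso
      obtain ⟨α, β, hαβ⟩ := IsCoprime.pow_left (m := 2) (hp'.coprime_iff_not_dvd.2 hpc)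
      apply h1
      have : (1 : ZMod (p ^ 2)) = β • (c : ZMod (p ^ 2)) := by
        rw [← one_smul ℤ (1 : ZMod (p ^ 2)), ← hαβ, add_smul, mul_smul, hpp, smul_zero, zero_add]
        simp
      rw [this]
      exact L.smul_mem _ hx
  by_cases hpL : (p : ℤ) • (1 : ZMod (p ^ 2)) ∈ L
  -- Now p generates L, and f(p) is killed by p; the extension sends 1 to a y with p y = f(p).
  · obtain ⟨y, hy⟩ := hM (f ⟨_, hpL⟩) (by
      rw [← map_smul]
      convert map_zero f
      refine Subtype.ext ?_
      change (p : ℤ) • (p : ℤ) • (1 : ZMod (p ^ 2)) = 0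
      rw [smul_smul, ← sq, hpp])
    have hy0 : ((p ^ 2 : ℕ) : ℤ) • y = 0 := by
      have h0 : (p : ℤ) • f ⟨_, hpL⟩ = 0 := by
        rw [← map_smul]
        convert map_zero f
        refine Subtype.ext ?_
        change (p : ℤ) • (p : ℤ) • (1 : ZMod (p ^ 2)) = 0
        rw [smul_smul, ← sq, hpp]
      push_cast
      rw [sq, mul_smul, hy, h0]
    let g := ZMod.lift (p ^ 2) ⟨zmultiplesHom M y, by simpa using hy0⟩
    refine ⟨g.toIntLinearMap, fun x => ?_⟩
    obtain ⟨c, hc⟩ := hL x x.2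
    have hx : x = c • (⟨_, hpL⟩ : L) := Subtype.ext hc
    have hg1 : g 1 = y := by
      have := ZMod.lift_coe (p ^ 2) ⟨zmultiplesHom M y, by simpa using hy0⟩ 1
      simpa [g] using this
    rw [hx, map_smul, ← hy]
    change g (c • (p : ℤ) • (1 : ZMod (p ^ 2))) = _
    rw [map_zsmul, map_zsmul, hg1]
  · refine ⟨0, fun x => ?_⟩
    have hx : x = 0 := by
      obtain ⟨c, hc⟩ := hL x x.2
      by_cases hpc : (p : ℤ) ∣ c
      · obtain ⟨d, rfl⟩ := hpc
        refine Subtype.ext (hc.trans ?_)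
        rw [mul_comm, mul_smul, smul_smul (p : ℤ) (p : ℤ), ← sq, hpp, smul_zero]; rfl
      · exfalso
        obtain ⟨α, β, hαβ⟩ := hp'.coprime_iff_not_dvd.2 hpc
        apply hpL
        have : (p : ℤ) • (1 : ZMod (p ^ 2)) = β • (x : ZMod (p ^ 2)) := by
          rw [hc, smul_smul β, eq_sub_of_add_eq' hαβ, sub_smul, one_smul, smul_smul (α * p), mul_assoc,
            ← sq, mul_smul α, hpp, smul_zero, sub_zero]
        rw [this]
        exact L.smul_mem _ x.2
    rw [hx, map_zero, LinearMap.zero_apply]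

/-- The multiples of p have no complement C: writing 1 = p a + c with c in C gives p = p c ∈ C,
although p ≠ 0. -/
theorem not_isSemisimpleModule_zmod_prime_sq {p : ℕ} (hp : p.Prime) :
    ¬ IsSemisimpleModule ℤ (ZMod (p ^ 2)) := by
  intro h
  have hpp : (p : ℤ) • (p : ℤ) • (1 : ZMod (p ^ 2)) = 0 := by
    have := zsmul_zmod_self (p ^ 2) 1
    push_cast at this
    rw [smul_smul, ← sq, this]
  obtain ⟨C, hC⟩ := exists_isCompl (LinearMap.range (LinearMap.lsmul ℤ (ZMod (p ^ 2)) (p : ℤ)))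
  obtain ⟨_, ⟨a, rfl⟩, c, hc, hac⟩ :=
    Submodule.mem_sup.1 (hC.sup_eq_top ▸ Submodule.mem_top : (1 : ZMod (p ^ 2)) ∈ _)
  obtain ⟨a, rfl⟩ := ZMod.intCast_surjective a
  have ha : (a : ZMod (p ^ 2)) = a • 1 := by simp
  have h1 : (p : ℤ) • (1 : ZMod (p ^ 2)) = (p : ℤ) • c := by
    rw [← hac, smul_add, LinearMap.lsmul_apply, ha, smul_comm _ a, smul_comm _ a, hpp, smul_zero,
      zero_add]
  have h2 := (Submodule.disjoint_def.1 hC.disjoint) ((p : ℤ) • (1 : ZMod (p ^ 2))) ⟨1, rfl⟩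
    (h1 ▸ C.smul_mem _ hc)
  have h3 : ((p : ℕ) : ZMod (p ^ 2)) = 0 := by simpa using h2
  rw [ZMod.natCast_eq_zero_iff] at h3
  have := Nat.le_of_dvd hp.pos h3
  have := hp.two_le
  nlinarith

theorem not_isPoor_of_forall_exists {M : Type u} [AddCommGroup M] {p : ℕ} (hp : p.Prime)
    (hM : ∀ x : M, (p : ℤ) • x = 0 → ∃ y, (p : ℤ) • y = x) : ¬ IsPoor.{u, v} M := by
  intro h
  let e : ZMod (p ^ 2) ≃+ ULift.{v} (ZMod (p ^ 2)) := AddEquiv.ulift.symm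
  have h1 := h _ ((isRelInjective_zmod_prime_sq hp hM).congr_right e)
  exact not_isSemisimpleModule_zmod_prime_sq hp
    (IsSemisimpleModule.congr e.toIntLinearEquiv)

/-! ### A set of representatives of the uniform groups -/

theorem exists_prime_zsmul_eq_zero {U : Type u} [AddCommGroup U] (n : ℕ) (hn : n ≠ 0) (x : U)
    (hx0 : x ≠ 0) (hx : (n : ℤ) • x = 0) :
    ∃ r : ℕ, r.Prime ∧ ∃ y : U, y ≠ 0 ∧ (r : ℤ) • y = 0 := by
  induction n using Nat.recOnMul generalizing x with
  | zero => exact absurd rfl hn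
  | one => exact absurd (by simpa using hx) hx0
  | prime r hr => exact ⟨r, hr, x, hx0, hx⟩
  | mul a b iha ihb =>
    push_cast at hx
    by_cases hb : (b : ℤ) • x = 0
    · exact ihb (right_ne_zero_of_mul hn) x hx0 hb
    · exact iha (left_ne_zero_of_mul hn) _ hb (by rwa [smul_smul])

/-- This confines uniform groups to one fixed ambient group, so representatives can be chosen. With
torsion, a character nonzero on an element of prime order is injective, since that element is a
multiple of every nonzero one; without torsion, extend x ↦ 1 into ℚ. -/
theorem IsUniformAbGroup.exists_injective {U : Type u} [AddCommGroup U]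
    (hU : IsUniformAbGroup U) :
    ∃ f : U →ₗ[ℤ] ℚ × AddCircle (1 : ℚ), Function.Injective f := by
  rw [isUniformAbGroup_iff] at hU
  obtain ⟨_, hU⟩ := hU
  by_cases htor : ∃ x : U, x ≠ 0 ∧ ∃ n : ℕ, n ≠ 0 ∧ (n : ℤ) • x = 0
  · obtain ⟨x, hx0, n, hn, hnx⟩ := htor
    obtain ⟨r, hr, y, hy0, hry⟩ := exists_prime_zsmul_eq_zero n hn x hx0 hnx
    obtain ⟨c, hc⟩ := CharacterModule.exists_character_apply_ne_zero_of_ne_zero hy0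
    let φ : U →ₗ[ℤ] AddCircle (1 : ℚ) := AddMonoidHom.toIntLinearMap c
    have hφ : Function.Injective φ := by
      rw [injective_iff_map_eq_zero]
      intro z hz
      by_contra hz0
      obtain ⟨a, b, hab, ha⟩ := hU y z hy0 hz0
      have hra : ¬ (r : ℤ) ∣ a := by
        rintro ⟨d, rfl⟩
        exact ha (by rw [mul_comm, mul_smul, hry, smul_zero])
      obtain ⟨α, β, hαβ⟩ := (Nat.prime_iff_prime_int.1 hr).coprime_iff_not_dvd.2 hra
      have hy : y = (β * b) • z := by
        rw [mul_smul, ← hab, smul_smul]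
        nth_rewrite 1 [← one_smul ℤ y]
        rw [← hαβ, add_smul, mul_smul α, hry, smul_zero, zero_add]
      apply hc
      change φ y = 0
      rw [hy, map_smul, hz, smul_zero]
    exact ⟨(LinearMap.inr ℤ ℚ _).comp φ, LinearMap.inr_injective.comp hφ⟩
  · push Not at htor
    have htf : ∀ (x : U) (n : ℤ), x ≠ 0 → n • x = 0 → n = 0 := by
      intro x n hx hn
      by_contra h0
      refine htor x hx n.natAbs (by simpa using h0) ?_
      rcases Int.natAbs_eq n with h | h
      · rwa [← h]
      · rw [show (n.natAbs : ℤ) = -n by omega, neg_smul, hn, neg_zero]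
    obtain ⟨x, hx0⟩ := exists_ne (0 : U)
    have hinj : Function.Injective (LinearMap.toSpanSingleton ℤ U x) := by
      rw [injective_iff_map_eq_zero]
      exact fun n hn => htf x n hx0 hn
    obtain ⟨φ, hφ⟩ := (Module.Baer.of_divisible ℚ).extension_property _ hinj
      (Int.castAddHom ℚ).toIntLinearMap
    have hφx : φ x = 1 := by
      have := congrArg (fun k => k 1) hφ
      simpa using this
    have hφ' : Function.Injective φ := by
      rw [injective_iff_map_eq_zero]
      intro z hz
      by_contra hz0
      obtain ⟨a, b, hab, ha⟩ := hU x z hx0 hz0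
      have h1 := congrArg φ hab
      rw [map_smul, map_smul, hz, hφx, smul_zero] at h1
      have h2 : a = 0 := by simpa using h1
      exact ha (by rw [h2, zero_smul])
    exact ⟨(LinearMap.inl ℤ ℚ _).comp φ, LinearMap.inl_injective.comp hφ'⟩

/-- Isomorphism of the uniform subgroups of `ℚ × ℚ/ℤ`. -/
def uniformSetoid :
    Setoid {S : Submodule ℤ (ℚ × AddCircle (1 : ℚ)) // IsUniformAbGroup S} where
  r S T := Nonempty (S.1 ≃+ T.1)
  iseqv := ⟨fun _ => ⟨AddEquiv.refl _⟩, fun ⟨e⟩ => ⟨e.symm⟩, fun ⟨e⟩ ⟨f⟩ => ⟨e.trans f⟩⟩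

/-- A representative of an isomorphism class of uniform groups. -/
abbrev uniformRepresentative (γ : Quotient uniformSetoid) : Type u :=
  ULift.{u} (Quotient.out γ).1

theorem isUniformRepresentatives_uniformRepresentative :
    IsUniformRepresentatives uniformRepresentative.{u} where
  uniform γ := (Quotient.out γ).2.of_equiv AddEquiv.ulift.symm
  exists_equiv U _ hU := by
    obtain ⟨f, hf⟩ := hU.exists_injective
    let e : U ≃+ LinearMap.range f := (LinearEquiv.ofInjective f hf).toAddEquiv
    let S : {S : Submodule ℤ (ℚ × AddCircle (1 : ℚ)) // IsUniformAbGroup S} :=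
      ⟨LinearMap.range f, hU.of_equiv e⟩
    obtain ⟨i⟩ : Nonempty (S.1 ≃+ (Quotient.out (Quotient.mk uniformSetoid S)).1) :=
      uniformSetoid.symm' (Quotient.mk_out (s := uniformSetoid) S)
    exact ⟨Quotient.mk uniformSetoid S, ⟨e.trans (i.trans AddEquiv.ulift.symm)⟩⟩
  eq_of_equiv γ δ := by
    rintro ⟨e⟩
    rw [← Quotient.out_eq γ, ← Quotient.out_eq δ]
    exact Quotient.sound (s := uniformSetoid) ⟨AddEquiv.ulift.symm.trans (e.trans AddEquiv.ulift)⟩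

/-! ### The main theorem -/

theorem mainTheorem9 :
    (∀ (p : ℕ), p.Prime →
      ∀ (Γ : Type w) (A : Γ → Type u) [∀ γ, AddCommGroup (A γ)],
        IsUniformRepresentatives A →
          (∃ K : Submodule ℤ (CountableCopiesSum A), IsCompl (primeSummands A p) K) ∧
          ∀ K : Submodule ℤ (CountableCopiesSum A), IsCompl (primeSummands A p) K →
            IsPiPoor.{max w u, v} K ∧ ¬ IsPoor.{max w u, v} K) ∧
    (IsPoor.{0, v} (⨁ p : Nat.Primes, ZMod (p : ℕ)) ∧
      ¬ IsPiPoor.{0, v} (⨁ p : Nat.Primes, ZMod (p : ℕ))) ∧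
    (¬ ∀ (G : Type u) [AddCommGroup G], IsPiPoor.{u, v} G → IsPoor.{u, v} G) ∧
    (¬ ∀ (G : Type u) [AddCommGroup G], IsPoor.{u, v} G → IsPiPoor.{u, v} G) := by
  refine ⟨fun p hp Γ A _ hA => ⟨exists_isCompl_primeSummands A p, fun K hK =>
    ⟨isPiPoor_complement hp hA hK,
      not_isPoor_of_forall_exists hp (exists_zsmul_eq_complement hp hA hK)⟩⟩,
    ⟨isPoor_directSum_zmod_prime, not_isPiPoor_directSum_zmod_prime⟩, fun h => ?_, fun h => ?_⟩
  · have hA := isUniformRepresentatives_uniformRepresentative.{u}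
    obtain ⟨K, hK⟩ := exists_isCompl_primeSummands uniformRepresentative.{u} 2
    exact not_isPoor_of_forall_exists Nat.prime_two
      (exists_zsmul_eq_complement Nat.prime_two hA hK)
      (h K (isPiPoor_complement Nat.prime_two hA hK))
  · let e : (⨁ p : Nat.Primes, ZMod (p : ℕ)) ≃+ ULift.{u} (⨁ p : Nat.Primes, ZMod (p : ℕ)) :=
      AddEquiv.ulift.symm
    exact not_isPiPoor_directSum_zmod_prime
      ((h _ (isPoor_directSum_zmod_prime.of_equiv e)).of_equiv e.symm)
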